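/- **Setting.** Let $d\ge 1$, $\Omega\subset\mathbb R^d$ compact, $Y$ a real Hilbert space, $\alpha>0$, $\kappa:\Omega\to Y$ Hölder continuous, and $F:Y\to[0,\infty)$ strictly convex and continuously Fréchet differentiable with Lipschitz gradient. Let $\mathcal M=C(\Omega)^*$ be the space of Radon measures, $Ku=\int_\Omega\kappa\,du$, $J(u)=F(Ku)+\alpha\|u\|_{\mathcal M}$, $r_J(u)=J(u)-\min_{\mathcal M}J$, $p_u(x)=-(\kappa(x),\nabla F(Ku))_Y$ and $\varphi(u,v)=\langle p_u,v-u\rangle+\alpha\|u\|-\alpha\|v\|$. A measure is sparse if it is a finite sum of Diracs; its support is $\mathcal A_u$, and $u(\{x\})$ are its weights. Let $\bar u$ be a minimizer of $J$, $\bar p=p_{\bar u}$, and assume that for some $\gamma,\theta,R',\sigma'>0$ with $\sigma'<\alpha$: (B1) $(\nabla F(y_1)-\nabla F(y_2),y_1-y_2)_Y\ge\gamma\|y_1-y_2\|_Y^2$ for $y_1,y_2$ in a neighbourhood of $K\bar u$; (B2) $\bar{\mathcal A}=\{x\in\Omega: |\bar p(x)|=\alpha=\|\bar p\|_{C(\Omega)}\}$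 is finite and contained in $\operatorname{int}\Omega$, and $\{\kappa(x)\}_{x\in\bar{\mathcal A}}$ is linearly independent; (B3) with $\Omega_r=\bigcup_{\bar x\in\bar{\mathcal A}}B_r(\bar x)$ one has $\Omega_{R'}\subset\operatorname{int}\Omega$, $\kappa\in C^2(\overline{\Omega_{R'}};Y)$, $|\bar p|\le\alpha-\sigma'$ on $\Omega\setminus\overline{\Omega_{R'}}$, and the balls $B_{2R'}(\bar x)$, $\bar x\in\bar{\mathcal A}$, are pairwise disjoint; (B4) $-\operatorname{sign}(\bar p(\bar x))\nabla^2\bar p(\bar x)\ge\theta\,\mathrm{Id}$ for $\bar x\in\bar{\mathcal A}$; (B5) $\operatorname{supp}\bar u=\bar{\mathcal A}$. **Parameters.** Call $(R,\sigma)$ *localizing* if there is $\Delta>0$ such that every $u\in\mathcal M$ with $r_J(u)\le\Delta$ satisfies: for each $\bar x\in\bar{\mathcal A}$, on $B_R(\bar x)$ the sign of $p_u$ is constantly $\operatorname{sign}\bar p(\bar x)$, $|p_u|$ has a unique local maximizer $\hat x$, and for all $x\in B_R(\bar x)$: $|p_u(\hat x)|-|p_u(x)|\le 2R\|\nabla p_u(x)\|$,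 $|p_u(\hat x)|-|p_u(x)|\ge\frac\theta8\|\hat x-x\|^2$ and $-\operatorname{sign}(p_u(x))\nabla^2p_u(x)\ge\frac\theta4\mathrm{Id}$; and $|p_u|\le\alpha-\sigma/2$ on $\Omega\setminus\overline{\Omega_R}$. The algorithm uses constants $\gamma,\theta$ as above, a localizing pair $(R,\sigma)$ with $0<R<R'$ and $0<\sigma\le\sigma'$, a Lipschitz constant $L>0$ of $\nabla F$, $C_K>0$ with $\|\kappa\|_{C(\Omega;Y)}\le C_K$, $C_{K'}>0$ with $\|\kappa\|_{C^1(\overline{\Omega_{R'}};Y)}\le C_{K'}$, a sparse $u_0$, $M>0$ with $\|v\|_{\mathcal M}\le M$ whenever $J(v)\le J(u_0)$, $\varepsilon_1>0$ with $r_J(u_0)\le2M\varepsilon_1$, $\Psi_1>0$, and $C=4LM^2C_K^2$. **Subroutines.** Put $v_u(x)=M\operatorname{sign}(p_u(x))\delta_x$. *DropStep*$(u)$: let $u^{\rm drop}$ be $u$ without its atoms $x\in\mathcal A_u$ with $\operatorname{sign}p_u(x)\ne\operatorname{sign}u(\{x\})$ or $|p_u(x)|\le\alpha-\sigma/2$;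 return $u^{\rm drop}$ if $J(u^{\rm drop})\le J(u)$, else $u$. *CoefficientStep*$(u,\Psi)$: for positive measures $w$ on $\mathcal A_u$ let $v^u_w=\sum_{x\in\mathcal A_u}\operatorname{sign}(u(\{x\}))w(\{x\})\delta_x$, $K^uw=Kv^u_w$, $J^u(w)=F(K^uw)+\alpha\|w\|$, $p^u_w(x)=-\operatorname{sign}(u(\{x\}))(\kappa(x),\nabla F(K^uw))_Y$, and $\Phi^u(w)=\max\{\langle p^u_w,v-w\rangle+\alpha\|w\|-\alpha\|v\|\}$ over positive measures $v$ on $\mathcal A_u$ with $\|v\|\le M$. Find such a $w_+$ with $J^u(w_+)\le J^u(\sum_{x\in\mathcal A_u}|u(\{x\})|\delta_x)$ and $\Phi^u(w_+)\le\Psi$; return $u_+=v^u_{w_+}$ and $w_+$. *LSIStep*$(u)$: let $\Phi_{\mathcal A_u}(u)=\max\varphi(u,v)$ over measures $v$ on $\mathcal A_u$ with $\|v\|\le M$. Start with $\mathcal A=\mathcal A_u$, $\mathcal B=\emptyset$; while $\mathcal A\ne\emptyset$ choose $x\in\arg\max_{\mathcal A}|p_u|$, find, if one exists, $y\in\Omega\cap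 B_{2R}(x)$ with $|p_u(y)|>\alpha-\sigma/2$, $\|\nabla p_u(y)\|\le\Phi_{\mathcal A_u}(u)$ and $|p_u(y)|-\max_{\mathcal A_u\cap B_{2R}(x)}|p_u|\ge2R\|\nabla p_u(y)\|$, add it to $\mathcal B$, and replace $\mathcal A$ by $\mathcal A\setminus B_{2R}(x)$. If $\mathcal B=\emptyset$ return $u$. Otherwise choose $\hat x\in\arg\max_{x\in\mathcal B}[|p_u(x)|-\max_{\mathcal A_u\cap B_{2R}(x)}|p_u|]$ and return $(1-\eta)u+\eta\sum_{x\in\mathcal B}u(B_{2R}(x))\delta_x$ with $$\eta=\min\Big\{1,\ |u(B_{2R}(\hat x))|\Big/\Big(16MLC_{K'}^2\big(2M\sqrt{R/\theta}+2MC_{K'}L/(\theta\sqrt\gamma)+\sqrt{M/\theta}\big)^2\Big)\Big\}.$$ *LGCGStep*$(u,\varepsilon,C)$: if some $v\in\{0\}\cup\{v_u(x):x\in\Omega\}$ satisfies $\varphi(u,v)\ge M\varepsilon$, take such a $v$, $\eta=\min\{1,M\varepsilon/C\}$, $\varepsilon_+=\varepsilon$; otherwise take $v=0$ if $\|p_u\|_{C(\Omega)}<\alpha$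 and $v=v_u(\hat x)$ with $\hat x\in\arg\max|p_u|$ else, $\eta=\min\{1,\varphi(u,v)/C\}$, $\varepsilon_+=\varphi(u,v)/(2M)$. Return $(1-\eta)u+\eta v$, $v$, $\varepsilon_+$. **LPDAP.** Set $u_{1-}=$ DropStep$(u_0)$. For $k=1,2,\dots$: (i) $(u_k,w_k)=$ CoefficientStep$(u_{k-},\Psi_k)$, $\tilde u_{k+}=$ LSIStep$(u_k)$, $(\hat u_{k+},v_k,\varepsilon_{k+1})=$ LGCGStep$(u_k,\varepsilon_k,C)$; terminate if $\varepsilon_{k+1}=0$; (ii) if $\Phi^{u_{k-}}(w_k)>\varphi(u_k,v_k)/2$, halve $\Psi_k$ and repeat (i) from the same $u_{k-}$ and $\varepsilon_k$ (a *recompute step*); (iii) otherwise set $\Psi_{k+1}=\Psi_k$, let $u_{k+}$ be one of $\tilde u_{k+},\hat u_{k+}$ with the smaller value of $J$, and $u_{(k+1)-}=$ DropStep$(u_{k+})$. Let $u_{k,s}$ denote the iterate $u_k$ computed in outer iteration $k$ after $s$ recompute steps in total (counted from the start of the run). **Theorem.** Localizing pairs exist: there is $\tilde R\in(0,R']$ such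 that for every $R\in(0,\tilde R)$ there is $\sigma\in(0,\sigma']$ with $(R,\sigma)$ localizing. Moreover, for every choice of the parameters as above, every run of LPDAP, and every $\zeta\in(0,1)$ (in particular for the asymptotic linear contraction factor of the method), there is $\check C>0$ such that for all $0<\epsilon<\zeta$ and all pairs $(k,s)$ occurring in the run $$k+s\ \ge\ \check C\log_\zeta(\epsilon)\quad\Longrightarrow\quad r_J(u_{k,s})\le\epsilon .$$ In particular $\check C$ is independent of $\epsilon$, so the total number of outer and recompute iterations needed grows only logarithmically in $1/\epsilon$. -/

import Mathlib

open Set Filter Topology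

namespace SparseMin

/-- The space of Radon measures on the compact set `Ω`, as the topological dual of `C(Ω)`; the
dual norm is the total variation norm and `u f` is the duality pairing. -/
abbrev RadonMeasure {d : ℕ} (Ω : TopologicalSpace.Compacts (EuclideanSpace ℝ (Fin d))) : Type :=
  StrongDual ℝ C(Ω, ℝ)

/-- A sparse measure `∑ λʲ δ_{xʲ}` with distinct points and nonzero coefficients. Its support is
`u.support` and `u x` is the mass `u({x})`. -/
abbrev SparseMeasure {d : ℕ} (Ω : TopologicalSpace.Compacts (EuclideanSpace ℝ (Fin d))) : Type :=
  Ω →₀ ℝ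

/-- The Dirac functional at `x`. -/
noncomputable def dirac {d : ℕ} {Ω : TopologicalSpace.Compacts (EuclideanSpace ℝ (Fin d))}
    (x : Ω) : RadonMeasure Ω :=
  ContinuousMap.evalCLM ℝ x

/-- A sparse measure regarded as a Radon measure. -/
noncomputable def toRadon {d : ℕ} {Ω : TopologicalSpace.Compacts (EuclideanSpace ℝ (Fin d))}
    (u : SparseMeasure Ω) : RadonMeasure Ω :=
  u.sum fun x a => a • dirac x

/-- The support of a Radon measure: the points all of whose neighbourhoods are charged. -/
def supp {d : ℕ} {Ω : TopologicalSpace.Compacts (EuclideanSpace ℝ (Fin d))}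
    (u : RadonMeasure Ω) : Set Ω :=
  {x | ∀ U ∈ 𝓝 x, ∃ f : C(Ω, ℝ), (∀ y, y ∉ U → f y = 0) ∧ u f ≠ 0}

/-- The mass `u(B_r(x))` of the open ball of radius `r` around `x`. -/
noncomputable def ballMass {d : ℕ} {Ω : TopologicalSpace.Compacts (EuclideanSpace ℝ (Fin d))}
    (u : SparseMeasure Ω) (x : Ω) (r : ℝ) : ℝ :=
  ∑ z ∈ u.support with dist z x < r, u z

/-- `f ∈ C^n` on the closure of the open set `U`: `f` is `n` times continuously differentiable on
`U` and all derivatives up to order `n` extend continuously to the closure. -/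
def ContDiffClosure {E Y : Type*} [NormedAddCommGroup E] [NormedSpace ℝ E]
    [NormedAddCommGroup Y] [NormedSpace ℝ Y] (n : ℕ) (f : E → Y) (U : Set E) : Prop :=
  ContDiffOn ℝ n f U ∧
    ∀ m ≤ n, ∃ g : E → ContinuousMultilinearMap ℝ (fun _ : Fin m => E) Y,
      ContinuousOn g (closure U) ∧ EqOn g (iteratedFDeriv ℝ m f) U

/-- The data of the problem `min F(Ku) + α ‖u‖` over the Radon measures on `Ω`, with the standing
regularity assumptions. Only the values of the kernel `κ` on `Ω` matter. -/
structure Problem (d : ℕ) (Y : Type*) [NormedAddCommGroup Y] [InnerProductSpace ℝ Y]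
    [CompleteSpace Y] where
  Ω : TopologicalSpace.Compacts (EuclideanSpace ℝ (Fin d))
  κ : EuclideanSpace ℝ (Fin d) → Y
  F : Y → ℝ
  α : ℝ
  α_pos : 0 < α
  holder_κ : ∃ ν : NNReal, 0 < ν ∧ ∃ c : NNReal, HolderOnWith c ν κ Ω
  F_nonneg : ∀ y, 0 ≤ F y
  F_strictConvex : StrictConvexOn ℝ univ F
  F_contDiff : ContDiff ℝ 1 F
  F_lipschitz : ∃ l : NNReal, LipschitzWith l (gradient F)

namespace Problem

variable {d : ℕ} {Y : Type*} [NormedAddCommGroup Y] [InnerProductSpace ℝ Y] [CompleteSpace Y]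
variable (P : Problem d Y)

/-- The kernel as a continuous function on `Ω`. -/
def kernel : C(P.Ω, Y) where
  toFun x := P.κ x
  continuous_toFun := by
    obtain ⟨ν, hν, c, hc⟩ := P.holder_κ
    exact (hc.continuousOn hν).domRestrict

/-- The operator `K_* : Y → C(Ω)`, `[K_* y](x) = (κ(x), y)`. -/
noncomputable def Kstar : Y →L[ℝ] C(P.Ω, ℝ) :=
  LinearMap.mkContinuous
    { toFun := fun y => ⟨fun x => inner ℝ (P.kernel x) y, by fun_prop⟩
      map_add' := fun y z => by ext x; simp [inner_add_right]
      map_smul' := fun a y => by ext x; simp [inner_smul_right] }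
    ‖P.kernel‖
    (fun y => by
      refine (ContinuousMap.norm_le _ (by positivity)).2 fun x => ?_
      exact (norm_inner_le_norm (𝕜 := ℝ) _ _).trans
        (mul_le_mul_of_nonneg_right (P.kernel.norm_coe_le_norm x) (norm_nonneg y)))

/-- The integral `Ku = ∫ κ du`: the element of `Y` with `(Ku, y) = ⟨K_* y, u⟩` for all `y`. -/
noncomputable def K (u : RadonMeasure P.Ω) : Y :=
  (InnerProductSpace.toDual ℝ Y).symm (u.comp P.Kstar)

noncomputable def J (u : RadonMeasure P.Ω) : ℝ := P.F (P.K u) + P.α * ‖u‖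

/-- The residual `r_J(u) = J(u) - min J`. -/
noncomputable def residual (u : RadonMeasure P.Ω) : ℝ := P.J u - ⨅ v, P.J v

/-- The dual variable `p_u = -K_* ∇F(Ku)`. -/
noncomputable def p (u : RadonMeasure P.Ω) : C(P.Ω, ℝ) := -P.Kstar (gradient P.F (P.K u))

/-- The dual variable as a function on the ambient space; it agrees with `P.p u` on `Ω`. -/
noncomputable def pFun (u : RadonMeasure P.Ω) (x : EuclideanSpace ℝ (Fin d)) : ℝ :=
  -inner ℝ (P.κ x) (gradient P.F (P.K u))

/-- `φ(u, v) = ⟨p_u, v - u⟩ + α ‖u‖ - α ‖v‖`. -/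
noncomputable def gap (u v : RadonMeasure P.Ω) : ℝ :=
  (v - u) (P.p u) + P.α * ‖u‖ - P.α * ‖v‖

/-- The union of the open balls of radius `r` around the points of `A`. -/
def ballUnion (A : Finset (EuclideanSpace ℝ (Fin d))) (r : ℝ) : Set (EuclideanSpace ℝ (Fin d)) :=
  ⋃ x ∈ A, Metric.ball x r

/-- Structural assumptions on the minimizer `ubar` and its dual variable. -/
structure IsNondegenerate (ubar : RadonMeasure P.Ω) (Abar : Finset (EuclideanSpace ℝ (Fin d)))
    (R' σ' γ θ : ℝ) : Prop where
  minimizer : ∀ v, P.J ubar ≤ P.J v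
  γ_pos : 0 < γ
  strongConvex : ∃ N ∈ 𝓝 (P.K ubar), ∀ y₁ ∈ N, ∀ y₂ ∈ N,
    γ * ‖y₁ - y₂‖ ^ 2 ≤ inner ℝ (gradient P.F y₁ - gradient P.F y₂) (y₁ - y₂)
  subset_interior : (Abar : Set (EuclideanSpace ℝ (Fin d))) ⊆ interior (P.Ω : Set _)
  active : (Abar : Set (EuclideanSpace ℝ (Fin d))) =
    {x | x ∈ P.Ω ∧ |P.pFun ubar x| = P.α ∧ ‖P.p ubar‖ = P.α}
  linearIndependent : LinearIndependent ℝ fun x : Abar => P.κ x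
  R'_pos : 0 < R'
  σ'_pos : 0 < σ'
  σ'_lt : σ' < P.α
  contDiff_κ : ContDiffClosure 2 P.κ (ballUnion Abar R')
  ballUnion_subset : ballUnion Abar R' ⊆ interior (P.Ω : Set _)
  away : ∀ x ∈ (P.Ω : Set _) \ closure (ballUnion Abar R'), |P.pFun ubar x| ≤ P.α - σ'
  disjoint : ∀ x ∈ Abar, ∀ y ∈ Abar, x ≠ y →
    Disjoint (Metric.ball x (2 * R')) (Metric.ball y (2 * R'))
  θ_pos : 0 < θ
  curvature : ∀ x ∈ Abar, ∀ h : EuclideanSpace ℝ (Fin d),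
    θ * ‖h‖ ^ 2 ≤
      -(Real.sign (P.pFun ubar x) * fderiv ℝ (fderiv ℝ (P.pFun ubar)) x h h)
  complementary : (fun x : P.Ω => (x : EuclideanSpace ℝ (Fin d))) '' supp ubar = Abar

/-- `(R, σ)` is an admissible choice of localization parameters: on some sublevel set of the
residual, every dual variable `p_u` has constant sign and is uniformly concave up to sign on each
ball `B_R(xbar)`, has exactly one local maximizer of `|p_u|` there, and satisfies
`|p_u| ≤ α - σ/2` outside the balls. -/
def IsLocalization (ubar : RadonMeasure P.Ω) (Abar : Finset (EuclideanSpace ℝ (Fin d)))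
    (θ R σ : ℝ) : Prop :=
  ∃ Δ > 0, ∀ u : RadonMeasure P.Ω, P.residual u ≤ Δ →
    (∀ xbar ∈ Abar,
      (∀ x ∈ Metric.ball xbar R,
        Real.sign (P.pFun u x) = Real.sign (P.pFun ubar xbar)) ∧
      (∃ xhat ∈ Metric.ball xbar R,
        (∀ x ∈ Metric.ball xbar R, IsLocalMax (fun y => |P.pFun u y|) x ↔ x = xhat) ∧
        (∀ x ∈ Metric.ball xbar R,
          |P.pFun u xhat| - |P.pFun u x| ≤ 2 * R * ‖gradient (P.pFun u) x‖) ∧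
        (∀ x ∈ Metric.ball xbar R,
          θ / 8 * ‖xhat - x‖ ^ 2 ≤ |P.pFun u xhat| - |P.pFun u x|)) ∧
      (∀ x ∈ Metric.ball xbar R, ∀ h : EuclideanSpace ℝ (Fin d),
        θ / 4 * ‖h‖ ^ 2 ≤
          -(Real.sign (P.pFun u x) * fderiv ℝ (fderiv ℝ (P.pFun u)) x h h))) ∧
    (∀ x ∈ (P.Ω : Set _) \ closure (ballUnion Abar R), |P.pFun u x| ≤ P.α - σ / 2)

end Problem

/-- The constants used by the algorithm. -/
structure Params where
  γ : ℝ
  θ : ℝ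
  R : ℝ
  σ : ℝ
  L : ℝ
  CK : ℝ
  CK' : ℝ
  M : ℝ

section Algorithm

variable {d : ℕ} {Y : Type*} [NormedAddCommGroup Y] [InnerProductSpace ℝ Y] [CompleteSpace Y]
variable (P : Problem d Y) (c : Params)

/-- `M` times the signed Dirac measure, `v_u(x) = M sign(p_u(x)) δ_x`. -/
noncomputable def diracDirection (u : SparseMeasure P.Ω) (x : P.Ω) : SparseMeasure P.Ω :=
  Finsupp.single x (c.M * Real.sign (P.p (toRadon u) x))

/-- Lazy directions for `u` at tolerance `ε`. -/
def IsLazy (u : SparseMeasure P.Ω) (ε : ℝ) (v : SparseMeasure P.Ω) : Prop :=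
  (v = 0 ∨ ∃ x, v = diracDirection P c u x) ∧ c.M * ε ≤ P.gap (toRadon u) (toRadon v)

/-- The direction used in an exact call. -/
def IsExact (u v : SparseMeasure P.Ω) : Prop :=
  (‖P.p (toRadon u)‖ < P.α ∧ v = 0) ∨
    (P.α ≤ ‖P.p (toRadon u)‖ ∧ ∃ x, (∀ y, |P.p (toRadon u) y| ≤ |P.p (toRadon u) x|) ∧
      v = diracDirection P c u x)

/-- `LGCGStep(u, ε, C)` may return `(u₊, v, ε₊)`: a lazy call if a lazy direction exists, and an
exact call otherwise. -/
def LGCGStep (u : SparseMeasure P.Ω) (ε C : ℝ) (uplus v : SparseMeasure P.Ω) (εplus : ℝ) : Prop :=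
  (IsLazy P c u ε v ∧ εplus = ε ∧
      uplus = (1 - min 1 (c.M * ε / C)) • u + min 1 (c.M * ε / C) • v) ∨
    ((∀ v', ¬ IsLazy P c u ε v') ∧ IsExact P c u v ∧
      εplus = P.gap (toRadon u) (toRadon v) / (2 * c.M) ∧
      uplus = (1 - min 1 (P.gap (toRadon u) (toRadon v) / C)) • u +
        min 1 (P.gap (toRadon u) (toRadon v) / C) • v)

open Classical in
/-- The restriction of `u` to the complement of the drop set
`{x ∈ supp u | sign p_u(x) ≠ sign u({x}) or |p_u(x)| ≤ α - σ/2}`. -/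
noncomputable def drop (u : SparseMeasure P.Ω) : SparseMeasure P.Ω :=
  u.filter fun x => ¬ (Real.sign (P.p (toRadon u) x) ≠ Real.sign (u x) ∨
    |P.p (toRadon u) x| ≤ P.α - c.σ / 2)

open Classical in
/-- `DropStep(u)`. -/
noncomputable def dropStep (u : SparseMeasure P.Ω) : SparseMeasure P.Ω :=
  if P.J (toRadon (drop P c u)) ≤ P.J (toRadon u) then drop P c u else u

/-- Positive measures supported in the support of `u`. -/
def positiveOn {Ω : TopologicalSpace.Compacts (EuclideanSpace ℝ (Fin d))}
    (u : SparseMeasure Ω) : Set (SparseMeasure Ω) :=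
  {w | w.support ⊆ u.support ∧ ∀ x, 0 ≤ w x}

/-- `K^u w = ∑ κ(x) sign(u({x})) w({x})` over the support of `u`. -/
noncomputable def signedK (u w : SparseMeasure P.Ω) : Y :=
  ∑ x ∈ u.support, (Real.sign (u x) * w x) • P.κ x

/-- `J^u(w) = F(K^u w) + α ‖w‖`. -/
noncomputable def signedJ (u w : SparseMeasure P.Ω) : ℝ :=
  P.F (signedK P u w) + P.α * ‖toRadon w‖

/-- The dual variable `p^u_w = -K^u_* ∇F(K^u w)` at points of the support of `u`. -/
noncomputable def signedP (u w : SparseMeasure P.Ω) (x : P.Ω) : ℝ :=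
  -(Real.sign (u x) * inner ℝ (P.κ x) (gradient P.F (signedK P u w)))

/-- `φ^u(w, v) = ⟨p^u_w, v - w⟩ + α ‖w‖ - α ‖v‖`. -/
noncomputable def signedGap (u w v : SparseMeasure P.Ω) : ℝ :=
  ∑ x ∈ u.support, signedP P u w x * (v x - w x) + P.α * ‖toRadon w‖ - P.α * ‖toRadon v‖

/-- `Φ^u(w)`, the maximum of `φ^u(w, ·)` over positive measures on the support of `u` with norm
at most `M`. -/
noncomputable def signedDualGap (u w : SparseMeasure P.Ω) : ℝ :=
  sSup (signedGap P u w '' {v | v ∈ positiveOn u ∧ ‖toRadon v‖ ≤ c.M})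

/-- `v^u_w = ∑ sign(u({x})) w({x}) δ_x` over the support of `u`. -/
noncomputable def signedMeasure {Ω : TopologicalSpace.Compacts (EuclideanSpace ℝ (Fin d))}
    (u w : SparseMeasure Ω) : SparseMeasure Ω :=
  ∑ x ∈ u.support, Finsupp.single x (Real.sign (u x) * w x)

/-- `CoefficientStep(u, Ψ)` may return `(u₊, w₊)`. -/
def CoefficientStep (u : SparseMeasure P.Ω) (Ψ : ℝ) (uplus w : SparseMeasure P.Ω) : Prop :=
  w ∈ positiveOn u ∧ signedJ P u w ≤ signedJ P u (u.mapRange (fun a => |a|) abs_zero) ∧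
    signedDualGap P c u w ≤ Ψ ∧ uplus = signedMeasure u w

/-- `Φ_{A_u}(u)`, the maximum of `φ(u, ·)` over measures on the support of `u` with norm at
most `M`. -/
noncomputable def localDualGap (u : SparseMeasure P.Ω) : ℝ :=
  sSup ((fun v : SparseMeasure P.Ω => P.gap (toRadon u) (toRadon v)) ''
    {v | v.support ⊆ u.support ∧ ‖toRadon v‖ ≤ c.M})

/-- The maximum of `|p_u|` over the support points of `u` in the open ball `B_{2R}(x)`. -/
noncomputable def localMax (u : SparseMeasure P.Ω) (x : P.Ω) : ℝ :=
  sSup ((fun z => |P.p (toRadon u) z|) '' {z | z ∈ u.support ∧ dist z x < 2 * c.R})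

/-- `y` is an admissible improvement of the support point `x`. The gradient of `p_u` at `y` is
taken within `Ω`; in the interior it is the usual gradient. -/
def IsLSIPoint (u : SparseMeasure P.Ω) (x y : P.Ω) : Prop :=
  dist y x < 2 * c.R ∧ P.α - c.σ / 2 < |P.p (toRadon u) y| ∧
    ∃ g : EuclideanSpace ℝ (Fin d), HasGradientWithinAt (P.pFun (toRadon u)) g P.Ω y ∧
      ‖g‖ ≤ localDualGap P c u ∧
      2 * c.R * ‖g‖ ≤ |P.p (toRadon u) y| - localMax P c u x

open Classical in
/-- `LSILoop u A B`: started with the remaining set `A`, the while loop of `LSI(u)` may collect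
exactly the points of `B`. -/
inductive LSILoop (u : SparseMeasure P.Ω) : Finset P.Ω → Finset P.Ω → Prop
  | done : LSILoop u ∅ ∅
  | found (A B : Finset P.Ω) (x y : P.Ω) (hx : x ∈ A)
      (hmax : ∀ z ∈ A, |P.p (toRadon u) z| ≤ |P.p (toRadon u) x|)
      (hy : IsLSIPoint P c u x y)
      (h : LSILoop u (A.filter fun z => ¬ dist z x < 2 * c.R) B) : LSILoop u A (insert y B)
  | skip (A B : Finset P.Ω) (x : P.Ω) (hx : x ∈ A)
      (hmax : ∀ z ∈ A, |P.p (toRadon u) z| ≤ |P.p (toRadon u) x|)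
      (hy : ∀ y, ¬ IsLSIPoint P c u x y)
      (h : LSILoop u (A.filter fun z => ¬ dist z x < 2 * c.R) B) : LSILoop u A B

/-- The lumped measure `∑_{x ∈ B} u(B_{2R}(x)) δ_x`. -/
noncomputable def lump (u : SparseMeasure P.Ω) (B : Finset P.Ω) : SparseMeasure P.Ω :=
  ∑ x ∈ B, Finsupp.single x (ballMass u x (2 * c.R))

/-- The step size of `LSIStep`, depending on the mass `m`. -/
noncomputable def lsiStepSize (m : ℝ) : ℝ :=
  min 1 (m / (16 * c.M * c.L * c.CK' ^ 2 *
    (2 * c.M * √(c.R / c.θ) + 2 * c.M * c.CK' * c.L / (c.θ * √c.γ) + √(c.M / c.θ)) ^ 2))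

/-- `LSIStep(u)` may return `u₊`. If no improved point is found, `u` is returned unchanged. -/
def LSIStep (u uplus : SparseMeasure P.Ω) : Prop :=
  ∃ B : Finset P.Ω, LSILoop P c u u.support B ∧
    ((B = ∅ ∧ uplus = u) ∨
      ∃ xhat ∈ B,
        (∀ x ∈ B, |P.p (toRadon u) x| - localMax P c u x ≤
          |P.p (toRadon u) xhat| - localMax P c u xhat) ∧
        uplus = (1 - lsiStepSize c |ballMass u xhat (2 * c.R)|) • u +
          lsiStepSize c |ballMass u xhat (2 * c.R)| • lump P c u B)

/-- A run of `LPDAP`, indexed by the passes `n = 0, 1, 2, …` through the loop body, of which there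
are `len` (possibly infinitely many). Pass `n` belongs to the outer iteration `k n` and is preceded
by `s n` recompute steps in total; `u n` is the iterate `u_{k,s}` computed in it and `uminus n` is
the input `u_{k-}` of the coefficient step. -/
structure IsLPDAPRun (u₀ : SparseMeasure P.Ω) (ε₁ Ψ₁ : ℝ) (len : ℕ∞) (k s : ℕ → ℕ)
    (uminus u w utilde uhat v : ℕ → SparseMeasure P.Ω) (ε εnext Ψ : ℕ → ℝ) : Prop where
  init_k : k 0 = 1
  init_s : s 0 = 0
  init_uminus : uminus 0 = dropStep P c u₀
  init_ε : ε 0 = ε₁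
  init_Ψ : Ψ 0 = Ψ₁
  coefficient : ∀ n : ℕ, n < len → CoefficientStep P c (uminus n) (Ψ n) (u n) (w n)
  lsi : ∀ n : ℕ, n < len → LSIStep P c (u n) (utilde n)
  lgcg : ∀ n : ℕ, n < len →
    LGCGStep P c (u n) (ε n) (4 * c.L * c.M ^ 2 * c.CK ^ 2) (uhat n) (v n) (εnext n)
  not_terminated : ∀ n : ℕ, (n + 1 : ℕ) < len → εnext n ≠ 0
  recompute : ∀ n : ℕ, (n + 1 : ℕ) < len →
    P.gap (toRadon (u n)) (toRadon (v n)) / 2 < signedDualGap P c (uminus n) (w n) →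
      k (n + 1) = k n ∧ s (n + 1) = s n + 1 ∧ uminus (n + 1) = uminus n ∧
        ε (n + 1) = ε n ∧ Ψ (n + 1) = Ψ n / 2
  advance : ∀ n : ℕ, (n + 1 : ℕ) < len →
    signedDualGap P c (uminus n) (w n) ≤ P.gap (toRadon (u n)) (toRadon (v n)) / 2 →
      k (n + 1) = k n + 1 ∧ s (n + 1) = s n ∧ ε (n + 1) = εnext n ∧ Ψ (n + 1) = Ψ n ∧
        ∃ uplus, (uplus = utilde n ∨ uplus = uhat n) ∧
          P.J (toRadon uplus) ≤ P.J (toRadon (utilde n)) ∧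
          P.J (toRadon uplus) ≤ P.J (toRadon (uhat n)) ∧
          uminus (n + 1) = dropStep P c uplus

end Algorithm

/-- The constants are positive and satisfy the bounds required of them: `R < R'` and `σ ≤ σ'` form
an admissible pair, `L` is a Lipschitz constant of `∇F`, and `CK`, `CK'` bound the kernel in
`C(Ω)` and in `C¹` of the closed `R'`-balls. -/
structure Params.IsAdmissible {d : ℕ} {Y : Type*} [NormedAddCommGroup Y] [InnerProductSpace ℝ Y]
    [CompleteSpace Y] (c : Params) (P : Problem d Y) (ubar : RadonMeasure P.Ω)
    (Abar : Finset (EuclideanSpace ℝ (Fin d))) (R' σ' : ℝ) : Prop where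
  R_pos : 0 < c.R
  R_lt : c.R < R'
  σ_pos : 0 < c.σ
  σ_le : c.σ ≤ σ'
  localization : P.IsLocalization ubar Abar c.θ c.R c.σ
  L_pos : 0 < c.L
  lipschitz : ∀ y₁ y₂, ‖gradient P.F y₁ - gradient P.F y₂‖ ≤ c.L * ‖y₁ - y₂‖
  CK_pos : 0 < c.CK
  norm_κ_le : ∀ x ∈ P.Ω, ‖P.κ x‖ ≤ c.CK
  CK'_pos : 0 < c.CK'
  norm_κ_le' : ∀ x ∈ Problem.ballUnion Abar R', ‖P.κ x‖ ≤ c.CK' ∧ ‖fderiv ℝ P.κ x‖ ≤ c.CK'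

end SparseMin

/-!
Throughout, `r` is the residual of a measure `u`, and the certificate is the dual variable of the
minimizer `ubar`; its modulus is at most `α`, with equality exactly at the active points.

**Localization.** Strong monotonicity of `∇F` near `K ubar` bounds `‖K u - K ubar‖ ^ 2` by a
multiple of `r` once `r` is small (`Problem.exists_norm_K_sub_le`). Hence dual variables of small
residual are uniformly close to the certificate, and `C²`-close to it near the active points, where
they inherit its concavity up to sign. This gives localizing pairs for every small radius
(`Problem.IsNondegenerate.exists_isLocalization`), even with `2 * θ` in place of `θ`.

**Sublinear decrease.** A conditional gradient step lowers the objective by at least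
`min (r / 4) (r ^ 2 / D)` with a constant `D`, and its gap bounds the residual up to a factor
(`LGCGStep.spec`). So as long as the residual exceeds a threshold, each outer iteration contracts
it.

**Local linear decrease.** Below a threshold, the drop step leaves only atoms near the active points
with the correct sign (`exists_clustered_dropStep`). The loop of the local step then finds exactly
one improved point per active point, and the step moves a fraction `η` of each cluster onto it. The
selected cluster alone yields a linear decrease of at least `η * m * Φ / (4 * M)`, where `Φ` is the
maximal gap and `m` the mass of that cluster. Since the coefficient step was accurate, the distance
that the mass travels is `O(√Φ)` by quadratic growth of the dual variable, so the quadratic error is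
`O(η ^ 2 * Φ)` and the prescribed `η` keeps it below half of the linear decrease
(`LSIStep.J_le`). Two points need care. Growth with the constant of the localization is not enough
to match the constants in `η`; the one for `2 * θ` holds on a smaller ball, and the mass outside of
that ball is `O(r)` and therefore negligible. Cluster masses are bounded below because the minimizer
is a combination of Diracs at all active points with nonzero weights, and testing `K u - K ubar`
with a family biorthogonal to `κ` at the active points isolates each cluster
(`Problem.IsNondegenerate.exists_mass_le`). As `r ≤ Φ`, the residual contracts
(`exists_lsi_contraction`).

**Counting.** The contractions give decay like `q ^ k` in the number of outer iterations; an
iteration whose input has not been cleaned by an effective drop step costs a single factor `q⁻¹`. A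
recompute step happens only if the residual is at most `4 * Ψ`, and it halves `Ψ`, which gives decay
like `2 ^ (-s)` in the number of recompute steps (`exists_geometric_of_steps`). The product of the
two bounds decays geometrically in `k + s` (`exists_logb_rate`).
-/

namespace SparseMin

/-! ### Sparse measures as functionals -/

section Sparse

variable {d : ℕ} {Ω : TopologicalSpace.Compacts (EuclideanSpace ℝ (Fin d))}

lemma toRadon_apply (u : SparseMeasure Ω) (f : C(Ω, ℝ)) :
    toRadon u f = ∑ x ∈ u.support, u x * f x := by
  simp [toRadon, Finsupp.sum, dirac]

lemma toRadon_apply_of_subset {u : SparseMeasure Ω} {S : Finset Ω} (h : u.support ⊆ S)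
    (f : C(Ω, ℝ)) : toRadon u f = ∑ x ∈ S, u x * f x := by
  rw [toRadon_apply]
  refine Finset.sum_subset h fun x _ hx => ?_
  simp [Finsupp.notMem_support_iff.1 hx]

@[simp] lemma toRadon_zero : toRadon (0 : SparseMeasure Ω) = 0 := by simp [toRadon]

lemma toRadon_single (x : Ω) (a : ℝ) : toRadon (Finsupp.single x a) = a • dirac x := by
  simp [toRadon]

lemma toRadon_add (u v : SparseMeasure Ω) : toRadon (u + v) = toRadon u + toRadon v :=
  Finsupp.sum_add_index' (by simp) (by simp [add_smul])

lemma toRadon_smul (a : ℝ) (u : SparseMeasure Ω) : toRadon (a • u) = a • toRadon u := by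
  rw [toRadon, Finsupp.sum_smul_index (by simp), toRadon, Finsupp.smul_sum]
  simp [mul_smul]

lemma toRadon_sum {ι : Type*} (s : Finset ι) (f : ι → SparseMeasure Ω) :
    toRadon (∑ i ∈ s, f i) = ∑ i ∈ s, toRadon (f i) := by
  classical
  induction s using Finset.induction_on with
  | empty => simp
  | insert a s ha ih => rw [Finset.sum_insert ha, Finset.sum_insert ha, toRadon_add, ih]

lemma norm_smul_radon (a : ℝ) (u : RadonMeasure Ω) : ‖a • u‖ = |a| * ‖u‖ := by
  refine le_antisymm (ContinuousLinearMap.opNorm_smul_le a u) ?_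
  rcases eq_or_ne a 0 with rfl | ha
  · rw [abs_zero, zero_mul]; exact ContinuousLinearMap.opNorm_nonneg _
  · have h := ContinuousLinearMap.opNorm_smul_le a⁻¹ (a • u)
    rw [smul_smul, inv_mul_cancel₀ ha, one_smul, norm_inv, Real.norm_eq_abs] at h
    rwa [← le_inv_mul_iff₀ (abs_pos.2 ha)]

lemma norm_dirac_le (x : Ω) : ‖(dirac x : RadonMeasure Ω)‖ ≤ 1 :=
  ContinuousLinearMap.opNorm_le_bound _ zero_le_one fun f => by
    simpa [dirac] using f.norm_coe_le_norm x

lemma abs_sign_le_one (a : ℝ) : |Real.sign a| ≤ 1 := by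
  rcases Real.sign_apply_eq a with h | h | h <;> simp [h]

lemma sign_mul_self_eq_abs (a : ℝ) : Real.sign a * a = |a| := by
  rcases lt_trichotomy a 0 with h | h | h
  · rw [Real.sign_of_neg h, abs_of_neg h]; ring
  · simp [h]
  · rw [Real.sign_of_pos h, abs_of_pos h]; ring

lemma abs_sign_of_ne_zero {a : ℝ} (h : a ≠ 0) : |Real.sign a| = 1 := by
  rcases lt_or_gt_of_ne h with h | h
  · simp [Real.sign_of_neg h]
  · simp [Real.sign_of_pos h]

lemma exists_continuousMap_eq_sign (u : SparseMeasure Ω) :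
    ∃ f : C(Ω, ℝ), (∀ x, |f x| ≤ 1) ∧ ∀ x ∈ u.support, f x = Real.sign (u x) := by
  have hfin : (u.support : Set Ω).Finite := u.support.finite_toSet
  have : Finite (u.support : Set Ω) := hfin
  let g : C((u.support : Set Ω), ℝ) := ⟨fun x => Real.sign (u x), continuous_of_discreteTopology⟩
  obtain ⟨f, hf, hfg⟩ := ContinuousMap.exists_restrict_eq_forall_mem_of_closed
    (t := Set.Icc (-1 : ℝ) 1) g
    (fun y => abs_le.1 (abs_sign_le_one _)) ⟨0, by simp⟩ hfin.isClosed
  refine ⟨f, fun x => abs_le.2 (hf x), fun x hx => ?_⟩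
  exact congrArg (fun h : C((u.support : Set Ω), ℝ) => h ⟨x, hx⟩) hfg

/-- The total variation of a sparse measure is the sum of the absolute values of its weights:
the signs of the weights extend to a continuous function of norm at most one. -/
lemma norm_toRadon (u : SparseMeasure Ω) : ‖toRadon u‖ = ∑ x ∈ u.support, |u x| := by
  apply le_antisymm
  · refine ContinuousLinearMap.opNorm_le_bound _ (Finset.sum_nonneg fun _ _ => abs_nonneg _)
      fun f => ?_
    rw [toRadon_apply, Finset.sum_mul]
    refine (Finset.abs_sum_le_sum_abs _ _).trans (Finset.sum_le_sum fun x _ => ?_)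
    rw [abs_mul]
    exact mul_le_mul_of_nonneg_left (f.norm_coe_le_norm x) (abs_nonneg _)
  · obtain ⟨f, hf, hfs⟩ := exists_continuousMap_eq_sign u
    have h1 : toRadon u f = ∑ x ∈ u.support, |u x| := by
      rw [toRadon_apply]
      exact Finset.sum_congr rfl fun x hx => by rw [hfs x hx, mul_comm, sign_mul_self_eq_abs]
    have h2 : ‖f‖ ≤ 1 := (ContinuousMap.norm_le _ zero_le_one).2 hf
    rw [← h1]
    calc toRadon u f ≤ ‖toRadon u f‖ := le_abs_self _
      _ ≤ ‖toRadon u‖ * ‖f‖ := (toRadon u).le_opNorm f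
      _ ≤ ‖toRadon u‖ * 1 := mul_le_mul_of_nonneg_left h2 (toRadon u).opNorm_nonneg
      _ = ‖toRadon u‖ := mul_one _

lemma norm_toRadon_of_subset {u : SparseMeasure Ω} {S : Finset Ω} (h : u.support ⊆ S) :
    ‖toRadon u‖ = ∑ x ∈ S, |u x| := by
  rw [norm_toRadon]
  refine Finset.sum_subset h fun x _ hx => ?_
  simp [Finsupp.notMem_support_iff.1 hx]

lemma abs_apply_le_norm_toRadon (u : SparseMeasure Ω) (x : Ω) : |u x| ≤ ‖toRadon u‖ := by
  rw [norm_toRadon]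
  by_cases hx : x ∈ u.support
  · exact Finset.single_le_sum (f := fun x => |u x|) (fun _ _ => abs_nonneg _) hx
  · rw [Finsupp.notMem_support_iff.1 hx, abs_zero]
    exact Finset.sum_nonneg fun _ _ => abs_nonneg _

lemma norm_toRadon_single (x : Ω) (a : ℝ) : ‖toRadon (Finsupp.single x a)‖ = |a| := by
  classical
  rw [norm_toRadon_of_subset (S := {x}) Finsupp.support_single_subset]
  simp

end Sparse

/-! ### Smooth convex functions on a Hilbert space -/

section Convex

variable {Y : Type*} [NormedAddCommGroup Y] [InnerProductSpace ℝ Y] [CompleteSpace Y]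

lemma hasDerivAt_line {F : Y → ℝ} (hF : Differentiable ℝ F) (x h : Y) (t : ℝ) :
    HasDerivAt (fun s : ℝ => F (x + s • h)) (inner ℝ (gradient F (x + t • h)) h) t := by
  have h1 : HasDerivAt (fun s : ℝ => x + s • h) h t := by
    simpa using ((hasDerivAt_id t).smul_const h).const_add x
  have h2 := (hF (x + t • h)).hasFDerivAt.comp_hasDerivAt t h1
  rwa [← inner_gradient_left] at h2

/-- The descent inequality for functions with an `L`-Lipschitz gradient. -/
lemma le_add_inner_gradient_add_sq {F : Y → ℝ} (hF : Differentiable ℝ F) {L : ℝ}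
    (hL : ∀ y₁ y₂, ‖gradient F y₁ - gradient F y₂‖ ≤ L * ‖y₁ - y₂‖) (x h : Y) :
    F (x + h) ≤ F x + inner ℝ (gradient F x) h + L / 2 * ‖h‖ ^ 2 := by
  let f : ℝ → ℝ := fun t => F (x + t • h) - t * inner ℝ (gradient F x) h - L / 2 * ‖h‖ ^ 2 * t ^ 2
  have hf : ∀ t, HasDerivAt f (inner ℝ (gradient F (x + t • h)) h - inner ℝ (gradient F x) h
      - L * ‖h‖ ^ 2 * t) t := by
    intro t
    have h1 := ((hasDerivAt_line hF x h t).sub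
      ((hasDerivAt_id t).mul_const (inner ℝ (gradient F x) h))).sub
      (((hasDerivAt_id t).pow 2).const_mul (L / 2 * ‖h‖ ^ 2))
    refine HasDerivAt.congr_deriv h1 ?_
    simp only [id, Nat.cast_ofNat]
    ring
  have hanti : AntitoneOn f (Icc 0 1) := by
    refine antitoneOn_of_hasDerivWithinAt_nonpos (convex_Icc 0 1)
      (fun t _ => (hf t).continuousAt.continuousWithinAt) (fun t _ => (hf t).hasDerivWithinAt)
      fun t ht => ?_
    rw [interior_Icc] at ht
    rw [← inner_sub_left]
    have h1 : inner ℝ (gradient F (x + t • h) - gradient F x) h ≤ L * ‖t • h‖ * ‖h‖ := by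
      refine (real_inner_le_norm _ _).trans (mul_le_mul_of_nonneg_right ?_ (norm_nonneg _))
      simpa using hL (x + t • h) x
    rw [norm_smul, Real.norm_of_nonneg ht.1.le] at h1
    nlinarith
  have := hanti (left_mem_Icc.2 zero_le_one) (right_mem_Icc.2 zero_le_one) zero_le_one
  simp only [f, one_smul, zero_smul, add_zero] at this
  linarith

lemma add_inner_gradient_le {F : Y → ℝ} (hF : Differentiable ℝ F) (hc : ConvexOn ℝ univ F)
    (x y : Y) : F x + inner ℝ (gradient F x) (y - x) ≤ F y := by
  have hcf : ConvexOn ℝ univ (fun t : ℝ => F (x + t • (y - x))) := by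
    refine ⟨convex_univ, fun s _ t _ a b ha hb hab => ?_⟩
    have := hc.2 (mem_univ (x + s • (y - x))) (mem_univ (x + t • (y - x))) ha hb hab
    convert this using 2
    rw [smul_add, smul_add, add_add_add_comm, ← add_smul, hab, one_smul, smul_smul, smul_smul,
      ← add_smul]
    simp
  have h1 := hasDerivAt_line hF x (y - x) 0
  have := hcf.le_slope_of_hasDerivAt (mem_univ 0) (mem_univ 1) zero_lt_one h1
  simp only [slope_def_field, zero_smul, add_zero, one_smul, add_sub_cancel, sub_zero, div_one]
    at this
  linarith

/-- Strong monotonicity of the gradient near `x` yields quadratic growth near `x`: two gradient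
inequalities, at `x` and at the midpoint of `x` and `y`, avoid any integration. -/
lemma sq_le_bregman_of_strongMono {F : Y → ℝ} (hF : Differentiable ℝ F) (hc : ConvexOn ℝ univ F)
    {γ : ℝ} {x y : Y} (h : γ * ‖midpoint ℝ x y - x‖ ^ 2 ≤
      inner ℝ (gradient F (midpoint ℝ x y) - gradient F x) (midpoint ℝ x y - x)) :
    γ / 4 * ‖y - x‖ ^ 2 ≤ F y - F x - inner ℝ (gradient F x) (y - x) := by
  set z := midpoint ℝ x y with hz
  have hzx : z - x = (1 / 2 : ℝ) • (y - x) := by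
    rw [hz, midpoint_sub_left]; simp
  have hyz : y - z = (1 / 2 : ℝ) • (y - x) := by
    rw [hz, right_sub_midpoint]; simp
  have h1 := add_inner_gradient_le hF hc z y
  have h2 := add_inner_gradient_le hF hc x z
  rw [hyz, inner_smul_right] at h1
  rw [hzx, inner_smul_right] at h2
  rw [hzx, norm_smul, inner_smul_right, inner_sub_left, mul_pow,
    Real.norm_of_nonneg (by norm_num)] at h
  linarith

end Convex

/-! ### The objective, its dual variable, and optimality -/

namespace Problem

variable {d : ℕ} {Y : Type*} [NormedAddCommGroup Y] [InnerProductSpace ℝ Y] [CompleteSpace Y]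
variable (P : Problem d Y)

lemma differentiable_F : Differentiable ℝ P.F := P.F_contDiff.differentiable one_ne_zero

lemma convex_F : ConvexOn ℝ univ P.F := P.F_strictConvex.convexOn

lemma inner_K (u : RadonMeasure P.Ω) (y : Y) : inner ℝ (P.K u) y = u (P.Kstar y) := by
  rw [K, InnerProductSpace.toDual_symm_apply]; rfl

lemma K_add (u v : RadonMeasure P.Ω) : P.K (u + v) = P.K u + P.K v :=
  ext_inner_right ℝ fun y => by simp [inner_K, inner_add_left]

lemma K_smul (a : ℝ) (u : RadonMeasure P.Ω) : P.K (a • u) = a • P.K u :=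
  ext_inner_right ℝ fun y => by simp [inner_K, inner_smul_left]

lemma K_sub (u v : RadonMeasure P.Ω) : P.K (u - v) = P.K u - P.K v :=
  ext_inner_right ℝ fun y => by simp [inner_K, inner_sub_left]

@[simp] lemma Kstar_apply (y : Y) (x : P.Ω) : P.Kstar y x = inner ℝ (P.κ x) y := rfl

lemma p_apply (u : RadonMeasure P.Ω) (x : P.Ω) : P.p u x = P.pFun u x := rfl

lemma K_toRadon (u : SparseMeasure P.Ω) : P.K (toRadon u) = ∑ x ∈ u.support, u x • P.κ x :=
  ext_inner_right ℝ fun y => by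
    simp [inner_K, toRadon_apply, sum_inner, inner_smul_left]

lemma K_toRadon_of_subset {u : SparseMeasure P.Ω} {S : Finset P.Ω} (h : u.support ⊆ S) :
    P.K (toRadon u) = ∑ x ∈ S, u x • P.κ x :=
  ext_inner_right ℝ fun y => by
    simp [inner_K, toRadon_apply_of_subset h, sum_inner, inner_smul_left]

lemma norm_Kstar_le {CK : ℝ} (hCK : 0 ≤ CK) (h : ∀ x ∈ P.Ω, ‖P.κ x‖ ≤ CK) (y : Y) :
    ‖P.Kstar y‖ ≤ CK * ‖y‖ :=
  (ContinuousMap.norm_le _ (by positivity)).2 fun x =>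
    (norm_inner_le_norm (𝕜 := ℝ) _ _).trans
      (mul_le_mul_of_nonneg_right (h x x.2) (norm_nonneg y))

lemma norm_K_le {CK : ℝ} (hCK : 0 ≤ CK) (h : ∀ x ∈ P.Ω, ‖P.κ x‖ ≤ CK) (u : RadonMeasure P.Ω) :
    ‖P.K u‖ ≤ CK * ‖u‖ := by
  have h1 : ‖P.K u‖ ^ 2 ≤ CK * ‖u‖ * ‖P.K u‖ := by
    rw [← real_inner_self_eq_norm_sq, inner_K]
    calc u (P.Kstar (P.K u)) ≤ ‖u (P.Kstar (P.K u))‖ := le_abs_self _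
      _ ≤ ‖u‖ * ‖P.Kstar (P.K u)‖ := u.le_opNorm _
      _ ≤ ‖u‖ * (CK * ‖P.K u‖) :=
        mul_le_mul_of_nonneg_left (P.norm_Kstar_le hCK h _) u.opNorm_nonneg
      _ = _ := by ring
  rcases (norm_nonneg (P.K u)).eq_or_lt with h0 | h0
  · rw [← h0]; exact mul_nonneg hCK u.opNorm_nonneg
  · nlinarith

lemma apply_p (u v : RadonMeasure P.Ω) : v (P.p u) = -inner ℝ (gradient P.F (P.K u)) (P.K v) := by
  rw [p, map_neg, real_inner_comm, inner_K]

lemma norm_p_sub_le {CK L : ℝ} (hCK : 0 ≤ CK) (h : ∀ x ∈ P.Ω, ‖P.κ x‖ ≤ CK)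
    (hL : ∀ y₁ y₂, ‖gradient P.F y₁ - gradient P.F y₂‖ ≤ L * ‖y₁ - y₂‖) (u v : RadonMeasure P.Ω) :
    ‖P.p u - P.p v‖ ≤ CK * (L * ‖P.K u - P.K v‖) := by
  have : P.p u - P.p v = P.Kstar (gradient P.F (P.K v) - gradient P.F (P.K u)) := by
    rw [p, p, map_sub]; abel
  rw [this]
  refine (P.norm_Kstar_le hCK h _).trans (mul_le_mul_of_nonneg_left ?_ hCK)
  rw [norm_sub_rev (P.K u)]
  exact hL _ _

lemma J_sub_le_gap (u v : RadonMeasure P.Ω) : P.J u - P.J v ≤ P.gap u v := by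
  have := add_inner_gradient_le P.differentiable_F P.convex_F (P.K u) (P.K v)
  rw [gap, _root_.sub_apply, apply_p, apply_p, J, J]
  rw [inner_sub_right] at this
  linarith

/-- Decrease of the objective along a perturbation, in terms of the dual variable. -/
lemma J_add_le {L : ℝ} (hL : ∀ y₁ y₂, ‖gradient P.F y₁ - gradient P.F y₂‖ ≤ L * ‖y₁ - y₂‖)
    (u h : RadonMeasure P.Ω) :
    P.J (u + h) ≤ P.J u - h (P.p u) + P.α * ‖u + h‖ - P.α * ‖u‖ + L / 2 * ‖P.K h‖ ^ 2 := by
  have := le_add_inner_gradient_add_sq P.differentiable_F hL (P.K u) (P.K h)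
  rw [apply_p, J, J, K_add]
  linarith

/-- Decrease of the objective along a convex combination, in terms of the gap. -/
lemma J_convexComb_le {L : ℝ}
    (hL : ∀ y₁ y₂, ‖gradient P.F y₁ - gradient P.F y₂‖ ≤ L * ‖y₁ - y₂‖)
    (u v : RadonMeasure P.Ω) {η : ℝ} (h0 : 0 ≤ η) (h1 : η ≤ 1) :
    P.J ((1 - η) • u + η • v) ≤
      P.J u - η * P.gap u v + η ^ 2 * (L / 2 * ‖P.K v - P.K u‖ ^ 2) := by
  have e : (1 - η) • u + η • v = u + η • (v - u) := by module
  have hn : ‖(1 - η) • u + η • v‖ ≤ (1 - η) * ‖u‖ + η * ‖v‖ := by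
    refine (ContinuousLinearMap.opNorm_add_le _ _).trans (add_le_add ?_ ?_)
    · rw [norm_smul_radon, abs_of_nonneg (sub_nonneg.2 h1)]
    · rw [norm_smul_radon, abs_of_nonneg h0]
  have h2 := P.J_add_le hL u (η • (v - u))
  rw [← e, K_smul, norm_smul, Real.norm_of_nonneg h0, K_sub, mul_pow] at h2
  have h3 := mul_le_mul_of_nonneg_left hn P.α_pos.le
  simp only [_root_.smul_apply, smul_eq_mul] at h2
  rw [gap]
  nlinarith

lemma exists_lipschitz : ∃ L : ℝ, 0 < L ∧
    ∀ y₁ y₂, ‖gradient P.F y₁ - gradient P.F y₂‖ ≤ L * ‖y₁ - y₂‖ := by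
  obtain ⟨l, hl⟩ := P.F_lipschitz
  refine ⟨l + 1, by positivity, fun y₁ y₂ => ?_⟩
  have := hl.norm_sub_le y₁ y₂
  nlinarith [norm_nonneg (y₁ - y₂)]

lemma exists_norm_κ_le : ∃ CK : ℝ, 0 < CK ∧ ∀ x ∈ P.Ω, ‖P.κ x‖ ≤ CK :=
  ⟨‖P.kernel‖ + 1, by positivity, fun x hx =>
    (P.kernel.norm_coe_le_norm ⟨x, hx⟩).trans (by linarith)⟩

section Minimizer

variable {P} {ubar : RadonMeasure P.Ω} (hmin : ∀ v, P.J ubar ≤ P.J v)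
include hmin

lemma residual_eq (u : RadonMeasure P.Ω) : P.residual u = P.J u - P.J ubar := by
  have : ⨅ v, P.J v = P.J ubar :=
    le_antisymm (ciInf_le ⟨P.J ubar, by rintro _ ⟨v, rfl⟩; exact hmin v⟩ ubar) (le_ciInf hmin)
  rw [residual, this]

lemma residual_nonneg (u : RadonMeasure P.Ω) : 0 ≤ P.residual u := by
  rw [residual_eq hmin]; linarith [hmin u]

lemma residual_minimizer : P.residual ubar = 0 := by
  rw [residual_eq hmin, sub_self]

/-- First order optimality: a minimizer has no direction of positive gap. -/
lemma gap_minimizer_nonpos (v : RadonMeasure P.Ω) : P.gap ubar v ≤ 0 := by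
  obtain ⟨L, hL0, hL⟩ := P.exists_lipschitz
  by_contra! hg
  set B := L / 2 * ‖P.K v - P.K ubar‖ ^ 2 with hB
  have hB0 : 0 ≤ B := by positivity
  set g := P.gap ubar v
  let η := min 1 (g / (2 * (B + 1)))
  have hη0 : 0 < η := lt_min one_pos (by positivity)
  have hη : η * (2 * (B + 1)) ≤ g := by
    rw [← le_div_iff₀ (by positivity)]; exact min_le_right _ _
  have h1 := P.J_convexComb_le hL ubar v hη0.le (min_le_left _ _)
  have h2 := hmin ((1 - η) • ubar + η • v)
  rw [← hB] at h1
  have : η * g ≤ η * (η * B) := by change P.J _ ≤ P.J ubar - η * g + η ^ 2 * B at h1; nlinarith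
  have := le_of_mul_le_mul_left this hη0
  nlinarith

lemma apply_p_minimizer : ubar (P.p ubar) = P.α * ‖ubar‖ := by
  have h0 := gap_minimizer_nonpos hmin 0
  have h2 := gap_minimizer_nonpos hmin ((2 : ℝ) • ubar)
  simp only [gap, norm_smul_radon, _root_.sub_apply, _root_.smul_apply,
    smul_eq_mul, _root_.zero_apply, ContinuousLinearMap.opNorm_zero, abs_two] at h0 h2
  linarith

lemma apply_p_le (v : RadonMeasure P.Ω) : v (P.p ubar) ≤ P.α * ‖v‖ := by
  have h := gap_minimizer_nonpos hmin v
  rw [gap, _root_.sub_apply, apply_p_minimizer hmin] at h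
  linarith

lemma abs_pFun_minimizer_le (x : P.Ω) : |P.pFun ubar x| ≤ P.α := by
  have hd := norm_dirac_le x
  have h1 := apply_p_le hmin (dirac x)
  have h2 := apply_p_le hmin (-dirac x)
  rw [ContinuousLinearMap.opNorm_neg] at h2
  have e : (dirac x : RadonMeasure P.Ω) (P.p ubar) = P.pFun ubar x := rfl
  rw [_root_.neg_apply, e] at h2
  rw [e] at h1
  have := mul_le_mul_of_nonneg_left hd P.α_pos.le
  exact abs_le.2 ⟨by linarith, by linarith⟩

/-- The residual controls the complementarity defect `α ‖u‖ - ⟨pbar, u⟩` together with the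
Bregman distance of `F`. -/
lemma residual_eq_bregman_add (u : RadonMeasure P.Ω) :
    P.residual u = (P.F (P.K u) - P.F (P.K ubar) -
      inner ℝ (gradient P.F (P.K ubar)) (P.K u - P.K ubar)) +
      (P.α * ‖u‖ - u (P.p ubar)) := by
  have h := apply_p_minimizer hmin
  rw [apply_p] at h
  rw [residual_eq hmin, apply_p, J, J, inner_sub_right]
  linarith

lemma defect_le_residual (u : RadonMeasure P.Ω) : P.α * ‖u‖ - u (P.p ubar) ≤ P.residual u := by
  have := add_inner_gradient_le P.differentiable_F P.convex_F (P.K ubar) (P.K u)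
  rw [residual_eq_bregman_add hmin]
  linarith

lemma bregman_le_residual (u : RadonMeasure P.Ω) : P.F (P.K u) - P.F (P.K ubar) -
      inner ℝ (gradient P.F (P.K ubar)) (P.K u - P.K ubar) ≤ P.residual u := by
  rw [residual_eq_bregman_add hmin]
  linarith [apply_p_le hmin u]

/-- Near the minimal value, observations depend Hölder continuously on the residual. -/
lemma exists_norm_K_sub_le {γ : ℝ} (hγ : 0 < γ)
    (hsc : ∃ N ∈ 𝓝 (P.K ubar), ∀ y₁ ∈ N, ∀ y₂ ∈ N,
      γ * ‖y₁ - y₂‖ ^ 2 ≤ inner ℝ (gradient P.F y₁ - gradient P.F y₂) (y₁ - y₂)) :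
    ∃ Δ > 0, ∀ u : RadonMeasure P.Ω, P.residual u ≤ Δ →
      γ / 4 * ‖P.K u - P.K ubar‖ ^ 2 ≤ P.residual u := by
  obtain ⟨N, hN, hsc⟩ := hsc
  obtain ⟨δ, hδ, hδN⟩ := Metric.mem_nhds_iff.1 hN
  have key : ∀ y, ‖y - P.K ubar‖ < δ → γ / 4 * ‖y - P.K ubar‖ ^ 2 ≤
      P.F y - P.F (P.K ubar) - inner ℝ (gradient P.F (P.K ubar)) (y - P.K ubar) := by
    intro y hy
    refine sq_le_bregman_of_strongMono P.differentiable_F P.convex_F (hsc _ (hδN ?_) _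
      (mem_of_mem_nhds hN))
    rw [Metric.mem_ball, dist_eq_norm, midpoint_sub_left, norm_smul]
    norm_num
    linarith [norm_nonneg (y - P.K ubar)]
  refine ⟨γ / 4 * (δ / 2) ^ 2 / 2, by positivity, fun u hu => ?_⟩
  by_cases hlt : ‖P.K u - P.K ubar‖ < δ
  · exact (key _ hlt).trans (bregman_le_residual hmin u)
  -- The Bregman distance is convex along rays, so it stays large outside the ball.
  exfalso
  push Not at hlt
  set n := ‖P.K u - P.K ubar‖ with hn
  have hn0 : 0 < n := hδ.trans_le hlt
  let t := δ / 2 / n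
  have ht0 : 0 < t := by positivity
  have ht1 : t ≤ 1 := by rw [div_le_one hn0]; linarith
  let y := P.K ubar + t • (P.K u - P.K ubar)
  have hy : ‖y - P.K ubar‖ = δ / 2 := by
    simp only [y, add_sub_cancel_left, norm_smul, Real.norm_of_nonneg ht0.le, ← hn, t]
    field_simp
  have h1 := key y (by rw [hy]; linarith)
  rw [hy] at h1
  have h2 := P.convex_F.2 (mem_univ (P.K ubar)) (mem_univ (P.K u)) (sub_nonneg.2 ht1) ht0.le
    (by ring)
  have e : (1 - t) • P.K ubar + t • P.K u = y := by simp only [y]; module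
  rw [e, smul_eq_mul, smul_eq_mul] at h2
  have e2 : y - P.K ubar = t • (P.K u - P.K ubar) := by simp [y]
  rw [e2, inner_smul_right] at h1
  have h3 := bregman_le_residual hmin u
  have h4 := residual_nonneg hmin u
  have h5 : t * (P.F (P.K u) - P.F (P.K ubar) -
      inner ℝ (gradient P.F (P.K ubar)) (P.K u - P.K ubar)) ≤ P.residual u :=
    (mul_le_mul_of_nonneg_left h3 ht0.le).trans (mul_le_of_le_one_left h4 ht1)
  have h6 : 0 < γ / 4 * (δ / 2) ^ 2 := by positivity
  linarith

end Minimizer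

end Problem

/-! ### Strong concavity up to sign -/

section Concave

variable {E : Type*} [NormedAddCommGroup E] [NormedSpace ℝ E]

/-- A second order Taylor bound on a convex open set from a one-sided bound on the Hessian. -/
lemma le_taylor_of_hessian_le {f : E → ℝ} {S : Set E} (hS : IsOpen S) (hc : Convex ℝ S)
    (hf : ContDiffOn ℝ 2 f S) {s c : ℝ}
    (hess : ∀ x ∈ S, ∀ h : E, c * ‖h‖ ^ 2 ≤ -(s * fderiv ℝ (fderiv ℝ f) x h h))
    {x y : E} (hx : x ∈ S) (hy : y ∈ S) :
    s * f y ≤ s * f x + s * fderiv ℝ f x (y - x) - c / 2 * ‖y - x‖ ^ 2 := by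
  set h := y - x with hh
  have hmem : ∀ t ∈ Icc (0 : ℝ) 1, x + t • h ∈ S := fun t ht =>
    hc.add_smul_sub_mem hx hy ht
  have hline : ∀ t, HasDerivAt (fun t : ℝ => x + t • h) h t := fun t => by
    simpa using ((hasDerivAt_id t).smul_const h).const_add x
  have hd1 : ∀ t ∈ Icc (0 : ℝ) 1,
      HasDerivAt (fun t : ℝ => f (x + t • h)) (fderiv ℝ f (x + t • h) h) t := fun t ht =>
    ((hf.contDiffAt (hS.mem_nhds (hmem t ht))).differentiableAt (by simp)).hasFDerivAt
      |>.comp_hasDerivAt t (hline t)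
  have hd2 : ∀ t ∈ Icc (0 : ℝ) 1, HasDerivAt (fun t : ℝ => fderiv ℝ f (x + t • h) h)
      (fderiv ℝ (fderiv ℝ f) (x + t • h) h h) t := fun t ht => by
    have h1 : ContDiffAt ℝ 1 (fderiv ℝ f) (x + t • h) :=
      (hf.contDiffAt (hS.mem_nhds (hmem t ht))).fderiv_right (by norm_num)
    have h2 := (h1.differentiableAt (by simp)).hasFDerivAt.comp_hasDerivAt t (hline t)
    exact ((ContinuousLinearMap.apply ℝ ℝ h).hasFDerivAt.comp_hasDerivAt t h2)
  let g1 : ℝ → ℝ := fun t => s * fderiv ℝ f (x + t • h) h + c * ‖h‖ ^ 2 * t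
  let g : ℝ → ℝ := fun t => s * f (x + t • h) - t * (s * fderiv ℝ f x h) + c / 2 * ‖h‖ ^ 2 * t ^ 2
  have hg1 : ∀ t ∈ Icc (0 : ℝ) 1, HasDerivAt g1
      (s * fderiv ℝ (fderiv ℝ f) (x + t • h) h h + c * ‖h‖ ^ 2) t := fun t ht =>
    (((hd2 t ht).const_mul s).add ((hasDerivAt_id t).const_mul (c * ‖h‖ ^ 2))).congr_deriv
      (by ring)
  have hg : ∀ t ∈ Icc (0 : ℝ) 1, HasDerivAt g (g1 t - s * fderiv ℝ f x h) t := fun t ht =>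
    ((((hd1 t ht).const_mul s).sub ((hasDerivAt_id t).mul_const (s * fderiv ℝ f x h))).add
      (((hasDerivAt_id t).pow 2).const_mul (c / 2 * ‖h‖ ^ 2))).congr_deriv
      (by simp only [g1, id, Nat.cast_ofNat]; ring)
  have hanti1 : AntitoneOn g1 (Icc 0 1) := by
    refine antitoneOn_of_hasDerivWithinAt_nonpos (convex_Icc 0 1)
      (fun t ht => (hg1 t ht).continuousAt.continuousWithinAt)
      (fun t ht => (hg1 t (interior_subset ht)).hasDerivWithinAt) fun t ht => ?_
    linarith [hess _ (hmem t (interior_subset ht)) h]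
  have hanti : AntitoneOn g (Icc 0 1) := by
    refine antitoneOn_of_hasDerivWithinAt_nonpos (convex_Icc 0 1)
      (fun t ht => (hg t ht).continuousAt.continuousWithinAt)
      (fun t ht => (hg t (interior_subset ht)).hasDerivWithinAt) fun t ht => ?_
    have ht' := interior_subset ht
    have := hanti1 (left_mem_Icc.2 zero_le_one) ht' ht'.1
    simp only [g1, zero_smul, add_zero, mul_zero] at this ⊢
    linarith
  have := hanti (left_mem_Icc.2 zero_le_one) (right_mem_Icc.2 zero_le_one) zero_le_one
  simp only [g, one_smul, zero_smul, add_zero, hh, add_sub_cancel] at this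
  linarith

lemma _root_.ContDiffAt.eventually_norm_hessian_sub_le {F : Type*} [NormedAddCommGroup F]
    [NormedSpace ℝ F] {f : E → F} {x : E} (hf : ContDiffAt ℝ 2 f x) {ε : ℝ} (hε : 0 < ε) :
    ∀ᶠ z in 𝓝 x, ∀ h, ‖fderiv ℝ (fderiv ℝ f) z h h - fderiv ℝ (fderiv ℝ f) x h h‖ ≤
      ε * ‖h‖ ^ 2 := by
  have hc : ContinuousAt (fderiv ℝ (fderiv ℝ f)) x :=
    ((hf.fderiv_right (m := 1) (by norm_num)).fderiv_right (m := 0) (by norm_num)).continuousAt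
  filter_upwards [hc (Metric.ball_mem_nhds (fderiv ℝ (fderiv ℝ f) x) hε)] with z hz h
  have h1 : ‖fderiv ℝ (fderiv ℝ f) z - fderiv ℝ (fderiv ℝ f) x‖ ≤ ε := by
    exact (dist_eq_norm (fderiv ℝ (fderiv ℝ f) z) (fderiv ℝ (fderiv ℝ f) x)).ge.trans
      (Metric.mem_ball.1 hz).le
  have h2 := ContinuousLinearMap.le_opNorm₂
    (fderiv ℝ (fderiv ℝ f) z - fderiv ℝ (fderiv ℝ f) x) h h
  calc _ ≤ _ := h2
    _ ≤ ε * ‖h‖ * ‖h‖ := by gcongr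
    _ = _ := by ring

end Concave

namespace Problem

variable {d : ℕ} {Y : Type*} [NormedAddCommGroup Y] [InnerProductSpace ℝ Y] [CompleteSpace Y]
variable (P : Problem d Y)

/-! ### Regularity of the dual variable -/

lemma pFun_eq_comp (u : RadonMeasure P.Ω) :
    P.pFun u = (-innerSL ℝ (gradient P.F (P.K u))) ∘ P.κ := by
  ext x; simp [pFun]

lemma contDiffAt_pFun {n : WithTop ℕ∞} {x : EuclideanSpace ℝ (Fin d)}
    (h : ContDiffAt ℝ n P.κ x) (u : RadonMeasure P.Ω) : ContDiffAt ℝ n (P.pFun u) x := by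
  rw [pFun_eq_comp]
  exact (-innerSL ℝ (gradient P.F (P.K u))).contDiff.contDiffAt.comp x h

lemma fderiv_fderiv_pFun {x : EuclideanSpace ℝ (Fin d)} (h : ContDiffAt ℝ 2 P.κ x)
    (u : RadonMeasure P.Ω) (a b : EuclideanSpace ℝ (Fin d)) :
    fderiv ℝ (fderiv ℝ (P.pFun u)) x a b =
      -inner ℝ (fderiv ℝ (fderiv ℝ P.κ) x a b) (gradient P.F (P.K u)) := by
  set T := -innerSL ℝ (gradient P.F (P.K u)) with hT
  have h1 : fderiv ℝ (P.pFun u) =ᶠ[𝓝 x] fun z => T.comp (fderiv ℝ P.κ z) := by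
    filter_upwards [h.eventually (by simp)] with z hz
    rw [pFun_eq_comp]
    exact (T.hasFDerivAt.comp z (hz.differentiableAt (by simp)).hasFDerivAt).fderiv
  have h2 : DifferentiableAt ℝ (fderiv ℝ P.κ) x :=
    (h.fderiv_right (m := 1) (by norm_num)).differentiableAt (by simp)
  have h3 : HasFDerivAt (fun z => T.comp (fderiv ℝ P.κ z))
      ((ContinuousLinearMap.compL ℝ (EuclideanSpace ℝ (Fin d)) Y ℝ T).comp
        (fderiv ℝ (fderiv ℝ P.κ) x)) x :=
    (ContinuousLinearMap.compL ℝ (EuclideanSpace ℝ (Fin d)) Y ℝ T).hasFDerivAt.comp x h2.hasFDerivAt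
  rw [h1.fderiv_eq, h3.fderiv]
  simp [hT]

lemma isOpen_ballUnion (A : Finset (EuclideanSpace ℝ (Fin d))) (r : ℝ) :
    IsOpen (ballUnion A r) :=
  isOpen_biUnion fun _ _ => Metric.isOpen_ball

lemma ball_subset_ballUnion {A : Finset (EuclideanSpace ℝ (Fin d))}
    {x : EuclideanSpace ℝ (Fin d)} (hx : x ∈ A) (r : ℝ) : Metric.ball x r ⊆ ballUnion A r :=
  subset_biUnion_of_mem (u := fun x => Metric.ball x r) hx

lemma mem_ballUnion {A : Finset (EuclideanSpace ℝ (Fin d))} {r : ℝ}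
    {x : EuclideanSpace ℝ (Fin d)} : x ∈ ballUnion A r ↔ ∃ y ∈ A, dist x y < r := by
  simp [ballUnion]

lemma sign_mul_of_sign_eq {a s : ℝ} (h : Real.sign a = s) : s * a = |a| := by
  rw [← h, sign_mul_self_eq_abs]

/-- A lower bound for `|a|` and closeness of `b` to `a` determine the sign of `b`. -/
lemma sign_eq_of_abs_sub_lt {a b : ℝ} (h : |b - a| < |a|) : Real.sign b = Real.sign a := by
  rcases lt_trichotomy a 0 with ha | ha | ha
  · rw [abs_of_neg ha, abs_lt] at h
    rw [Real.sign_of_neg ha, Real.sign_of_neg (by linarith)]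
  · simp [ha] at h; exact absurd h (not_lt.2 (abs_nonneg _))
  · rw [abs_of_pos ha, abs_lt] at h
    rw [Real.sign_of_pos ha, Real.sign_of_pos (by linarith)]

variable {P} {ubar : RadonMeasure P.Ω} {Abar : Finset (EuclideanSpace ℝ (Fin d))}
  {R' σ' γ θ : ℝ}

namespace IsNondegenerate

variable (hP : P.IsNondegenerate ubar Abar R' σ' γ θ)
include hP

lemma contDiffAt_κ {x : EuclideanSpace ℝ (Fin d)} (hx : x ∈ ballUnion Abar R') :
    ContDiffAt ℝ 2 P.κ x := by
  have := hP.contDiff_κ.1.contDiffAt ((isOpen_ballUnion Abar R').mem_nhds hx)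
  exact_mod_cast this

lemma le_dist {x y : EuclideanSpace ℝ (Fin d)} (hx : x ∈ Abar) (hy : y ∈ Abar) (h : x ≠ y) :
    4 * R' ≤ dist x y := by
  by_contra! hlt
  have hmem : ∀ z, z ∈ Metric.ball x (2 * R') → z ∉ Metric.ball y (2 * R') := fun z h1 h2 =>
    Set.disjoint_left.1 (hP.disjoint x hx y hy h) h1 h2
  refine hmem (midpoint ℝ x y) ?_ ?_
  · rw [Metric.mem_ball, dist_midpoint_left]; norm_num; linarith
  · rw [Metric.mem_ball, dist_midpoint_right]; norm_num; linarith

lemma abs_pFun_eq {x : EuclideanSpace ℝ (Fin d)} (hx : x ∈ Abar) : |P.pFun ubar x| = P.α := by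
  have : x ∈ (Abar : Set (EuclideanSpace ℝ (Fin d))) := hx
  rw [hP.active] at this
  exact this.2.1

lemma mem_Ω {x : EuclideanSpace ℝ (Fin d)} (hx : x ∈ Abar) : x ∈ P.Ω :=
  interior_subset (hP.subset_interior hx)

lemma abs_sign {x : EuclideanSpace ℝ (Fin d)} (hx : x ∈ Abar) :
    |Real.sign (P.pFun ubar x)| = 1 := by
  apply abs_sign_of_ne_zero
  rw [← abs_pos, hP.abs_pFun_eq hx]
  exact P.α_pos

lemma abs_pFun_lt {x : P.Ω} (hx : (x : EuclideanSpace ℝ (Fin d)) ∉ Abar) :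
    |P.pFun ubar x| < P.α := by
  refine lt_of_le_of_ne (abs_pFun_minimizer_le hP.minimizer x) fun h => hx ?_
  have : (x : EuclideanSpace ℝ (Fin d)) ∈ (Abar : Set (EuclideanSpace ℝ (Fin d))) := by
    rw [hP.active]
    refine ⟨x.2, h, le_antisymm ?_ ?_⟩
    · exact (ContinuousMap.norm_le _ P.α_pos.le).2 fun y => abs_pFun_minimizer_le hP.minimizer y
    · rw [← h]; exact (P.p ubar).norm_coe_le_norm x
  exact this

/-- Outside of every neighbourhood of the active points, the dual certificate stays away from
its maximal modulus. -/
lemma exists_abs_pFun_le {R : ℝ} (hR : 0 < R) :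
    ∃ σ, 0 < σ ∧ σ ≤ σ' ∧ ∀ x ∈ (P.Ω : Set _) \ ballUnion Abar R, |P.pFun ubar x| ≤ P.α - σ := by
  let S : Set P.Ω := {x | (x : EuclideanSpace ℝ (Fin d)) ∉ ballUnion Abar R}
  have hS : IsCompact S :=
    ((isOpen_ballUnion Abar R).isClosed_compl.preimage continuous_subtype_val).isCompact
  rcases S.eq_empty_or_nonempty with h | h
  · refine ⟨σ', hP.σ'_pos, le_rfl, fun x hx => ?_⟩
    have : (⟨x, hx.1⟩ : P.Ω) ∈ S := hx.2
    rw [h] at this; exact this.elim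
  · obtain ⟨x₀, hx₀, hmax⟩ := hS.exists_isMaxOn h
      (f := fun x => |P.p ubar x|) (P.p ubar).continuous.abs.continuousOn
    have hlt : |P.p ubar x₀| < P.α := hP.abs_pFun_lt fun hA =>
      hx₀ (ball_subset_ballUnion hA R (Metric.mem_ball_self hR))
    refine ⟨min σ' (P.α - |P.p ubar x₀|), lt_min hP.σ'_pos (sub_pos.2 hlt), min_le_left _ _,
      fun x hx => ?_⟩
    have h1 : |P.p ubar ⟨x, hx.1⟩| ≤ |P.p ubar x₀| := hmax (show (⟨x, hx.1⟩ : P.Ω) ∈ S from hx.2)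
    rw [p_apply] at h1
    linarith [min_le_right σ' (P.α - |P.p ubar x₀|)]

lemma exists_norm_K_sub_le_of_pos {δ : ℝ} (hδ : 0 < δ) :
    ∃ Δ > 0, ∀ u : RadonMeasure P.Ω, P.residual u ≤ Δ → ‖P.K u - P.K ubar‖ ≤ δ := by
  obtain ⟨Δ, hΔ, h⟩ := Problem.exists_norm_K_sub_le hP.minimizer hP.γ_pos hP.strongConvex
  have hγ := hP.γ_pos
  refine ⟨min Δ (γ / 4 * δ ^ 2), lt_min hΔ (by positivity), fun u hu => ?_⟩
  have h1 := (h u (hu.trans (min_le_left _ _))).trans (hu.trans (min_le_right _ _))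
  exact le_of_sq_le_sq (le_of_mul_le_mul_left h1 (by positivity)) hδ.le

/-- Dual variables converge uniformly as the residual tends to zero. -/
lemma exists_abs_pFun_sub_le {δ : ℝ} (hδ : 0 < δ) :
    ∃ Δ > 0, ∀ u : RadonMeasure P.Ω, P.residual u ≤ Δ →
      ∀ x ∈ P.Ω, |P.pFun u x - P.pFun ubar x| ≤ δ := by
  obtain ⟨CK, hCK, hκ⟩ := P.exists_norm_κ_le
  obtain ⟨L, hL0, hL⟩ := P.exists_lipschitz
  obtain ⟨Δ, hΔ, h⟩ := hP.exists_norm_K_sub_le_of_pos (δ := δ / (CK * L)) (by positivity)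
  refine ⟨Δ, hΔ, fun u hu x hx => ?_⟩
  have h1 : |P.p u ⟨x, hx⟩ - P.p ubar ⟨x, hx⟩| ≤ ‖P.p u - P.p ubar‖ :=
    (P.p u - P.p ubar).norm_coe_le_norm ⟨x, hx⟩
  refine h1.trans ((P.norm_p_sub_le hCK.le hκ hL u ubar).trans ?_)
  calc CK * (L * ‖P.K u - P.K ubar‖) ≤ CK * (L * (δ / (CK * L))) := by
        gcongr; exact h u hu
    _ = δ := by field_simp

/-- On small balls around the active points the dual certificate is uniformly concave up to sign,
and second derivatives of the kernel are bounded. -/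
lemma exists_radius : ∃ Rt B : ℝ, 0 < Rt ∧ Rt ≤ R' ∧ 0 < B ∧ ∀ xbar ∈ Abar,
    ∀ x ∈ Metric.ball xbar Rt,
      |P.pFun ubar x - P.pFun ubar xbar| < P.α / 2 ∧
      (∀ h, ‖fderiv ℝ (fderiv ℝ P.κ) x h h‖ ≤ B * ‖h‖ ^ 2) ∧
      ∀ h, 3 / 4 * θ * ‖h‖ ^ 2 ≤
        -(Real.sign (P.pFun ubar xbar) * fderiv ℝ (fderiv ℝ (P.pFun ubar)) x h h) := by
  let B : ℝ := ∑ x ∈ Abar, (‖fderiv ℝ (fderiv ℝ P.κ) x‖ + 1) + 1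
  have hnn : ∀ x, 0 ≤ ‖fderiv ℝ (fderiv ℝ P.κ) x‖ + 1 := fun x =>
    add_nonneg (ContinuousLinearMap.opNorm_nonneg _) zero_le_one
  have hB : 0 < B := add_pos_of_nonneg_of_pos (Finset.sum_nonneg fun x _ => hnn x) one_pos
  have key : ∀ xbar ∈ Abar, ∃ r > 0, ∀ x ∈ Metric.ball xbar r,
      |P.pFun ubar x - P.pFun ubar xbar| < P.α / 2 ∧
      (∀ h, ‖fderiv ℝ (fderiv ℝ P.κ) x h h‖ ≤ B * ‖h‖ ^ 2) ∧
      ∀ h, 3 / 4 * θ * ‖h‖ ^ 2 ≤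
        -(Real.sign (P.pFun ubar xbar) * fderiv ℝ (fderiv ℝ (P.pFun ubar)) x h h) := by
    intro xbar hx
    have hmem := ball_subset_ballUnion hx R' (Metric.mem_ball_self hP.R'_pos)
    have hκ := hP.contDiffAt_κ hmem
    have hp := P.contDiffAt_pFun hκ ubar
    have c1 : ContinuousAt (P.pFun ubar) xbar := hp.continuousAt
    have e1 : ∀ᶠ x in 𝓝 xbar, P.pFun ubar x ∈ Metric.ball (P.pFun ubar xbar) (P.α / 2) :=
      c1 (Metric.ball_mem_nhds _ (half_pos P.α_pos))
    have e2 := hκ.eventually_norm_hessian_sub_le one_pos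
    have hθ := hP.θ_pos
    have e3 := hp.eventually_norm_hessian_sub_le (show 0 < θ / 4 by positivity)
    obtain ⟨r, hr, hball⟩ := Metric.eventually_nhds_iff_ball.1 (e1.and (e2.and e3))
    refine ⟨r, hr, fun x hxr => ⟨(hball x hxr).1, fun h => ?_, fun h => ?_⟩⟩
    · have h1 := (hball x hxr).2.1 h
      have h2 := ContinuousLinearMap.le_opNorm₂ (fderiv ℝ (fderiv ℝ P.κ) xbar) h h
      have h3 := norm_le_norm_add_norm_sub (fderiv ℝ (fderiv ℝ P.κ) xbar h h)
        (fderiv ℝ (fderiv ℝ P.κ) x h h)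
      have h4 := Finset.single_le_sum (f := fun x => ‖fderiv ℝ (fderiv ℝ P.κ) x‖ + 1)
        (fun x _ => hnn x) hx
      have h5 : (‖fderiv ℝ (fderiv ℝ P.κ) xbar‖ + 1) * ‖h‖ ^ 2 ≤ B * ‖h‖ ^ 2 := by
        gcongr; simp only [B]; linarith
      rw [norm_sub_rev] at h1
      linarith
    have h4 := (hball x hxr).2.2 h
    rw [Real.norm_eq_abs] at h4
    have h5 := hP.curvature xbar hx h
    set a := fderiv ℝ (fderiv ℝ (P.pFun ubar)) x h h
    set b := fderiv ℝ (fderiv ℝ (P.pFun ubar)) xbar h h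
    set s := Real.sign (P.pFun ubar xbar)
    have h6 : |s * (a - b)| ≤ θ / 4 * ‖h‖ ^ 2 := by
      rwa [abs_mul, hP.abs_sign hx, one_mul]
    have h7 := (abs_le.1 h6).2
    linarith
  choose! r hr hball using key
  obtain ⟨Rt, h0, hle⟩ : ∃ Rt, 0 < Rt ∧ (Rt ≤ R' ∧ ∀ x ∈ Abar, Rt ≤ r x) := by
    have : ∀ᶠ t in 𝓝[>] (0 : ℝ), t ≤ R' ∧ ∀ x ∈ Abar, t ≤ r x := by
      refine (eventually_nhdsWithin_of_eventually_nhds (eventually_le_nhds hP.R'_pos)).and ?_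
      rw [Filter.eventually_all_finset]
      exact fun x hx => eventually_nhdsWithin_of_eventually_nhds (eventually_le_nhds (hr x hx))
    obtain ⟨t, ht, ht0⟩ := (this.and self_mem_nhdsWithin).exists
    exact ⟨t, ht0, ht⟩
  exact ⟨Rt, B, h0, hle.1, hB, fun xbar hx x hxr =>
    hball xbar hx x (Metric.ball_subset_ball (hle.2 xbar hx) hxr)⟩

/-- Every sufficiently small radius localizes, even with the curvature constant `2 θ` in place of
`θ`: dual variables of small residual are `C²`-close to the dual certificate near the active
points and uniformly close elsewhere. -/
theorem exists_isLocalization : ∃ Rt, 0 < Rt ∧ Rt ≤ R' ∧ ∀ R, 0 < R → R < Rt →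
    ∃ σ, 0 < σ ∧ σ ≤ σ' ∧ P.IsLocalization ubar Abar (2 * θ) R σ := by
  obtain ⟨Rt, B, hRt0, hRt, hB, hrad⟩ := hP.exists_radius
  refine ⟨Rt, hRt0, hRt, fun R hR0 hR => ?_⟩
  obtain ⟨σ, hσ0, hσ, hout⟩ := hP.exists_abs_pFun_le hR0
  refine ⟨σ, hσ0, hσ, ?_⟩
  have hθ := hP.θ_pos
  have hσα : σ < P.α := hσ.trans_lt hP.σ'_lt
  obtain ⟨L, hL0, hL⟩ := P.exists_lipschitz
  obtain ⟨Δ₁, hΔ₁, hp⟩ := hP.exists_abs_pFun_sub_le (δ := σ / 4) (by positivity)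
  obtain ⟨Δ₂, hΔ₂, hK⟩ := hP.exists_norm_K_sub_le_of_pos (δ := θ / (4 * (B * L))) (by positivity)
  refine ⟨min Δ₁ Δ₂, lt_min hΔ₁ hΔ₂, fun u hu => ⟨fun xbar hx => ?_, fun x hx => ?_⟩⟩
  swap
  · have h1 := hout x ⟨hx.1, fun h => hx.2 (subset_closure h)⟩
    have h2 := hp u (hu.trans (min_le_left _ _)) x hx.1
    have h3 := abs_sub_abs_le_abs_sub (P.pFun u x) (P.pFun ubar x)
    linarith
  have hpu := hp u (hu.trans (min_le_left _ _))
  have hball : Metric.ball xbar R ⊆ Metric.ball xbar Rt := Metric.ball_subset_ball hR.le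
  have hU : Metric.closedBall xbar R ⊆ ballUnion Abar R' :=
    (Metric.closedBall_subset_ball (hR.trans_le hRt)).trans (ball_subset_ballUnion hx R')
  have hUΩ : Metric.closedBall xbar R ⊆ P.Ω :=
    hU.trans (hP.ballUnion_subset.trans interior_subset)
  have habs := hP.abs_pFun_eq hx
  have hs1 := hP.abs_sign hx
  set s := Real.sign (P.pFun ubar xbar) with hs
  have hsign : ∀ x ∈ Metric.ball xbar R, Real.sign (P.pFun u x) = s := fun x hxR => by
    have h1 := (hrad xbar hx x (hball hxR)).1
    have h2 := hpu x (hUΩ (Metric.ball_subset_closedBall hxR))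
    refine sign_eq_of_abs_sub_lt ?_
    rw [habs]
    have := abs_sub_le (P.pFun u x) (P.pFun ubar x) (P.pFun ubar xbar)
    linarith
  have hmul : ∀ x ∈ Metric.ball xbar R, s * P.pFun u x = |P.pFun u x| := fun x hxR =>
    sign_mul_of_sign_eq (hsign x hxR)
  have hG : ‖gradient P.F (P.K u) - gradient P.F (P.K ubar)‖ ≤ θ / (4 * B) :=
    (hL _ _).trans <| by
      calc L * ‖P.K u - P.K ubar‖ ≤ L * (θ / (4 * (B * L))) := by
            gcongr; exact hK u (hu.trans (min_le_right _ _))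
        _ = θ / (4 * B) := by field_simp
  have hess : ∀ x ∈ Metric.ball xbar R, ∀ h : EuclideanSpace ℝ (Fin d), θ / 2 * ‖h‖ ^ 2 ≤
      -(s * fderiv ℝ (fderiv ℝ (P.pFun u)) x h h) := fun x hxR h => by
    have hκ := hP.contDiffAt_κ (hU (Metric.ball_subset_closedBall hxR))
    obtain ⟨-, h1, h2⟩ := hrad xbar hx x (hball hxR)
    have h2 := h2 h
    rw [P.fderiv_fderiv_pFun hκ] at h2 ⊢
    set k := fderiv ℝ (fderiv ℝ P.κ) x h h with hk
    have h3 : ‖k‖ ≤ B * ‖h‖ ^ 2 := h1 h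
    have h4 : |s * (inner ℝ k (gradient P.F (P.K u)) - inner ℝ k (gradient P.F (P.K ubar)))| ≤
        θ / 4 * ‖h‖ ^ 2 := by
      rw [abs_mul, hs1, one_mul, ← inner_sub_right]
      calc _ ≤ ‖k‖ * ‖gradient P.F (P.K u) - gradient P.F (P.K ubar)‖ := abs_real_inner_le_norm _ _
        _ ≤ (B * ‖h‖ ^ 2) * (θ / (4 * B)) := by gcongr
        _ = _ := by field_simp
    have h5 := (abs_le.1 h4).1
    linarith
  have hC2 : ContDiffOn ℝ 2 (P.pFun u) (Metric.ball xbar R) := fun x hxR =>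
    (P.contDiffAt_pFun
      (hP.contDiffAt_κ (hU (Metric.ball_subset_closedBall hxR))) u).contDiffWithinAt
  have htaylor : ∀ x ∈ Metric.ball xbar R, ∀ y ∈ Metric.ball xbar R,
      |P.pFun u y| ≤ |P.pFun u x| + s * fderiv ℝ (P.pFun u) x (y - x) - θ / 4 * ‖y - x‖ ^ 2 :=
    fun x hxR y hyR => by
      have := le_taylor_of_hessian_le Metric.isOpen_ball (convex_ball _ _) hC2 hess hxR hyR
      rw [hmul x hxR, hmul y hyR] at this
      linarith
  have hcrit : ∀ x ∈ Metric.ball xbar R, IsLocalMax (fun y => |P.pFun u y|) x →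
      fderiv ℝ (P.pFun u) x = 0 := fun x hxR hloc => by
    have h1 : IsLocalMax (fun y => s * P.pFun u y) x := by
      refine hloc.congr ?_
      filter_upwards [Metric.isOpen_ball.mem_nhds hxR] with y hy using (hmul y hy).symm
    have hd : DifferentiableAt ℝ (P.pFun u) x :=
      (hC2.contDiffAt (Metric.isOpen_ball.mem_nhds hxR)).differentiableAt (by simp)
    have h2 := h1.fderiv_eq_zero
    rw [fderiv_const_mul hd] at h2
    exact (smul_eq_zero.1 h2).resolve_left fun h0 => by rw [h0, abs_zero] at hs1; norm_num at hs1
  -- The maximum over the closed ball is attained inside, as the boundary values are too small.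
  obtain ⟨xhat, hxhat, hxmax⟩ := (isCompact_closedBall xbar R).exists_isMaxOn
    ⟨xbar, Metric.mem_closedBall_self hR0.le⟩ (f := fun x => |P.pFun u x|) (fun x hxR =>
      (P.contDiffAt_pFun (hP.contDiffAt_κ (hU hxR)) u).continuousAt.abs.continuousWithinAt)
  have hxin : xhat ∈ Metric.ball xbar R := by
    by_contra hnot
    have hout' : xhat ∉ ballUnion Abar R := by
      rw [mem_ballUnion]
      rintro ⟨y, hy, hyd⟩
      rcases eq_or_ne y xbar with rfl | hne
      · exact hnot hyd
      · have h1 := hP.le_dist hy hx hne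
        have h2 := dist_triangle_left y xbar xhat
        have h3 : dist xhat xbar ≤ R := hxhat
        linarith
    have h1 := hout xhat ⟨hUΩ hxhat, hout'⟩
    have h2 := hpu xhat (hUΩ hxhat)
    have h3 := hpu xbar (hP.mem_Ω hx)
    have h4 : |P.pFun u xbar| ≤ |P.pFun u xhat| := hxmax (Metric.mem_closedBall_self hR0.le)
    have h5 := abs_sub_abs_le_abs_sub (P.pFun u xhat) (P.pFun ubar xhat)
    have h6 := abs_sub_abs_le_abs_sub (P.pFun ubar xbar) (P.pFun u xbar)
    rw [abs_sub_comm, habs] at h6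
    linarith
  have hmaxloc : IsLocalMax (fun y => |P.pFun u y|) xhat := by
    filter_upwards [Metric.isOpen_ball.mem_nhds hxin] with y hy
      using hxmax (Metric.ball_subset_closedBall hy)
  refine ⟨hsign, ⟨xhat, hxin, fun x hxR => ⟨fun hloc => ?_, fun h => h ▸ hmaxloc⟩,
    fun x hxR => ?_, fun x hxR => ?_⟩, fun x hxR h => ?_⟩
  · have h1 := htaylor x hxR xhat hxin
    rw [hcrit x hxR hloc] at h1
    have h2 : |P.pFun u x| ≤ |P.pFun u xhat| := hxmax (Metric.ball_subset_closedBall hxR)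
    simp only [_root_.zero_apply, mul_zero, add_zero] at h1
    have h3 : ‖xhat - x‖ ^ 2 ≤ 0 := by nlinarith
    have h4 : ‖xhat - x‖ = 0 := by nlinarith [norm_nonneg (xhat - x)]
    exact (sub_eq_zero.1 (norm_eq_zero.1 h4)).symm
  · have h1 := htaylor x hxR xhat hxin
    have h2 : s * fderiv ℝ (P.pFun u) x (xhat - x) ≤ ‖gradient (P.pFun u) x‖ * ‖xhat - x‖ := by
      rw [← inner_gradient_left]
      refine (le_abs_self _).trans ?_
      rw [abs_mul, hs1, one_mul]
      exact abs_real_inner_le_norm _ _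
    have h3 : ‖xhat - x‖ ≤ 2 * R := by
      rw [← dist_eq_norm]
      have := dist_triangle_right xhat x xbar
      rw [Metric.mem_ball] at hxR hxin
      linarith
    have h4 : 0 ≤ θ / 4 * ‖xhat - x‖ ^ 2 := by positivity
    have h5 := mul_le_mul_of_nonneg_left h3 (norm_nonneg (gradient (P.pFun u) x))
    linarith
  · have h1 := htaylor xhat hxin x hxR
    rw [hcrit xhat hxin hmaxloc, norm_sub_rev] at h1
    simp only [_root_.zero_apply, mul_zero, add_zero] at h1
    linarith
  · have := hess x hxR h
    rw [hsign x hxR]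
    linarith

end IsNondegenerate

lemma IsLocalization.mono {θ' R σ : ℝ} (h : P.IsLocalization ubar Abar θ' R σ) (hθ : θ ≤ θ') :
    P.IsLocalization ubar Abar θ R σ := by
  obtain ⟨Δ, hΔ, h⟩ := h
  refine ⟨Δ, hΔ, fun u hu => ⟨fun xbar hx => ?_, (h u hu).2⟩⟩
  obtain ⟨h1, ⟨xhat, hxhat, h2, h3, h4⟩, h5⟩ := (h u hu).1 xbar hx
  refine ⟨h1, ⟨xhat, hxhat, h2, h3, fun x hx => le_trans ?_ (h4 x hx)⟩,
    fun x hx h => le_trans ?_ (h5 x hx h)⟩ <;> gcongr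

end Problem

/-! ### Finite families -/

lemma exists_pos_le_of_finset {ι : Type*} (A : Finset ι) {f : ι → ℝ} (hf : ∀ i ∈ A, 0 < f i) :
    ∃ δ > 0, ∀ i ∈ A, δ ≤ f i := by
  have : ∀ᶠ t in 𝓝[>] (0 : ℝ), ∀ i ∈ A, t ≤ f i := by
    rw [Filter.eventually_all_finset]
    exact fun i hi => eventually_nhdsWithin_of_eventually_nhds (eventually_le_nhds (hf i hi))
  obtain ⟨t, ht, ht0⟩ := (this.and self_mem_nhdsWithin).exists
  exact ⟨t, ht0, ht⟩

/-- The Cauchy–Schwarz inequality for weighted sums. -/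
lemma sum_mul_sq_le_of_nonneg {ι : Type*} (S : Finset ι) {a b : ι → ℝ} (ha : ∀ i ∈ S, 0 ≤ a i) :
    (∑ i ∈ S, a i * b i) ^ 2 ≤ (∑ i ∈ S, a i) * ∑ i ∈ S, a i * b i ^ 2 :=
  Finset.sum_sq_le_sum_mul_sum_of_sq_le_mul S ha
    (fun i hi => mul_nonneg (ha i hi) (sq_nonneg _)) (fun i _ => (by ring : _ = _).le)

/-- A finite linearly independent family in a Hilbert space has a biorthogonal family. -/
lemma exists_biorthogonal {ι Y : Type*} [Finite ι] [NormedAddCommGroup Y] [InnerProductSpace ℝ Y]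
    {v : ι → Y} (hv : LinearIndependent ℝ v) (i : ι) :
    ∃ e : Y, inner ℝ (v i) e = 1 ∧ ∀ j, j ≠ i → inner ℝ (v j) e = 0 := by
  let W := Submodule.span ℝ (v '' {i}ᶜ)
  have : FiniteDimensional ℝ W := FiniteDimensional.span_of_finite ℝ (Set.toFinite _)
  have hi : v i ∉ W := by
    apply hv.notMem_span_image
    simp
  let e := v i - W.starProjection (v i)
  have horth : e ∈ Wᗮ := W.sub_starProjection_mem_orthogonal (v i)
  have hpm : W.starProjection (v i) ∈ W := W.starProjection_apply_mem (v i)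
  have he : e ≠ 0 := fun h => hi (by rw [sub_eq_zero.1 h]; exact hpm)
  have hie : inner ℝ (v i) e = ‖e‖ ^ 2 := by
    have h1 : v i = e + W.starProjection (v i) := by simp [e]
    rw [h1, inner_add_left, (W.mem_orthogonal e).1 horth _ hpm, add_zero,
      real_inner_self_eq_norm_sq]
  have hne : ‖e‖ ^ 2 ≠ 0 := by positivity
  refine ⟨(‖e‖ ^ 2)⁻¹ • e, ?_, fun j hj => ?_⟩
  · rw [inner_smul_right, hie, inv_mul_cancel₀ hne]
  · rw [inner_smul_right, (W.mem_orthogonal e).1 horth _ (Submodule.subset_span ⟨j, hj, rfl⟩),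
      mul_zero]

namespace Problem

variable {d : ℕ} {Y : Type*} [NormedAddCommGroup Y] [InnerProductSpace ℝ Y] [CompleteSpace Y]
variable {P : Problem d Y} {ubar : RadonMeasure P.Ω} {Abar : Finset (EuclideanSpace ℝ (Fin d))}
  {R' σ' γ θ : ℝ}

namespace IsNondegenerate

variable (hP : P.IsNondegenerate ubar Abar R' σ' γ θ)
include hP

/-! ### The minimizer is a combination of Diracs at the active points -/

/-- The minimizer does not charge functions living where the certificate is not active: the
certificate may be perturbed by such a function without violating its bound. -/
lemma apply_eq_zero_of_inactive {h : C(P.Ω, ℝ)} {δ : ℝ} (hδ : 0 < δ)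
    (hh : ∀ x, h x ≠ 0 → |P.pFun ubar x| ≤ P.α - δ) : ubar h = 0 := by
  have key : ∀ g : C(P.Ω, ℝ), (∀ x, g x ≠ 0 → |P.pFun ubar x| ≤ P.α - δ) → ubar g ≤ 0 := by
    intro g hg
    let t := δ / (‖g‖ + 1)
    have ht : 0 < t := by positivity
    have htg : t * ‖g‖ ≤ δ := by
      rw [div_mul_eq_mul_div, div_le_iff₀ (by positivity)]; nlinarith [norm_nonneg g]
    have hn : ‖P.p ubar + t • g‖ ≤ P.α := by
      refine (ContinuousMap.norm_le _ P.α_pos.le).2 fun x => ?_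
      rw [ContinuousMap.add_apply, ContinuousMap.smul_apply, p_apply, smul_eq_mul, Real.norm_eq_abs]
      by_cases hx : g x = 0
      · rw [hx, mul_zero, add_zero]; exact abs_pFun_minimizer_le hP.minimizer x
      · refine (abs_add_le _ _).trans ?_
        have h1 : |t * g x| ≤ t * ‖g‖ := by
          rw [abs_mul, abs_of_pos ht]
          exact mul_le_mul_of_nonneg_left (g.norm_coe_le_norm x) ht.le
        linarith [hg x hx]
    have h1 : ubar (P.p ubar + t • g) ≤ ‖ubar‖ * P.α :=
      (le_abs_self _).trans ((ubar.le_opNorm _).trans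
        (mul_le_mul_of_nonneg_left hn ubar.opNorm_nonneg))
    rw [map_add, map_smul, smul_eq_mul, apply_p_minimizer hP.minimizer] at h1
    by_contra! hpos
    have := mul_pos ht hpos
    linarith
  have h1 := key h hh
  have h2 := key (-h) fun x hx => hh x fun h0 => hx (by simp [h0])
  rw [map_neg] at h2
  linarith

/-- The minimizer is supported on the active points: a function vanishing there is uniformly close
to one living where the certificate is not active, by truncation. -/
lemma apply_eq_zero_of_vanish {f : C(P.Ω, ℝ)}
    (hf : ∀ x : P.Ω, (x : EuclideanSpace ℝ (Fin d)) ∈ Abar → f x = 0) : ubar f = 0 := by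
  have key : ∀ ε > 0, |ubar f| ≤ ‖ubar‖ * ε := by
    intro ε hε
    let c : C(P.Ω, ℝ) := ⟨fun x => max (-ε) (min ε (f x)), by fun_prop⟩
    have hc : ‖c‖ ≤ ε := (ContinuousMap.norm_le _ hε.le).2 fun x =>
      abs_le.2 ⟨le_max_left _ _, max_le (by linarith) (min_le_left _ _)⟩
    have hne : ∀ x, (f - c) x ≠ 0 → ε ≤ |f x| := by
      intro x hx
      by_contra! hlt
      rw [abs_lt] at hlt
      apply hx
      simp only [ContinuousMap.sub_apply, c, ContinuousMap.coe_mk]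
      rw [min_eq_right hlt.2.le, max_eq_right hlt.1.le, sub_self]
    let S : Set P.Ω := {x | ε ≤ |f x|}
    have hS : IsCompact S := (isClosed_le continuous_const f.continuous.abs).isCompact
    have hδ : ∃ δ > 0, ∀ x ∈ S, |P.pFun ubar x| ≤ P.α - δ := by
      rcases S.eq_empty_or_nonempty with h | h
      · exact ⟨1, one_pos, by simp [h]⟩
      · obtain ⟨x₀, hx₀, hmax⟩ := hS.exists_isMaxOn h
          (f := fun x => |P.p ubar x|) (P.p ubar).continuous.abs.continuousOn
        have hlt : |P.p ubar x₀| < P.α := hP.abs_pFun_lt fun hA => by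
          have : ε ≤ |f x₀| := hx₀
          rw [hf x₀ hA, abs_zero] at this
          linarith
        refine ⟨P.α - |P.p ubar x₀|, sub_pos.2 hlt, fun x hx => ?_⟩
        have : |P.p ubar x| ≤ |P.p ubar x₀| := hmax hx
        rw [p_apply] at this
        linarith
    obtain ⟨δ, hδ, hS⟩ := hδ
    have h0 := hP.apply_eq_zero_of_inactive hδ (h := f - c) fun x hx => hS x (hne x hx)
    rw [map_sub, sub_eq_zero] at h0
    rw [h0]
    exact (ubar.le_opNorm c).trans (mul_le_mul_of_nonneg_left hc ubar.opNorm_nonneg)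
  have hn := ubar.opNorm_nonneg
  by_contra hne
  have hpos : 0 < |ubar f| := abs_pos.2 hne
  have h1 := key (|ubar f| / (2 * (‖ubar‖ + 1))) (by positivity)
  rw [mul_div_assoc', le_div_iff₀ (by positivity)] at h1
  nlinarith

/-- The observation of the minimizer is a combination of the kernels at the active points. The
weights are nonzero as every active point belongs to the support. -/
lemma exists_weights : ∃ c : EuclideanSpace ℝ (Fin d) → ℝ, (∀ x ∈ Abar, c x ≠ 0) ∧
    P.K ubar = ∑ x ∈ Abar, c x • P.κ x := by
  have hR := hP.R'_pos
  let b : EuclideanSpace ℝ (Fin d) → C(P.Ω, ℝ) := fun z =>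
    ⟨fun x => max 0 (1 - dist (x : EuclideanSpace ℝ (Fin d)) z / R'), by fun_prop⟩
  have hbz : ∀ z (x : P.Ω), (x : EuclideanSpace ℝ (Fin d)) = z → b z x = 1 := by
    rintro z x rfl; simp [b]
  have hb0 : ∀ z ∈ Abar, ∀ x : P.Ω, (x : EuclideanSpace ℝ (Fin d)) ∈ Abar →
      (x : EuclideanSpace ℝ (Fin d)) ≠ z → b z x = 0 := by
    intro z hz x hx hne
    have h1 := hP.le_dist hx hz hne
    have h2 : 1 ≤ dist (x : EuclideanSpace ℝ (Fin d)) z / R' := by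
      rw [le_div_iff₀ hR]; linarith
    simp only [b, ContinuousMap.coe_mk]
    exact max_eq_left (by linarith)
  refine ⟨fun z => ubar (b z), fun z hz h0 => ?_, ext_inner_right ℝ fun y => ?_⟩
  · have hz' : z ∈ (fun x : P.Ω => (x : EuclideanSpace ℝ (Fin d))) '' supp ubar := by
      rw [hP.complementary]; exact hz
    obtain ⟨x, hx, rfl⟩ := hz'
    obtain ⟨f, hf0, hf⟩ := hx (Metric.ball x R') (Metric.ball_mem_nhds _ hR)
    apply hf
    change ubar (b x) = 0 at h0
    have h1 := hP.apply_eq_zero_of_vanish (f := f - f x • b x) fun y hy => by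
      by_cases hyx : y = x
      · subst hyx; simp [hbz]
      · have hne : (y : EuclideanSpace ℝ (Fin d)) ≠ x := fun h => hyx (Subtype.ext h)
        have : y ∉ Metric.ball x R' := fun hmem => by
          have h1 := hP.le_dist hy hz hne
          rw [Metric.mem_ball, Subtype.dist_eq] at hmem
          linarith
        simp [hf0 y this, hb0 _ hz y hy hne]
    rw [map_sub, map_smul, h0, smul_zero, sub_zero] at h1
    exact h1
  · have h1 := hP.apply_eq_zero_of_vanish
      (f := P.Kstar y - ∑ z ∈ Abar, inner ℝ (P.κ z) y • b z) fun x hx => by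
        rw [ContinuousMap.sub_apply, ContinuousMap.sum_apply, Finset.sum_eq_single_of_mem _ hx]
        · simp [hbz]
        · intro z hz hne
          simp [hb0 z hz x hx hne.symm]
    rw [map_sub, map_sum, sub_eq_zero] at h1
    rw [inner_K, h1, sum_inner]
    refine Finset.sum_congr rfl fun z _ => ?_
    rw [map_smul, smul_eq_mul, real_inner_smul_left, mul_comm]

/-! ### Consequences of localization -/

lemma norm_κ_sub_le {CK' : ℝ} (hCK' : ∀ x ∈ ballUnion Abar R', ‖fderiv ℝ P.κ x‖ ≤ CK')
    {xbar x y : EuclideanSpace ℝ (Fin d)} (hb : xbar ∈ Abar) (hx : x ∈ Metric.ball xbar R')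
    (hy : y ∈ Metric.ball xbar R') : ‖P.κ x - P.κ y‖ ≤ CK' * ‖x - y‖ :=
  (convex_ball xbar R').norm_image_sub_le_of_norm_fderiv_le (fun z hz =>
      (hP.contDiffAt_κ (ball_subset_ballUnion hb R' hz)).differentiableAt (by simp))
    (fun z hz => hCK' z (ball_subset_ballUnion hb R' hz)) hy hx

lemma differentiableAt_pFun {x : EuclideanSpace ℝ (Fin d)} (hx : x ∈ ballUnion Abar R')
    (u : RadonMeasure P.Ω) : DifferentiableAt ℝ (P.pFun u) x :=
  (P.contDiffAt_pFun (hP.contDiffAt_κ hx) u).differentiableAt (by simp)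

lemma eq_of_mem_ball {x y z : EuclideanSpace ℝ (Fin d)} (hx : x ∈ Abar) (hy : y ∈ Abar)
    (hzx : dist z x < R') (hzy : dist z y < R') : x = y := by
  by_contra hne
  have h1 := hP.le_dist hx hy hne
  have h2 := dist_triangle_left x y z
  have h3 := hP.R'_pos
  linarith

/-- A bound for `|p_u|` outside the closed balls extends to the complement of the open balls, by
continuity. -/
lemma mem_ballUnion_of_lt {R b : ℝ} (hR0 : 0 < R) (hR : R < R') {u : RadonMeasure P.Ω}
    (hout : ∀ x ∈ (P.Ω : Set _) \ closure (ballUnion Abar R), |P.pFun u x| ≤ b)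
    {x : EuclideanSpace ℝ (Fin d)} (hx : x ∈ P.Ω) (hlt : b < |P.pFun u x|) :
    x ∈ ballUnion Abar R := by
  by_contra hnot
  have hclU : closure (ballUnion Abar R) ⊆ ⋃ y ∈ Abar, Metric.closedBall y R := by
    rw [ballUnion, Finset.closure_biUnion]
    exact iUnion₂_mono fun _ _ => Metric.closure_ball_subset_closedBall
  have hcl : x ∈ closure (ballUnion Abar R) := by
    by_contra h
    linarith [hout x ⟨hx, h⟩]
  obtain ⟨y, hy, hxy⟩ : ∃ y ∈ Abar, dist x y ≤ R := by simpa using hclU hcl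
  have heq : dist x y = R :=
    le_antisymm hxy (not_lt.1 fun h => hnot (mem_ballUnion.2 ⟨y, hy, h⟩))
  -- Approach the boundary point `x` radially from outside the ball.
  let q : ℝ → EuclideanSpace ℝ (Fin d) := fun t => x + t • (x - y)
  have hq : Continuous q := by fun_prop
  have hq0 : q 0 = x := by simp [q]
  have hqd : ∀ t, 0 < t → dist (q t) y = (1 + t) * R := fun t ht => by
    have : q t - y = (1 + t) • (x - y) := by simp only [q]; module
    rw [dist_eq_norm, this, norm_smul, Real.norm_of_nonneg (by linarith), ← dist_eq_norm, heq]
  have hxR' : x ∈ ballUnion Abar R' := mem_ballUnion.2 ⟨y, hy, by linarith⟩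
  have hcont : ContinuousAt (fun t => |P.pFun u (q t)|) 0 := by
    refine ContinuousAt.abs (ContinuousAt.comp (g := P.pFun u) ?_ hq.continuousAt)
    rw [hq0]
    exact (hP.differentiableAt_pFun hxR' u).continuousAt
  have hnear : ∀ᶠ t in 𝓝[>] (0 : ℝ), |P.pFun u (q t)| ≤ b := by
    have h1 : ∀ᶠ t in 𝓝 (0 : ℝ), (1 + t) * R < R' := by
      have : ContinuousAt (fun t : ℝ => (1 + t) * R) 0 := by fun_prop
      exact this.eventually_lt_const (by simpa using hR)
    filter_upwards [eventually_nhdsWithin_of_eventually_nhds h1, self_mem_nhdsWithin] with t ht ht0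
    have hdt := hqd t ht0
    refine hout _ ⟨?_, fun hmem => ?_⟩
    · exact interior_subset (hP.ballUnion_subset (mem_ballUnion.2 ⟨y, hy, by rw [hdt]; exact ht⟩))
    · obtain ⟨z, hz, hqz⟩ : ∃ z ∈ Abar, dist (q t) z ≤ R := by simpa using hclU hmem
      have : z = y := hP.eq_of_mem_ball hz hy (hqz.trans_lt hR) (by rw [hdt]; exact ht)
      subst this
      have : 0 < t * R := mul_pos ht0 hR0
      rw [hdt] at hqz
      linarith
  have := le_of_tendsto (hcont.tendsto.mono_left nhdsWithin_le_nhds) hnear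
  simp only [hq0] at this
  linarith

/-- The active points are the local maximizers selected by localization at the minimizer, so the
certificate has quadratic growth around them. -/
lemma growth_of_isLocalization {R σ : ℝ} (hR0 : 0 < R) (hloc : P.IsLocalization ubar Abar θ R σ)
    {xbar x : EuclideanSpace ℝ (Fin d)} (hb : xbar ∈ Abar) (hx : x ∈ Metric.ball xbar R) :
    θ / 8 * ‖x - xbar‖ ^ 2 ≤ P.α - |P.pFun ubar x| := by
  obtain ⟨Δ, hΔ, h⟩ := hloc
  obtain ⟨-, ⟨xhat, -, h2, -, h4⟩, -⟩ :=
    (h ubar (by rw [residual_minimizer hP.minimizer]; exact hΔ.le)).1 xbar hb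
  have hmax : IsLocalMax (fun y => |P.pFun ubar y|) xbar := by
    filter_upwards [mem_interior_iff_mem_nhds.1 (hP.subset_interior hb)] with y hy
    rw [hP.abs_pFun_eq hb]
    exact abs_pFun_minimizer_le hP.minimizer ⟨y, hy⟩
  have := (h2 xbar (Metric.mem_ball_self hR0)).1 hmax
  subst this
  have h5 := h4 x hx
  rwa [hP.abs_pFun_eq hb, norm_sub_rev] at h5

lemma sum_signed_defect_le (u : SparseMeasure P.Ω) :
    ∑ x ∈ u.support, (P.α * |u x| - u x * P.pFun ubar x) ≤ P.residual (toRadon u) := by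
  refine le_trans (le_of_eq ?_) (defect_le_residual hP.minimizer (toRadon u))
  rw [norm_toRadon, toRadon_apply, Finset.mul_sum, ← Finset.sum_sub_distrib]
  rfl

lemma sum_defect_le (u : SparseMeasure P.Ω) :
    ∑ x ∈ u.support, |u x| * (P.α - |P.pFun ubar x|) ≤ P.residual (toRadon u) := by
  refine le_trans (Finset.sum_le_sum fun x _ => ?_) (hP.sum_signed_defect_le u)
  have : u x * P.pFun ubar x ≤ |u x| * |P.pFun ubar x| := by
    rw [← abs_mul]; exact le_abs_self _
  linarith

/-- The mass of a sparse measure near an active point is bounded below once the residual is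
small: testing `K u ≈ K ubar` with a biorthogonal family isolates the mass near each point. -/
lemma exists_mass_le {R σ CK' M : ℝ} (hR0 : 0 < R) (hR : R < R')
    (hloc : P.IsLocalization ubar Abar θ R σ) (hCK'0 : 0 < CK')
    (hCK' : ∀ x ∈ ballUnion Abar R', ‖fderiv ℝ P.κ x‖ ≤ CK') (hM : 0 < M) :
    ∃ Δ > 0, ∃ m > 0, ∀ u : SparseMeasure P.Ω, P.residual (toRadon u) ≤ Δ → ‖toRadon u‖ ≤ M →
      (∀ x ∈ u.support, (x : EuclideanSpace ℝ (Fin d)) ∈ ballUnion Abar R) →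
      ∀ xbar ∈ Abar,
        m ≤ |∑ x ∈ u.support with dist x.1 xbar < R, u x| := by
  classical
  obtain ⟨c, hc0, hKc⟩ := hP.exists_weights
  have hθ := hP.θ_pos
  have hpt : ∀ xbar ∈ Abar, ∃ Δ > 0, ∀ u : SparseMeasure P.Ω, P.residual (toRadon u) ≤ Δ →
      ‖toRadon u‖ ≤ M → (∀ x ∈ u.support, (x : EuclideanSpace ℝ (Fin d)) ∈ ballUnion Abar R) →
      |c xbar| / 2 ≤ |∑ x ∈ u.support with dist x.1 xbar < R, u x| := by
    intro xbar hb
    obtain ⟨e, he1, he0⟩ := exists_biorthogonal hP.linearIndependent ⟨xbar, hb⟩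
    have hcpos : 0 < |c xbar| := abs_pos.2 (hc0 xbar hb)
    let δ := |c xbar| / (4 * (‖e‖ + 1))
    have hδ : 0 < δ := by positivity
    have heδ : ‖e‖ * δ ≤ |c xbar| / 4 := by
      have : (‖e‖ + 1) * δ = |c xbar| / 4 := by simp only [δ]; field_simp
      nlinarith
    obtain ⟨Δ₁, hΔ₁, hK⟩ := hP.exists_norm_K_sub_le_of_pos hδ
    refine ⟨min Δ₁ (θ * (δ / CK') ^ 2 / (8 * M)), lt_min hΔ₁ (by positivity),
      fun u hu huM hsupp => ?_⟩
    have hctr : ∀ x ∈ u.support, ∃ z ∈ Abar, dist (x : EuclideanSpace ℝ (Fin d)) z < R :=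
      fun x hx => mem_ballUnion.1 (hsupp x hx)
    choose! z hzA hzd using hctr
    have hinner : ∀ w ∈ Abar, inner ℝ (P.κ w) e = if w = xbar then 1 else 0 := by
      intro w hw
      split_ifs with h
      · subst h; exact he1
      · exact he0 ⟨w, hw⟩ fun h' => h (congrArg Subtype.val h')
    have hubar : inner ℝ (P.K ubar) e = c xbar := by
      rw [hKc, sum_inner, Finset.sum_eq_single_of_mem xbar hb]
      · rw [real_inner_smul_left, hinner xbar hb, if_pos rfl, mul_one]
      · intro w hw hne
        rw [real_inner_smul_left, hinner w hw, if_neg hne, mul_zero]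
    have hS : ∑ x ∈ u.support with dist x.1 xbar < R, u x =
        ∑ x ∈ u.support, u x * inner ℝ (P.κ (z x)) e := by
      rw [Finset.sum_filter]
      refine Finset.sum_congr rfl fun x hx => ?_
      rw [hinner _ (hzA x hx)]
      by_cases h : z x = xbar
      · rw [if_pos h, if_pos (h ▸ hzd x hx), mul_one]
      · rw [if_neg h, if_neg, mul_zero]
        intro hlt
        exact h (hP.eq_of_mem_ball (hzA x hx) hb ((hzd x hx).trans hR) (hlt.trans hR))
    have hKu : inner ℝ (P.K (toRadon u)) e = ∑ x ∈ u.support, u x * inner ℝ (P.κ x) e := by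
      rw [K_toRadon, sum_inner]
      exact Finset.sum_congr rfl fun x _ => real_inner_smul_left _ _ _
    set D := ∑ x ∈ u.support, |u x| * ‖(x : EuclideanSpace ℝ (Fin d)) - z x‖ with hD
    have hD0 : 0 ≤ D := Finset.sum_nonneg fun _ _ => by positivity
    have hDle : D ≤ δ / CK' := by
      have h1 := sum_mul_sq_le_of_nonneg u.support
        (a := fun x => |u x|) (b := fun x => ‖(x : EuclideanSpace ℝ (Fin d)) - z x‖)
        fun _ _ => abs_nonneg _
      rw [← norm_toRadon] at h1
      have h2 : θ / 8 * ∑ x ∈ u.support, |u x| * ‖(x : EuclideanSpace ℝ (Fin d)) - z x‖ ^ 2 ≤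
          P.residual (toRadon u) := by
        refine le_trans ?_ (hP.sum_defect_le u)
        rw [Finset.mul_sum]
        refine Finset.sum_le_sum fun x hx => ?_
        have := mul_le_mul_of_nonneg_left
          (hP.growth_of_isLocalization hR0 hloc (hzA x hx) (hzd x hx)) (abs_nonneg (u x))
        linarith
      set Q := ∑ x ∈ u.support, |u x| * ‖(x : EuclideanSpace ℝ (Fin d)) - z x‖ ^ 2
      have hQ0 : 0 ≤ Q := Finset.sum_nonneg fun _ _ => by positivity
      have h3 := h2.trans (hu.trans (min_le_right _ _))
      have h4 : M * Q ≤ (δ / CK') ^ 2 := by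
        rw [le_div_iff₀ (by positivity)] at h3
        have h5 : θ * (M * Q) ≤ θ * (δ / CK') ^ 2 := by linarith
        exact le_of_mul_le_mul_left h5 hθ
      have h5 : ‖toRadon u‖ * Q ≤ M * Q := mul_le_mul_of_nonneg_right huM hQ0
      exact le_of_sq_le_sq (h1.trans (h5.trans h4)) (by positivity)
    have hdiff : |inner ℝ (P.K (toRadon u)) e - ∑ x ∈ u.support, u x * inner ℝ (P.κ (z x)) e| ≤
        ‖e‖ * δ := by
      rw [hKu, ← Finset.sum_sub_distrib]
      refine (Finset.abs_sum_le_sum_abs _ _).trans ?_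
      calc _ ≤ ∑ x ∈ u.support, ‖e‖ * CK' *
            (|u x| * ‖(x : EuclideanSpace ℝ (Fin d)) - z x‖) := by
            refine Finset.sum_le_sum fun x hx => ?_
            rw [← mul_sub, ← inner_sub_left, abs_mul]
            have h1 := hP.norm_κ_sub_le hCK' (hzA x hx) (x := x) (y := z x)
              ((hzd x hx).trans hR) (Metric.mem_ball_self hP.R'_pos)
            have h2 := (abs_real_inner_le_norm (P.κ x - P.κ (z x)) e).trans
              (mul_le_mul_of_nonneg_right h1 (norm_nonneg e))
            have h3 := mul_le_mul_of_nonneg_left h2 (abs_nonneg (u x))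
            linarith
        _ = ‖e‖ * (CK' * D) := by rw [← Finset.mul_sum, mul_assoc]
        _ ≤ ‖e‖ * (CK' * (δ / CK')) := by gcongr
        _ = ‖e‖ * δ := by field_simp
    have hKd : |inner ℝ (P.K (toRadon u)) e - c xbar| ≤ ‖e‖ * δ := by
      rw [← hubar, ← inner_sub_left]
      refine (abs_real_inner_le_norm _ _).trans ?_
      rw [mul_comm]
      exact mul_le_mul_of_nonneg_left (hK _ (hu.trans (min_le_left _ _))) (norm_nonneg _)
    rw [hS]
    set a := inner ℝ (P.K (toRadon u)) e
    set b := ∑ x ∈ u.support, u x * inner ℝ (P.κ (z x)) e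
    have h1 := abs_sub_abs_le_abs_sub (c xbar) b
    have h2 := abs_sub_le (c xbar) a b
    rw [abs_sub_comm (c xbar) a] at h2
    linarith
  choose! Δ hΔ hmass using hpt
  obtain ⟨Δ₀, hΔ₀, hle⟩ := exists_pos_le_of_finset Abar hΔ
  obtain ⟨m, hm, hmle⟩ := exists_pos_le_of_finset Abar (f := fun x => |c x| / 2)
    fun x hx => by have := abs_pos.2 (hc0 x hx); positivity
  exact ⟨Δ₀, hΔ₀, m, hm, fun u hu huM hsupp xbar hb =>
    (hmle xbar hb).trans (hmass xbar hb u (hu.trans (hle xbar hb)) huM hsupp)⟩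

end IsNondegenerate
end Problem

variable {d : ℕ} {Y : Type*} [NormedAddCommGroup Y] [InnerProductSpace ℝ Y] [CompleteSpace Y]
variable {P : Problem d Y} {c : Params}

/-! ### The coefficient step -/

section Coefficient

variable {u w v : SparseMeasure P.Ω}

lemma signedMeasure_apply (u w : SparseMeasure P.Ω) (x : P.Ω) :
    signedMeasure u w x = Real.sign (u x) * w x := by
  classical
  rw [signedMeasure, Finsupp.finsetSum_apply]
  by_cases hx : x ∈ u.support
  · rw [Finset.sum_eq_single_of_mem x hx fun y _ hy => by simp [hy]]
    simp
  · rw [Finset.sum_eq_zero fun y hy => ?_]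
    · simp [Finsupp.notMem_support_iff.1 hx]
    · have : y ≠ x := fun h => hx (h ▸ hy)
      simp [this]

lemma support_signedMeasure_subset (u w : SparseMeasure P.Ω) :
    (signedMeasure u w).support ⊆ u.support := by
  intro x hx
  rw [Finsupp.mem_support_iff, signedMeasure_apply] at hx
  rw [Finsupp.mem_support_iff]
  intro h0
  simp [h0] at hx

lemma abs_signedMeasure_apply (hw : w ∈ positiveOn u) (x : P.Ω) :
    |signedMeasure u w x| = w x := by
  rw [signedMeasure_apply]
  by_cases hx : u x = 0
  · have : w x = 0 := by
      by_contra h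
      exact Finsupp.mem_support_iff.1 (hw.1 (Finsupp.mem_support_iff.2 h)) hx
    simp [this]
  · rw [abs_mul, abs_sign_of_ne_zero hx, one_mul, abs_of_nonneg (hw.2 x)]

lemma norm_signedMeasure (hw : w ∈ positiveOn u) :
    ‖toRadon (signedMeasure u w)‖ = ‖toRadon w‖ := by
  rw [norm_toRadon_of_subset (support_signedMeasure_subset u w), norm_toRadon_of_subset hw.1]
  exact Finset.sum_congr rfl fun x _ => by rw [abs_signedMeasure_apply hw, abs_of_nonneg (hw.2 x)]

lemma K_signedMeasure (u w : SparseMeasure P.Ω) :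
    P.K (toRadon (signedMeasure u w)) = signedK P u w := by
  rw [P.K_toRadon_of_subset (support_signedMeasure_subset u w), signedK]
  simp_rw [signedMeasure_apply]

lemma J_signedMeasure (hw : w ∈ positiveOn u) :
    P.J (toRadon (signedMeasure u w)) = signedJ P u w := by
  rw [Problem.J, signedJ, norm_signedMeasure hw, K_signedMeasure]

lemma apply_toRadon_sub_of_subset {S : Finset P.Ω} {v w : SparseMeasure P.Ω} (hv : v.support ⊆ S)
    (hw : w.support ⊆ S) (f : C(P.Ω, ℝ)) :
    (toRadon v - toRadon w) f = ∑ x ∈ S, f x * (v x - w x) := by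
  rw [_root_.sub_apply, toRadon_apply_of_subset hv, toRadon_apply_of_subset hw,
    ← Finset.sum_sub_distrib]
  exact Finset.sum_congr rfl fun x _ => by ring

/-- The signed gap is the gap of the associated signed measures. -/
lemma gap_signedMeasure (hw : w ∈ positiveOn u) (hv : v ∈ positiveOn u) :
    P.gap (toRadon (signedMeasure u w)) (toRadon (signedMeasure u v)) = signedGap P u w v := by
  rw [Problem.gap, signedGap, norm_signedMeasure hw, norm_signedMeasure hv,
    apply_toRadon_sub_of_subset (support_signedMeasure_subset u v)
      (support_signedMeasure_subset u w)]
  congr 2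
  refine Finset.sum_congr rfl fun x _ => ?_
  rw [signedMeasure_apply, signedMeasure_apply, signedP, ← K_signedMeasure, Problem.p_apply,
    Problem.pFun]
  ring

lemma signedGap_le_signedDualGap (hv : v ∈ positiveOn u) (hvM : ‖toRadon v‖ ≤ c.M) :
    signedGap P u w v ≤ signedDualGap P c u w := by
  refine le_csSup ?_ ⟨v, ⟨hv, hvM⟩, rfl⟩
  refine ⟨∑ x ∈ u.support, (|signedP P u w x| * c.M - signedP P u w x * w x) +
    P.α * ‖toRadon w‖, ?_⟩
  rintro _ ⟨v, ⟨-, hvM⟩, rfl⟩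
  have h0 : 0 ≤ P.α * ‖toRadon v‖ := mul_nonneg P.α_pos.le (toRadon v).opNorm_nonneg
  have h1 : ∑ x ∈ u.support, signedP P u w x * (v x - w x) ≤
      ∑ x ∈ u.support, (|signedP P u w x| * c.M - signedP P u w x * w x) := by
    refine Finset.sum_le_sum fun x _ => ?_
    have h2 : signedP P u w x * v x ≤ |signedP P u w x| * c.M := by
      refine (le_abs_self _).trans ?_
      rw [abs_mul]
      exact mul_le_mul_of_nonneg_left ((abs_apply_le_norm_toRadon v x).trans hvM) (abs_nonneg _)
    linarith
  simp only [signedGap]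
  linarith

lemma gap_le_signedDualGap (hw : w ∈ positiveOn u) (hv : v ∈ positiveOn u)
    (hvM : ‖toRadon v‖ ≤ c.M) :
    P.gap (toRadon (signedMeasure u w)) (toRadon (signedMeasure u v)) ≤ signedDualGap P c u w := by
  rw [gap_signedMeasure hw hv]
  exact signedGap_le_signedDualGap hv hvM

lemma mapRange_abs_mem_positiveOn (hv : v.support ⊆ u.support) :
    v.mapRange (fun a => |a|) abs_zero ∈ positiveOn u :=
  ⟨Finsupp.support_mapRange.trans hv, fun x => by simp⟩

lemma norm_mapRange_abs (v : SparseMeasure P.Ω) :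
    ‖toRadon (v.mapRange (fun a => |a|) abs_zero)‖ = ‖toRadon v‖ := by
  rw [norm_toRadon_of_subset (S := v.support) Finsupp.support_mapRange, norm_toRadon]
  simp

lemma J_le_of_coefficientStep {Ψ : ℝ} {uplus : SparseMeasure P.Ω}
    (h : CoefficientStep P c u Ψ uplus w) : P.J (toRadon uplus) ≤ P.J (toRadon u) := by
  obtain ⟨hw, hJ, -, rfl⟩ := h
  rw [J_signedMeasure hw]
  refine hJ.trans (le_of_eq ?_)
  rw [← J_signedMeasure (mapRange_abs_mem_positiveOn subset_rfl)]
  congr 2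
  ext x
  rw [signedMeasure_apply, Finsupp.mapRange_apply]
  rcases lt_trichotomy (u x) 0 with h | h | h
  · rw [Real.sign_of_neg h, abs_of_neg h]; ring
  · simp [h]
  · rw [Real.sign_of_pos h, abs_of_pos h]; ring

end Coefficient

lemma J_dropStep_le (u : SparseMeasure P.Ω) :
    P.J (toRadon (dropStep P c u)) ≤ P.J (toRadon u) := by
  rw [dropStep]
  split_ifs with h
  · exact h
  · exact le_rfl

/-! ### Maximal gaps and the conditional gradient step -/

/-- The maximum of `φ(u, ·)` over the ball of radius `M`, in closed form. -/
noncomputable def maxGap (P : Problem d Y) (c : Params) (u : RadonMeasure P.Ω) : ℝ :=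
  P.α * ‖u‖ - u (P.p u) + c.M * max 0 (‖P.p u‖ - P.α)

lemma gap_le_maxGap (u : RadonMeasure P.Ω) {v : RadonMeasure P.Ω} (hv : ‖v‖ ≤ c.M) :
    P.gap u v ≤ maxGap P c u := by
  have h0 := v.opNorm_nonneg
  have h1 : v (P.p u) ≤ ‖v‖ * ‖P.p u‖ := (le_abs_self _).trans (v.le_opNorm _)
  have h2 : ‖v‖ * (‖P.p u‖ - P.α) ≤ c.M * max 0 (‖P.p u‖ - P.α) :=
    (mul_le_mul_of_nonneg_left (le_max_right 0 _) h0).trans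
      (mul_le_mul_of_nonneg_right hv (le_max_left _ _))
  rw [Problem.gap, maxGap, _root_.sub_apply]
  linarith

lemma norm_diracDirection_le (hM : 0 < c.M) (u : SparseMeasure P.Ω) (x : P.Ω) :
    ‖toRadon (diracDirection P c u x)‖ ≤ c.M := by
  rw [diracDirection, norm_toRadon_single, abs_mul, abs_of_pos hM]
  exact mul_le_of_le_one_right hM.le (abs_sign_le_one _)

/-- The exact direction attains the maximal gap. -/
lemma IsExact.gap_eq {u v : SparseMeasure P.Ω} (hM : 0 < c.M) (h : IsExact P c u v) :
    P.gap (toRadon u) (toRadon v) = maxGap P c (toRadon u) := by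
  rcases h with ⟨hlt, rfl⟩ | ⟨hle, x, hx, rfl⟩
  · rw [maxGap, max_eq_left (by linarith), Problem.gap, toRadon_zero, zero_sub,
      _root_.neg_apply, ContinuousLinearMap.opNorm_zero]
    ring
  · have hnorm : ‖P.p (toRadon u)‖ = |P.p (toRadon u) x| :=
      le_antisymm ((ContinuousMap.norm_le _ (abs_nonneg _)).2 hx)
        ((P.p (toRadon u)).norm_coe_le_norm x)
    have hne : P.p (toRadon u) x ≠ 0 := by
      rw [← abs_pos, ← hnorm]; linarith [P.α_pos]
    rw [maxGap, max_eq_right (by linarith), Problem.gap, _root_.sub_apply, diracDirection,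
      norm_toRadon_single, toRadon_single, abs_mul, abs_sign_of_ne_zero hne, abs_of_pos hM,
      _root_.smul_apply, smul_eq_mul]
    have : (dirac x : RadonMeasure P.Ω) (P.p (toRadon u)) = P.p (toRadon u) x := rfl
    rw [this, mul_assoc, sign_mul_self_eq_abs, ← hnorm]
    ring

section Minimizer

variable {ubar : RadonMeasure P.Ω} (hmin : ∀ v, P.J ubar ≤ P.J v) (hubar : ‖ubar‖ ≤ c.M)
include hmin hubar

lemma residual_le_maxGap (u : RadonMeasure P.Ω) : P.residual u ≤ maxGap P c u := by
  rw [Problem.residual_eq hmin]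
  exact (P.J_sub_le_gap u ubar).trans (gap_le_maxGap u hubar)

/-- Properties of the conditional gradient step, given the tolerance invariant
`r_J(u) ≤ 2 M ε`: the gap of the chosen direction is comparable to the residual, the objective
decreases at the sublinear rate, and the invariant persists. -/
lemma LGCGStep.spec {u uplus v : SparseMeasure P.Ω} {ε εplus : ℝ} (hM : 0 < c.M) (hL0 : 0 < c.L)
    (hL : ∀ y₁ y₂, ‖gradient P.F y₁ - gradient P.F y₂‖ ≤ c.L * ‖y₁ - y₂‖)
    (hCK0 : 0 < c.CK) (hCK : ∀ x ∈ P.Ω, ‖P.κ x‖ ≤ c.CK) (hu : ‖toRadon u‖ ≤ c.M) (hε : 0 ≤ ε)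
    (hr : P.residual (toRadon u) ≤ 2 * c.M * ε)
    (h : LGCGStep P c u ε (4 * c.L * c.M ^ 2 * c.CK ^ 2) uplus v εplus) :
    ‖toRadon v‖ ≤ c.M ∧ P.residual (toRadon u) ≤ 2 * P.gap (toRadon u) (toRadon v) ∧
      0 ≤ εplus ∧ P.residual (toRadon u) ≤ 2 * c.M * εplus ∧
      P.J (toRadon uplus) ≤ P.J (toRadon u) ∧
      P.J (toRadon uplus) ≤ P.J (toRadon u) - min (P.residual (toRadon u) / 4)
        (P.residual (toRadon u) ^ 2 / (32 * c.L * c.M ^ 2 * c.CK ^ 2)) := by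
  have hr0 := Problem.residual_nonneg hmin (toRadon u)
  set r := P.residual (toRadon u) with hrdef
  set C := 4 * c.L * c.M ^ 2 * c.CK ^ 2 with hC
  have hC0 : 0 < C := by positivity
  -- The decrease for the step size `min 1 (t / C)`, where `t` is at most the gap.
  have main : ∀ t, r / 2 ≤ t → t ≤ P.gap (toRadon u) (toRadon v) → ‖toRadon v‖ ≤ c.M →
      uplus = (1 - min 1 (t / C)) • u + min 1 (t / C) • v →
      P.J (toRadon uplus) ≤ P.J (toRadon u) ∧
      P.J (toRadon uplus) ≤ P.J (toRadon u) - min (r / 4)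
        (r ^ 2 / (32 * c.L * c.M ^ 2 * c.CK ^ 2)) := by
    intro t ht htg hv hup
    have ht0 : 0 ≤ t := by linarith
    set η := min 1 (t / C) with hη
    have hη0 : 0 ≤ η := le_min zero_le_one (by positivity)
    have hJ := P.J_convexComb_le hL (toRadon u) (toRadon v) hη0 (min_le_left _ _)
    rw [← toRadon_smul, ← toRadon_smul, ← toRadon_add, ← hup] at hJ
    have hKn : c.L / 2 * ‖P.K (toRadon v) - P.K (toRadon u)‖ ^ 2 ≤ C / 2 := by
      have h1 : ‖P.K (toRadon v) - P.K (toRadon u)‖ ≤ 2 * (c.CK * c.M) := by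
        refine (norm_sub_le _ _).trans ?_
        have h2 := (P.norm_K_le hCK0.le hCK (toRadon v)).trans
          (mul_le_mul_of_nonneg_left hv hCK0.le)
        have h3 := (P.norm_K_le hCK0.le hCK (toRadon u)).trans
          (mul_le_mul_of_nonneg_left hu hCK0.le)
        linarith
      calc _ ≤ c.L / 2 * (2 * (c.CK * c.M)) ^ 2 := by gcongr
        _ = C / 2 := by rw [hC]; ring
    have hηt : η * C ≤ t := by
      rw [← le_div_iff₀ hC0]; exact min_le_right _ _
    have hdec : P.J (toRadon uplus) ≤ P.J (toRadon u) - η * t / 2 := by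
      have h1 : η * t ≤ η * P.gap (toRadon u) (toRadon v) := mul_le_mul_of_nonneg_left htg hη0
      have h2 : η ^ 2 * (c.L / 2 * ‖P.K (toRadon v) - P.K (toRadon u)‖ ^ 2) ≤ η ^ 2 * (C / 2) :=
        mul_le_mul_of_nonneg_left hKn (sq_nonneg _)
      have h3 : η * (η * C) ≤ η * t := mul_le_mul_of_nonneg_left hηt hη0
      nlinarith
    refine ⟨hdec.trans (sub_le_self _ (by positivity)), hdec.trans (sub_le_sub_left ?_ _)⟩
    rcases le_total 1 (t / C) with h1 | h1
    · rw [hη, min_eq_left h1]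
      exact (min_le_left _ _).trans (by linarith)
    · rw [hη, min_eq_right h1]
      refine (min_le_right _ _).trans ?_
      have h2 : r ^ 2 / (32 * c.L * c.M ^ 2 * c.CK ^ 2) = (r / 2) * (r / 2) / C / 2 := by
        rw [hC]; field_simp; ring
      have h3 : (r / 2) * (r / 2) ≤ t * t := by gcongr
      calc _ = (r / 2) * (r / 2) / C / 2 := h2
        _ ≤ t * t / C / 2 := by gcongr
        _ = t / C * t / 2 := by ring
  rcases h with ⟨⟨hv, hgap⟩, rfl, hup⟩ | ⟨-, hex, rfl, hup⟩
  · have hvM : ‖toRadon v‖ ≤ c.M := by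
      rcases hv with rfl | ⟨x, rfl⟩
      · rw [toRadon_zero, ContinuousLinearMap.opNorm_zero]; exact hM.le
      · exact norm_diracDirection_le hM u x
    obtain ⟨h1, h2⟩ := main (c.M * εplus) (by linarith) hgap hvM hup
    exact ⟨hvM, by linarith, hε, hr, h1, h2⟩
  · have hg := hex.gap_eq hM
    have hrg := residual_le_maxGap hmin hubar (toRadon u)
    rw [← hg, ← hrdef] at hrg
    have hvM : ‖toRadon v‖ ≤ c.M := by
      rcases hex with ⟨-, rfl⟩ | ⟨-, x, -, rfl⟩
      · rw [toRadon_zero, ContinuousLinearMap.opNorm_zero]; exact hM.le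
      · exact norm_diracDirection_le hM u x
    obtain ⟨h1, h2⟩ := main _ (by linarith) le_rfl hvM hup
    have e : 2 * c.M * (P.gap (toRadon u) (toRadon v) / (2 * c.M)) =
        P.gap (toRadon u) (toRadon v) := by field_simp
    exact ⟨hvM, by linarith, by have := hr0.trans hrg; positivity, by rw [e]; exact hrg, h1, h2⟩

end Minimizer

variable {ubar : RadonMeasure P.Ω} {Abar : Finset (EuclideanSpace ℝ (Fin d))} {R' σ' γ θ : ℝ}

/-! ### Clustered measures and the drop step -/

/-- Every atom of `u` lies in the open `R`-ball around an active point and carries the sign of the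
dual certificate there. -/
def Clustered (P : Problem d Y) (c : Params) (ubar : RadonMeasure P.Ω)
    (Abar : Finset (EuclideanSpace ℝ (Fin d))) (u : SparseMeasure P.Ω) : Prop :=
  ∀ x ∈ u.support, ∃ xbar ∈ Abar, dist x.1 xbar < c.R ∧
    Real.sign (u x) = Real.sign (P.pFun ubar xbar)

lemma Clustered.signedMeasure {u w : SparseMeasure P.Ω} (h : Clustered P c ubar Abar u)
    (hw : w ∈ positiveOn u) : Clustered P c ubar Abar (signedMeasure u w) := by
  intro x hx
  obtain ⟨xbar, hb, hd, hs⟩ := h x (support_signedMeasure_subset u w hx)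
  refine ⟨xbar, hb, hd, ?_⟩
  rw [← hs, signedMeasure_apply]
  have hne : SparseMin.signedMeasure u w x ≠ 0 := Finsupp.mem_support_iff.1 hx
  rw [signedMeasure_apply] at hne
  have hw0 : 0 < w x := lt_of_le_of_ne (hw.2 x) fun h0 => hne (by rw [← h0, mul_zero])
  rcases lt_trichotomy (u x) 0 with h | h | h
  · rw [Real.sign_of_neg h, Real.sign_of_neg (by linarith)]
  · simp [h]
  · rw [Real.sign_of_pos h, Real.sign_of_pos (by linarith)]

/-- For small residuals the drop step is effective and returns a clustered measure: the mass it
removes is of the order of the residual, so the linear decrease of the objective dominates. -/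
lemma exists_clustered_dropStep (hP : P.IsNondegenerate ubar Abar R' σ' γ θ)
    (hc : c.IsAdmissible P ubar Abar R' σ') :
    ∃ Δ > 0, ∀ u : SparseMeasure P.Ω, P.residual (toRadon u) ≤ Δ →
      Clustered P c ubar Abar (dropStep P c u) := by
  classical
  obtain ⟨Δ₁, hΔ₁, hloc⟩ := hc.localization
  have hσ := hc.σ_pos
  have hσα : c.σ < P.α := hc.σ_le.trans_lt hP.σ'_lt
  have hL := hc.L_pos
  have hCK := hc.CK_pos
  obtain ⟨Δ₂, hΔ₂, hp⟩ := hP.exists_abs_pFun_sub_le (δ := c.σ / 4) (by positivity)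
  refine ⟨min Δ₁ (min Δ₂ (c.σ ^ 2 / (4 * c.L * c.CK ^ 2))),
    lt_min hΔ₁ (lt_min hΔ₂ (by positivity)), fun u hu => ?_⟩
  have hu1 := hu.trans (min_le_left _ _)
  have hpu := hp _ (hu.trans ((min_le_right _ _).trans (min_le_left _ _)))
  have hu3 := hu.trans ((min_le_right _ _).trans (min_le_right _ _))
  set dr := drop P c u with hdr
  set D : Finset P.Ω := u.support.filter fun x =>
    Real.sign (P.p (toRadon u) x) ≠ Real.sign (u x) ∨ |P.p (toRadon u) x| ≤ P.α - c.σ / 2 with hD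
  have hdrx : ∀ x, dr x = if Real.sign (P.p (toRadon u) x) ≠ Real.sign (u x) ∨
      |P.p (toRadon u) x| ≤ P.α - c.σ / 2 then 0 else u x := by
    intro x
    rw [hdr, drop, Finsupp.filter_apply]
    by_cases h : Real.sign (P.p (toRadon u) x) ≠ Real.sign (u x) ∨
      |P.p (toRadon u) x| ≤ P.α - c.σ / 2
    · rw [if_pos h, if_neg (not_not.2 h)]
    · rw [if_neg h, if_pos h]
  have hdrop : ∀ x ∈ D, u x * P.p (toRadon u) x ≤ |u x| * (P.α - c.σ / 2) := by
    intro x hx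
    have hb : 0 ≤ P.α - c.σ / 2 := by linarith
    rcases (Finset.mem_filter.1 hx).2 with h | h
    · refine le_trans ?_ (mul_nonneg (abs_nonneg _) hb)
      have hux : u x ≠ 0 := Finsupp.mem_support_iff.1 (Finset.mem_filter.1 hx).1
      by_contra! hpos
      apply h
      rcases lt_or_gt_of_ne hux with h1 | h1
      · rw [Real.sign_of_neg h1, Real.sign_of_neg (by nlinarith)]
      · rw [Real.sign_of_pos h1, Real.sign_of_pos (by nlinarith)]
    · refine (le_abs_self _).trans ?_
      rw [abs_mul]
      exact mul_le_mul_of_nonneg_left h (abs_nonneg _)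
  -- The dropped part `h` and its mass `m`.
  let h : SparseMeasure P.Ω := dr - u
  have hhx : ∀ x, h x = if x ∈ D then -u x else 0 := by
    intro x
    simp only [h, Finsupp.sub_apply, hdrx, hD, Finset.mem_filter, Finsupp.mem_support_iff]
    by_cases h0 : u x = 0
    · simp [h0]
    · simp only [ne_eq, h0, not_false_eq_true, true_and]
      split_ifs <;> simp
  have hhsupp : h.support ⊆ D := by
    intro x hx
    by_contra hnot
    exact Finsupp.mem_support_iff.1 hx (by rw [hhx, if_neg hnot])
  set m := ∑ x ∈ D, |u x| with hm
  have hm0 : 0 ≤ m := Finset.sum_nonneg fun _ _ => abs_nonneg _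
  have hnh : ‖toRadon h‖ = m := by
    rw [norm_toRadon_of_subset hhsupp]
    exact Finset.sum_congr rfl fun x hx => by rw [hhx, if_pos hx, abs_neg]
  have hmle : c.σ / 4 * m ≤ P.residual (toRadon u) := by
    refine le_trans ?_ (hP.sum_signed_defect_le u)
    rw [hm, Finset.mul_sum]
    refine le_trans (Finset.sum_le_sum fun x hx => ?_)
      (Finset.sum_le_sum_of_subset_of_nonneg (Finset.filter_subset _ _) fun x _ _ => ?_)
    · have h1 := hdrop x hx
      have h2 : u x * P.pFun ubar x - u x * P.pFun (toRadon u) x ≤ |u x| * (c.σ / 4) := by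
        rw [← mul_sub]
        refine (le_abs_self _).trans ?_
        rw [abs_mul, abs_sub_comm]
        exact mul_le_mul_of_nonneg_left (hpu x x.2) (abs_nonneg _)
      rw [P.p_apply] at h1
      linarith
    · have h1 := Problem.abs_pFun_minimizer_le hP.minimizer x
      have h2 := (le_abs_self _).trans (abs_mul (u x) (P.pFun ubar x)).le
      have h3 := mul_le_mul_of_nonneg_left h1 (abs_nonneg (u x))
      linarith
  have hndr : ‖toRadon dr‖ = ‖toRadon u‖ - m := by
    have hs : dr.support ⊆ u.support := by
      intro x hx
      rw [Finsupp.mem_support_iff] at hx ⊢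
      intro h0
      apply hx
      rw [hdrx, h0, ite_self]
    rw [norm_toRadon_of_subset hs, norm_toRadon, hm, hD, Finset.sum_filter,
      ← Finset.sum_sub_distrib]
    refine Finset.sum_congr rfl fun x _ => ?_
    rw [hdrx]
    split_ifs <;> simp
  have hph : c.σ / 2 * m ≤ toRadon h (P.p (toRadon u)) + P.α * m := by
    rw [toRadon_apply_of_subset hhsupp, hm, Finset.mul_sum, Finset.mul_sum,
      ← Finset.sum_add_distrib]
    refine Finset.sum_le_sum fun x hx => ?_
    rw [hhx, if_pos hx]
    linarith [hdrop x hx]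
  have hJ : P.J (toRadon dr) ≤ P.J (toRadon u) := by
    have h1 := P.J_add_le hc.lipschitz (toRadon u) (toRadon h)
    have e : toRadon u + toRadon h = toRadon dr := by
      rw [← toRadon_add]; simp [h]
    rw [e, hndr] at h1
    have h2 : ‖P.K (toRadon h)‖ ≤ c.CK * m := by
      rw [← hnh]; exact P.norm_K_le hCK.le hc.norm_κ_le _
    have h3 : c.L / 2 * ‖P.K (toRadon h)‖ ^ 2 ≤ c.L / 2 * (c.CK * m) ^ 2 := by gcongr
    have h4 : m * (c.L * c.CK ^ 2) ≤ c.σ := by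
      have h5 : c.σ / 4 * m ≤ c.σ ^ 2 / (4 * c.L * c.CK ^ 2) := hmle.trans hu3
      rw [le_div_iff₀ (by positivity)] at h5
      have h6 : c.σ * (m * (c.L * c.CK ^ 2)) ≤ c.σ * c.σ := by linarith
      exact le_of_mul_le_mul_left h6 hσ
    have h5 := mul_le_mul_of_nonneg_left h4 hm0
    nlinarith
  rw [dropStep, if_pos hJ]
  intro x hx
  have hxne : dr x ≠ 0 := Finsupp.mem_support_iff.1 hx
  rw [hdrx] at hxne
  have hnot : ¬(Real.sign (P.p (toRadon u) x) ≠ Real.sign (u x) ∨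
      |P.p (toRadon u) x| ≤ P.α - c.σ / 2) := fun h => hxne (if_pos h)
  have hval : dr x = u x := by rw [hdrx, if_neg hnot]
  push Not at hnot
  obtain ⟨xbar, hb, hd⟩ := Problem.mem_ballUnion.1
    (hP.mem_ballUnion_of_lt hc.R_pos hc.R_lt (hloc _ hu1).2 x.2 hnot.2)
  refine ⟨xbar, hb, hd, ?_⟩
  rw [hval, ← hnot.1]
  exact ((hloc _ hu1).1 xbar hb).1 x hd

/-! ### The loop of the local step -/

/-- If proximity is transitive on the atoms and the admissible points, and every atom admits an
improvement, then the loop collects exactly one point near each atom. -/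
lemma LSILoop.spec {u : SparseMeasure P.Ω} {X : Set P.Ω}
    (htrans : ∀ x ∈ X, ∀ y ∈ X, ∀ z ∈ X, dist x y < 2 * c.R → dist y z < 2 * c.R →
      dist x z < 2 * c.R)
    (hmem : ∀ x y, IsLSIPoint P c u x y → y ∈ X)
    {A B : Finset P.Ω} (h : LSILoop P c u A B) (hA : ∀ x ∈ A, x ∈ X)
    (hex : ∀ x ∈ A, ∃ y, IsLSIPoint P c u x y) :
    (∀ y ∈ B, ∃ x ∈ A, IsLSIPoint P c u x y) ∧
      ∀ x ∈ A, ∃ y ∈ B, dist x y < 2 * c.R ∧ ∀ y' ∈ B, dist x y' < 2 * c.R → y' = y := by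
  induction h with
  | done => simp
  | skip A B x hx hmax hy h ih => exact absurd (hex x hx) (not_exists.2 hy)
  | found A B x y hx hmax hy h ih =>
    have hsub : ∀ z ∈ A.filter (fun z => ¬ dist z x < 2 * c.R), z ∈ A := fun z hz =>
      (Finset.mem_filter.1 hz).1
    obtain ⟨ih1, ih2⟩ := ih (fun z hz => hA z (hsub z hz)) fun z hz => hex z (hsub z hz)
    have hyX := hmem x y hy
    have hxy : dist x y < 2 * c.R := by rw [dist_comm]; exact hy.1
    have hfar : ∀ y' ∈ B, ∀ z ∈ A, dist z x < 2 * c.R → ¬ dist z y' < 2 * c.R := by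
      intro y' hy' z hz hzx hzy'
      obtain ⟨x', hx', hx'y⟩ := ih1 y' hy'
      have hx'A := hsub x' hx'
      have hy'X := hmem x' y' hx'y
      refine (Finset.mem_filter.1 hx').2 ?_
      have h1 : dist x' y' < 2 * c.R := by rw [dist_comm]; exact hx'y.1
      have h2 : dist y' z < 2 * c.R := by rw [dist_comm]; exact hzy'
      have h3 := htrans x' (hA _ hx'A) y' hy'X z (hA _ hz) h1 h2
      exact htrans x' (hA _ hx'A) z (hA _ hz) x (hA _ hx) h3 hzx
    refine ⟨fun y' hy' => ?_, fun z hz => ?_⟩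
    · rcases Finset.mem_insert.1 hy' with rfl | hy'
      · exact ⟨x, hx, hy⟩
      · obtain ⟨x', hx', h'⟩ := ih1 y' hy'
        exact ⟨x', hsub x' hx', h'⟩
    · by_cases hzx : dist z x < 2 * c.R
      · refine ⟨y, Finset.mem_insert_self _ _,
          htrans z (hA z hz) x (hA x hx) y hyX hzx hxy, fun y' hy' hzy' => ?_⟩
        rcases Finset.mem_insert.1 hy' with rfl | hy'
        · rfl
        · exact absurd hzy' (hfar y' hy' z hz hzx)
      · obtain ⟨y', hy', hzy', huniq⟩ := ih2 z (Finset.mem_filter.2 ⟨hz, hzx⟩)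
        refine ⟨y', Finset.mem_insert_of_mem hy', hzy', fun y'' hy'' hzy'' => ?_⟩
        rcases Finset.mem_insert.1 hy'' with rfl | hy''
        · refine absurd (htrans z (hA z hz) _ hyX x (hA x hx) hzy'' ?_) hzx
          rw [dist_comm]; exact hxy
        · exact huniq y'' hy'' hzy''

/-- The lumped measure transports every atom to the collected point near it. -/
lemma lump_eq_sum {u : SparseMeasure P.Ω} {B : Finset P.Ω} {τ : P.Ω → P.Ω} {r : ℝ}
    (hr : r = 2 * c.R)
    (hτ : ∀ x ∈ u.support, τ x ∈ B ∧ dist x (τ x) < r ∧ ∀ y ∈ B, dist x y < r → y = τ x) :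
    lump P c u B = ∑ x ∈ u.support, Finsupp.single (τ x) (u x) := by
  classical
  subst hr
  have h1 : ∀ y ∈ B, Finsupp.single y (ballMass u y (2 * c.R)) =
      ∑ x ∈ u.support, if dist x y < 2 * c.R then Finsupp.single y (u x) else 0 := by
    intro y _
    rw [ballMass, Finset.sum_filter, Finsupp.single_finsetSum]
    refine Finset.sum_congr rfl fun x _ => ?_
    split_ifs <;> simp
  rw [lump, Finset.sum_congr rfl h1, Finset.sum_comm]
  refine Finset.sum_congr rfl fun x hx => ?_
  obtain ⟨hB, hd, huniq⟩ := hτ x hx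
  rw [Finset.sum_eq_single_of_mem _ hB, if_pos hd]
  intro y hy hne
  rw [if_neg fun h => hne (huniq y hy h)]

/-! ### The local structure of a dual variable -/

/-- The localization properties of one dual variable `p_u`, with `xhat b` the maximizer of `|p_u|`
in the ball around the active point `b`. -/
structure LocalDual (P : Problem d Y) (c : Params) (ubar : RadonMeasure P.Ω)
    (Abar : Finset (EuclideanSpace ℝ (Fin d))) (u : RadonMeasure P.Ω)
    (xhat : EuclideanSpace ℝ (Fin d) → EuclideanSpace ℝ (Fin d)) : Prop where
  sign : ∀ b ∈ Abar, ∀ x ∈ Metric.ball b c.R,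
    Real.sign (P.pFun u x) = Real.sign (P.pFun ubar b)
  mem : ∀ b ∈ Abar, xhat b ∈ Metric.ball b c.R
  isLocalMax : ∀ b ∈ Abar, ∀ x ∈ Metric.ball b c.R,
    IsLocalMax (fun y => |P.pFun u y|) x ↔ x = xhat b
  le_gradient : ∀ b ∈ Abar, ∀ x ∈ Metric.ball b c.R,
    |P.pFun u (xhat b)| - |P.pFun u x| ≤ 2 * c.R * ‖gradient (P.pFun u) x‖
  growth : ∀ b ∈ Abar, ∀ x ∈ Metric.ball b c.R,
    c.θ / 8 * ‖xhat b - x‖ ^ 2 ≤ |P.pFun u (xhat b)| - |P.pFun u x|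
  mem_ballUnion : ∀ x : P.Ω, P.α - c.σ / 2 < |P.pFun u x| → x.1 ∈ Problem.ballUnion Abar c.R
  lt_abs : ∀ b ∈ Abar, P.α - c.σ / 2 < |P.pFun u (xhat b)|

section

variable (hP : P.IsNondegenerate ubar Abar R' σ' γ θ) (hc : c.IsAdmissible P ubar Abar R' σ')
  (hθ : c.θ = θ)

include hP in
lemma abs_le_of_growth {u : RadonMeasure P.Ω}
    {xhat : EuclideanSpace ℝ (Fin d) → EuclideanSpace ℝ (Fin d)} (hθ : c.θ = θ)
    (h : LocalDual P c ubar Abar u xhat) {b x : EuclideanSpace ℝ (Fin d)} (hb : b ∈ Abar)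
    (hx : x ∈ Metric.ball b c.R) : |P.pFun u x| ≤ |P.pFun u (xhat b)| := by
  have h1 := h.growth b hb x hx
  have h2 := hP.θ_pos
  have : 0 ≤ c.θ / 8 * ‖xhat b - x‖ ^ 2 := by rw [hθ]; positivity
  linarith

include hP hc

include hθ in
/-- Localization at a dual variable of small residual, with the values at the maximizers bounded
below since they are close to those of the certificate. -/
lemma exists_localDual : ∃ Δ > 0, ∀ u : RadonMeasure P.Ω, P.residual u ≤ Δ →
    ∃ xhat, LocalDual P c ubar Abar u xhat := by
  obtain ⟨Δ₁, hΔ₁, hloc⟩ := hc.localization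
  have hσ := hc.σ_pos
  obtain ⟨Δ₂, hΔ₂, hp⟩ := hP.exists_abs_pFun_sub_le (δ := c.σ / 4) (by positivity)
  refine ⟨min Δ₁ Δ₂, lt_min hΔ₁ hΔ₂, fun u hu => ?_⟩
  obtain ⟨hin, hout⟩ := hloc u (hu.trans (min_le_left _ _))
  have hpu := hp u (hu.trans (min_le_right _ _))
  choose! hsign hmax hconc using hin
  choose! xhat hmem hmax hgrad hgrow using hmax
  refine ⟨xhat, hsign, hmem, hmax, hgrad, hgrow,
    fun x hx => hP.mem_ballUnion_of_lt hc.R_pos hc.R_lt hout x.2 hx, fun b hb => ?_⟩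
  have h1 := hgrow b hb b (Metric.mem_ball_self hc.R_pos)
  have h2 : 0 ≤ c.θ / 8 * ‖xhat b - b‖ ^ 2 := by have := hP.θ_pos; rw [hθ]; positivity
  have h3 := hpu b (hP.mem_Ω hb)
  have h4 := abs_sub_abs_le_abs_sub (P.pFun ubar b) (P.pFun u b)
  rw [hP.abs_pFun_eq hb, abs_sub_comm] at h4
  linarith

lemma mem_Ω_of_mem_ball {b x : EuclideanSpace ℝ (Fin d)} (hb : b ∈ Abar)
    (hx : x ∈ Metric.ball b c.R) : x ∈ interior (P.Ω : Set (EuclideanSpace ℝ (Fin d))) :=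
  hP.ballUnion_subset (Problem.ball_subset_ballUnion hb R'
    (Metric.ball_subset_ball hc.R_lt.le hx))

/-- Two points of the `R`-balls are at distance less than `2 R` exactly if they lie in the same
ball. -/
lemma dist_lt_two_mul_iff {b b' x y : EuclideanSpace ℝ (Fin d)} (hb : b ∈ Abar) (hb' : b' ∈ Abar)
    (hx : dist x b < c.R) (hy : dist y b' < c.R) : dist x y < 2 * c.R ↔ b = b' := by
  constructor
  · intro h
    by_contra hne
    have h1 := hP.le_dist hb hb' hne
    have h2 := dist_triangle4 b x y b'
    rw [dist_comm b x] at h2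
    have h3 := hc.R_lt
    linarith
  · rintro rfl
    have := dist_triangle_right x y b
    linarith

/-- Hence being at distance less than `2 R` is transitive on the union of the `R`-balls. -/
lemma dist_trans_ballUnion : ∀ x ∈ {x : P.Ω | x.1 ∈ Problem.ballUnion Abar c.R},
    ∀ y ∈ {x : P.Ω | x.1 ∈ Problem.ballUnion Abar c.R},
    ∀ z ∈ {x : P.Ω | x.1 ∈ Problem.ballUnion Abar c.R},
    dist x y < 2 * c.R → dist y z < 2 * c.R → dist x z < 2 * c.R := by
  intro x hx y hy z hz hxy hyz
  obtain ⟨b₁, hb₁, hx⟩ := Problem.mem_ballUnion.1 hx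
  obtain ⟨b₂, hb₂, hy⟩ := Problem.mem_ballUnion.1 hy
  obtain ⟨b₃, hb₃, hz⟩ := Problem.mem_ballUnion.1 hz
  rw [Subtype.dist_eq] at *
  rw [dist_lt_two_mul_iff hP hc hb₁ hb₂ hx hy] at hxy
  rw [dist_lt_two_mul_iff hP hc hb₂ hb₃ hy hz] at hyz
  exact (dist_lt_two_mul_iff hP hc hb₁ hb₃ hx hz).2 (hxy.trans hyz)

omit hP hc

lemma abs_le_localMax {u : SparseMeasure P.Ω} {x z : P.Ω} (hz : z ∈ u.support)
    (hd : dist z x < 2 * c.R) : |P.pFun (toRadon u) z| ≤ localMax P c u x := by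
  refine le_csSup ⟨‖P.p (toRadon u)‖, ?_⟩ ⟨z, ⟨hz, hd⟩, rfl⟩
  rintro _ ⟨y, -, rfl⟩
  exact (P.p (toRadon u)).norm_coe_le_norm y

lemma localMax_le {u : SparseMeasure P.Ω} {x z : P.Ω} {b : ℝ} (hz : z ∈ u.support)
    (hd : dist z x < 2 * c.R)
    (h : ∀ y ∈ u.support, dist y x < 2 * c.R → |P.pFun (toRadon u) y| ≤ b) :
    localMax P c u x ≤ b := by
  refine csSup_le ⟨_, z, ⟨hz, hd⟩, rfl⟩ ?_
  rintro _ ⟨y, ⟨hy, hyd⟩, rfl⟩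
  exact h y hy hyd

include hP hc

include hθ in
/-- The local maximizer of `|p_u|` is always an admissible improvement, so the loop never skips an
atom of a clustered measure. -/
lemma LocalDual.isLSIPoint {u : SparseMeasure P.Ω}
    {xhat : EuclideanSpace ℝ (Fin d) → EuclideanSpace ℝ (Fin d)}
    (h : LocalDual P c ubar Abar (toRadon u) xhat)
    (hsupp : ∀ x ∈ u.support, x.1 ∈ Problem.ballUnion Abar c.R) (hgap : 0 ≤ localDualGap P c u)
    {x : P.Ω} (hx : x ∈ u.support) {b : EuclideanSpace ℝ (Fin d)} (hb : b ∈ Abar)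
    (hxb : dist x.1 b < c.R) :
    IsLSIPoint P c u x ⟨xhat b, interior_subset (mem_Ω_of_mem_ball hP hc hb (h.mem b hb))⟩ := by
  have hmem := h.mem b hb
  refine ⟨?_, h.lt_abs b hb, 0, ?_, by simpa using hgap, ?_⟩
  · rw [Subtype.dist_eq]
    exact (dist_lt_two_mul_iff hP hc hb hb hmem hxb).2 rfl
  · have hs := hP.abs_sign hb
    set s := Real.sign (P.pFun ubar b) with hsdef
    have hd : DifferentiableAt ℝ (P.pFun (toRadon u)) (xhat b) := hP.differentiableAt_pFun
      (Problem.ball_subset_ballUnion hb R' (Metric.ball_subset_ball hc.R_lt.le hmem)) _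
    have h1 : IsLocalMax (fun y => s * P.pFun (toRadon u) y) (xhat b) := by
      refine ((h.isLocalMax b hb _ hmem).2 rfl).congr ?_
      filter_upwards [Metric.isOpen_ball.mem_nhds hmem] with y hy
      exact (Problem.sign_mul_of_sign_eq (h.sign b hb y hy)).symm
    have h2 := h1.fderiv_eq_zero
    rw [fderiv_const_mul hd] at h2
    have h3 : fderiv ℝ (P.pFun (toRadon u)) (xhat b) = 0 :=
      (smul_eq_zero.1 h2).resolve_left fun h0 => by rw [h0, abs_zero] at hs; norm_num at hs
    have h4 : HasGradientAt (P.pFun (toRadon u)) 0 (xhat b) := by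
      rw [hasGradientAt_iff_hasFDerivAt, map_zero, ← h3]; exact hd.hasFDerivAt
    exact hasGradientWithinAt_iff_hasFDerivWithinAt.2 h4.hasFDerivAt.hasFDerivWithinAt
  · rw [norm_zero, mul_zero]
    refine sub_nonneg.2 (localMax_le hx (by rw [dist_self]; linarith [hc.R_pos]) fun y hy hyd => ?_)
    obtain ⟨b', hb', hyb'⟩ := Problem.mem_ballUnion.1 (hsupp y hy)
    rw [Subtype.dist_eq, dist_lt_two_mul_iff hP hc hb' hb hyb' hxb] at hyd
    subst hyd
    exact abs_le_of_growth hP hθ h hb' hyb'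

/-- Every admissible improvement lies in the ball of the atom and nearly attains the local maximum
of `|p_u|`: it closes at least half of the distance to it. -/
lemma LocalDual.of_isLSIPoint {u : SparseMeasure P.Ω}
    {xhat : EuclideanSpace ℝ (Fin d) → EuclideanSpace ℝ (Fin d)}
    (h : LocalDual P c ubar Abar (toRadon u) xhat)
    {x y : P.Ω} {b : EuclideanSpace ℝ (Fin d)} (hb : b ∈ Abar) (hxb : dist x.1 b < c.R)
    (hy : IsLSIPoint P c u x y) :
    dist y.1 b < c.R ∧
      |P.pFun (toRadon u) (xhat b)| - |P.pFun (toRadon u) y| ≤ 2 * c.R * localDualGap P c u ∧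
      |P.pFun (toRadon u) (xhat b)| - |P.pFun (toRadon u) y| ≤
        |P.pFun (toRadon u) y| - localMax P c u x ∧
      0 ≤ |P.pFun (toRadon u) y| - localMax P c u x := by
  obtain ⟨hd, hlt, g, hg, hgn, himp⟩ := hy
  obtain ⟨b', hb', hyb'⟩ := Problem.mem_ballUnion.1 (h.mem_ballUnion y hlt)
  rw [Subtype.dist_eq, dist_lt_two_mul_iff hP hc hb' hb hyb' hxb] at hd
  subst hd
  have hint := mem_Ω_of_mem_ball hP hc hb' hyb'
  have hgrad : gradient (P.pFun (toRadon u)) y = g := by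
    apply HasGradientAt.gradient
    rw [hasGradientAt_iff_hasFDerivAt]
    exact (hasGradientWithinAt_iff_hasFDerivWithinAt.1 hg).hasFDerivAt
      (mem_interior_iff_mem_nhds.1 hint)
  have h1 := h.le_gradient b' hb' y hyb'
  rw [hgrad] at h1
  have hR := hc.R_pos
  have h2 : 2 * c.R * ‖g‖ ≤ 2 * c.R * localDualGap P c u := by gcongr
  have h3 : 0 ≤ 2 * c.R * ‖g‖ := by positivity
  exact ⟨hyb', h1.trans h2, h1.trans himp, h3.trans himp⟩

omit hc hP

/-- On clustered measures the unsigned gap over the support is controlled by the signed gap of the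
coefficient step, as the weights already carry the signs of the dual variable. -/
lemma localDualGap_bounds (hM : 0 < c.M) {um u w : SparseMeasure P.Ω} {Ψ : ℝ}
    (huM : ‖toRadon u‖ ≤ c.M)
    {xhat : EuclideanSpace ℝ (Fin d) → EuclideanSpace ℝ (Fin d)}
    (hcl : Clustered P c ubar Abar um) (hcs : CoefficientStep P c um Ψ u w)
    (h : LocalDual P c ubar Abar (toRadon u) xhat) :
    0 ≤ localDualGap P c u ∧ localDualGap P c u ≤ signedDualGap P c um w := by
  obtain ⟨hw, -, -, rfl⟩ := hcs
  set u := signedMeasure um w with hu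
  have key : ∀ v : SparseMeasure P.Ω, v.support ⊆ u.support → ‖toRadon v‖ ≤ c.M →
      P.gap (toRadon u) (toRadon v) ≤ signedDualGap P c um w := by
    intro v hv hvM
    have hv' := hv.trans (support_signedMeasure_subset um w)
    have hpos := mapRange_abs_mem_positiveOn hv'
    refine le_trans ?_ (gap_le_signedDualGap hw hpos (by rwa [norm_mapRange_abs]))
    rw [Problem.gap, Problem.gap, norm_signedMeasure hpos, norm_mapRange_abs,
      _root_.sub_apply, _root_.sub_apply]
    have h1 : toRadon v (P.p (toRadon u)) ≤
        toRadon (signedMeasure um (v.mapRange (fun a => |a|) abs_zero)) (P.p (toRadon u)) := by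
      rw [toRadon_apply_of_subset hv',
        toRadon_apply_of_subset (support_signedMeasure_subset um _)]
      refine Finset.sum_le_sum fun x hx => ?_
      obtain ⟨b, hb, hxb, hs⟩ := hcl x hx
      have h2 := h.sign b hb x hxb
      rw [← hs] at h2
      rw [signedMeasure_apply, Finsupp.mapRange_apply, P.p_apply, mul_right_comm,
        Problem.sign_mul_of_sign_eq h2, mul_comm |P.pFun _ _|, ← abs_mul]
      exact le_abs_self _
    linarith
  have hbdd : BddAbove ((fun v : SparseMeasure P.Ω => P.gap (toRadon u) (toRadon v)) ''
      {v | v.support ⊆ u.support ∧ ‖toRadon v‖ ≤ c.M}) :=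
    ⟨_, by rintro _ ⟨v, ⟨hv, hvM⟩, rfl⟩; exact key v hv hvM⟩
  have h0M : ‖toRadon (0 : SparseMeasure P.Ω)‖ ≤ c.M := by
    rw [toRadon_zero, ContinuousLinearMap.opNorm_zero]; exact hM.le
  refine ⟨le_csSup hbdd ⟨u, ⟨subset_rfl, huM⟩, ?_⟩, ?_⟩
  · simp [Problem.gap]
  · refine csSup_le ⟨_, 0, ⟨by simp, h0M⟩, rfl⟩ ?_
    rintro _ ⟨v, ⟨hv, hvM⟩, rfl⟩
    exact key v hv hvM

end

/-! ### Decrease of the objective in the local step -/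

/-- A weighted sum of distances: points with quadratic growth are handled by Cauchy–Schwarz, the
remaining ones by their small total weight. -/
lemma sum_mul_dist_le {ι : Type*} (S : Finset ι) (near : ι → Prop) {a r G : ι → ℝ}
    {M θ Φ D m : ℝ} (hθ : 0 < θ) (ha : ∀ i ∈ S, 0 ≤ a i)
    (hM : ∑ i ∈ S, a i ≤ M) (hG : ∀ i ∈ S, 0 ≤ G i) (hΦ : ∑ i ∈ S, a i * G i ≤ Φ)
    (hnear : ∀ i ∈ S, near i → θ / 4 * r i ^ 2 ≤ G i) (hD0 : 0 ≤ D)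
    (hfar : ∀ i ∈ S, ¬ near i → r i ≤ D)
    (hm : ∀ T ⊆ S, (∀ i ∈ T, ¬ near i) → ∑ i ∈ T, a i ≤ m) :
    ∑ i ∈ S, a i * r i ≤ 2 * √(M / θ) * √Φ + D * m := by
  classical
  have hM0 : 0 ≤ M := (Finset.sum_nonneg ha).trans hM
  have hΦ0 : 0 ≤ Φ := (Finset.sum_nonneg fun i hi => mul_nonneg (ha i hi) (hG i hi)).trans hΦ
  rw [← Finset.sum_filter_add_sum_filter_not S near]
  refine add_le_add ?_ ?_
  · have hsub : S.filter near ⊆ S := Finset.filter_subset _ _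
    have h1 := sum_mul_sq_le_of_nonneg (S.filter near) (a := a) (b := r)
      fun i hi => ha i (hsub hi)
    have h2 : ∑ i ∈ S.filter near, a i ≤ M :=
      (Finset.sum_le_sum_of_subset_of_nonneg hsub fun i hi _ => ha i hi).trans hM
    have h3 : θ / 4 * ∑ i ∈ S.filter near, a i * r i ^ 2 ≤ Φ := by
      refine le_trans ?_ ((Finset.sum_le_sum_of_subset_of_nonneg hsub fun i hi _ =>
        mul_nonneg (ha i hi) (hG i hi)).trans hΦ)
      rw [Finset.mul_sum]
      refine Finset.sum_le_sum fun i hi => ?_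
      have := mul_le_mul_of_nonneg_left
        (hnear i (hsub hi) (Finset.mem_filter.1 hi).2) (ha i (hsub hi))
      linarith
    set Q := ∑ i ∈ S.filter near, a i * r i ^ 2
    have hQ0 : 0 ≤ Q := Finset.sum_nonneg fun i hi => mul_nonneg (ha i (hsub hi)) (sq_nonneg _)
    have h4 : Q ≤ 4 * Φ / θ := by rw [le_div_iff₀ hθ]; linarith
    refine le_of_sq_le_sq (h1.trans ?_) (by positivity)
    calc _ ≤ M * (4 * Φ / θ) := mul_le_mul h2 h4 hQ0 hM0
      _ = (2 * √(M / θ) * √Φ) ^ 2 := by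
        rw [mul_pow, mul_pow, Real.sq_sqrt (by positivity), Real.sq_sqrt hΦ0]
        ring
  · have hsub : S.filter (fun i => ¬ near i) ⊆ S := Finset.filter_subset _ _
    calc _ ≤ ∑ i ∈ S.filter (fun i => ¬ near i), D * a i := by
          refine Finset.sum_le_sum fun i hi => ?_
          rw [mul_comm D]
          exact mul_le_mul_of_nonneg_left (hfar i (hsub hi) (Finset.mem_filter.1 hi).2)
            (ha i (hsub hi))
      _ = D * ∑ i ∈ S.filter (fun i => ¬ near i), a i := by rw [Finset.mul_sum]
      _ ≤ D * m := mul_le_mul_of_nonneg_left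
          (hm _ hsub fun i hi => (Finset.mem_filter.1 hi).2) hD0

/-- The length scale in the step size of the local step. -/
noncomputable def stepScale (c : Params) : ℝ :=
  2 * c.M * √(c.R / c.θ) + 2 * c.M * c.CK' * c.L / (c.θ * √c.γ) + √(c.M / c.θ)

lemma stepScale_pos (hM : 0 < c.M) (hR : 0 < c.R) (hθ : 0 < c.θ) (hL : 0 < c.L)
    (hCK' : 0 < c.CK') (hγ : 0 < c.γ) : 0 < stepScale c := by
  have : 0 < √(c.R / c.θ) := Real.sqrt_pos.2 (by positivity)
  have : 0 < √c.γ := Real.sqrt_pos.2 hγ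
  unfold stepScale
  positivity

/-- With the prescribed step size the linear decrease dominates the quadratic error. -/
lemma step_le {η m D M L C Φ lin k : ℝ} (hM : 0 < M) (hL : 0 < L) (hC : 0 < C) (hD : 0 < D)
    (hη0 : 0 ≤ η) (hη : η ≤ m / (16 * M * L * C ^ 2 * D ^ 2)) (hΦ : 0 ≤ Φ)
    (hlin : m * (Φ / (4 * M)) ≤ lin) (hk0 : 0 ≤ k) (hk : k ≤ C * (2 * D) * √Φ) :
    -η * lin + η ^ 2 * (L / 2 * k ^ 2) ≤ -(η * m * Φ / (8 * M)) := by
  have h1 : k ^ 2 ≤ C ^ 2 * (4 * D ^ 2) * Φ := by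
    calc k ^ 2 ≤ (C * (2 * D) * √Φ) ^ 2 := by gcongr
      _ = C ^ 2 * (4 * D ^ 2) * Φ := by rw [mul_pow, Real.sq_sqrt hΦ]; ring
  rw [le_div_iff₀ (by positivity)] at hη
  have h2 : η * (L / 2 * k ^ 2) ≤ m * Φ / (8 * M) := by
    rw [le_div_iff₀ (by positivity)]
    calc η * (L / 2 * k ^ 2) * (8 * M) ≤ η * (L / 2 * (C ^ 2 * (4 * D ^ 2) * Φ)) * (8 * M) := by
          gcongr
      _ = η * (16 * M * L * C ^ 2 * D ^ 2) * Φ := by ring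
      _ ≤ m * Φ := by gcongr
  have h3 := mul_le_mul_of_nonneg_left h2 hη0
  have h4 := mul_le_mul_of_nonneg_left hlin hη0
  have e1 : m * (Φ / (4 * M)) = 2 * (m * Φ / (8 * M)) := by field_simp; ring
  have e2 : η * m * Φ / (8 * M) = η * (m * Φ / (8 * M)) := by ring
  rw [e1] at h4
  rw [e2]
  nlinarith

/-- The local step decreases the objective by a fixed multiple of the maximal gap, once the
residual is small: `m₀` bounds the masses of the clusters from below, `ρ` is a radius on which
dual variables have curvature `θ / 2`, and `σ₁` is the inactivity of the certificate outside. -/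
lemma LSIStep.J_le (hP : P.IsNondegenerate ubar Abar R' σ' γ θ)
    (hc : c.IsAdmissible P ubar Abar R' σ') (hγ : c.γ = γ) (hθ : c.θ = θ) (hM : 0 < c.M)
    {um u w ut : SparseMeasure P.Ω} {Ψ : ℝ}
    {xhat : EuclideanSpace ℝ (Fin d) → EuclideanSpace ℝ (Fin d)}
    (hcl : Clustered P c ubar Abar um) (hcs : CoefficientStep P c um Ψ u w)
    (hld : LocalDual P c ubar Abar (toRadon u) xhat) (huM : ‖toRadon u‖ ≤ c.M)
    (hS : signedDualGap P c um w ≤ maxGap P c (toRadon u) / 2)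
    (hr0 : 0 < P.residual (toRadon u)) (hrΦ : P.residual (toRadon u) ≤ maxGap P c (toRadon u))
    {m₀ : ℝ} (hm₀ : 0 < m₀)
    (hmass : ∀ b ∈ Abar, m₀ ≤ |∑ x ∈ u.support with dist x.1 b < c.R, u x|)
    {ρ σ₁ : ℝ} (hσ₁ : 0 < σ₁)
    (hρ : ρ ≤ c.R) (hnear : ∀ b ∈ Abar, ∀ x ∈ Metric.ball b ρ, c.θ / 4 * ‖x - xhat b‖ ^ 2 ≤
      |P.pFun (toRadon u) (xhat b)| - |P.pFun (toRadon u) x|)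
    (hfar : ∀ x ∈ (P.Ω : Set _) \ Problem.ballUnion Abar ρ, |P.pFun ubar x| ≤ P.α - σ₁)
    (hsmall : 2 * c.R / σ₁ * √(P.residual (toRadon u)) ≤
      4 * c.M * c.CK' * c.L / (c.θ * √c.γ))
    (hlsi : LSIStep P c u ut) :
    P.J (toRadon ut) ≤ P.J (toRadon u) -
      lsiStepSize c m₀ * m₀ / (8 * c.M) * maxGap P c (toRadon u) := by
  classical
  have hθ0 : 0 < c.θ := hθ ▸ hP.θ_pos
  have hγ0 : 0 < c.γ := hγ ▸ hP.γ_pos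
  have hR := hc.R_pos
  have hL := hc.L_pos
  have hC := hc.CK'_pos
  have hσα : c.σ < P.α := hc.σ_le.trans_lt hP.σ'_lt
  set pu := P.pFun (toRadon u) with hpu
  set r := P.residual (toRadon u) with hr
  set Φ := maxGap P c (toRadon u) with hΦ
  have hΦ0 : 0 < Φ := hr0.trans_le hrΦ
  obtain ⟨hw, hJw, hΨ, hu⟩ := hcs
  have hcl_u : Clustered P c ubar Abar u := by rw [hu]; exact hcl.signedMeasure hw
  have hsupp_um : u.support ⊆ um.support := by rw [hu]; exact support_signedMeasure_subset um w
  obtain ⟨hloc0, hlocS⟩ := localDualGap_bounds (P := P) (c := c) hM huM hcl ⟨hw, hJw, hΨ, hu⟩ hld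
  -- The gap of `u` towards `0` and towards single atoms is small compared with `Φ`.
  have hg0 : P.α * ‖toRadon u‖ - toRadon u (P.p (toRadon u)) ≤ Φ / 2 := by
    have hz : (0 : SparseMeasure P.Ω) ∈ positiveOn um := ⟨by simp, by simp⟩
    have h1 := gap_le_signedDualGap (c := c) hw hz (by
      rw [toRadon_zero, ContinuousLinearMap.opNorm_zero]; exact hM.le)
    rw [← hu] at h1
    have e : signedMeasure um (0 : SparseMeasure P.Ω) = 0 := by
      ext x; simp [signedMeasure_apply]
    rw [e, Problem.gap, toRadon_zero, zero_sub, _root_.neg_apply,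
      ContinuousLinearMap.opNorm_zero] at h1
    linarith
  have hα_lt : P.α < ‖P.p (toRadon u)‖ := by
    by_contra! hle
    have : Φ = P.α * ‖toRadon u‖ - toRadon u (P.p (toRadon u)) := by
      rw [hΦ, maxGap, max_eq_left (by linarith)]; ring
    linarith
  have hΦeq : Φ = P.α * ‖toRadon u‖ - toRadon u (P.p (toRadon u)) +
      c.M * (‖P.p (toRadon u)‖ - P.α) := by
    rw [hΦ, maxGap, max_eq_right (by linarith)]
  have hatom : ∀ x ∈ u.support, Φ / (2 * c.M) ≤ ‖P.p (toRadon u)‖ - |pu x| := by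
    intro x hx
    obtain ⟨b, hb, hxb, hs⟩ := hcl x (hsupp_um hx)
    have hz : Finsupp.single x c.M ∈ positiveOn um := by
      refine ⟨Finsupp.support_single_subset.trans (by simpa using hsupp_um hx), fun z => ?_⟩
      rw [Finsupp.single_apply]; split_ifs <;> linarith
    have h1 := gap_le_signedDualGap (c := c) hw hz (by
      rw [norm_toRadon_single, abs_of_pos hM])
    rw [← hu] at h1
    have e : signedMeasure um (Finsupp.single x c.M) =
        Finsupp.single x (Real.sign (um x) * c.M) := by
      ext z
      rw [signedMeasure_apply, Finsupp.single_apply, Finsupp.single_apply]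
      split_ifs with h
      · rw [h]
      · rw [mul_zero]
    have hne : um x ≠ 0 := Finsupp.mem_support_iff.1 (hsupp_um hx)
    have h2 : Real.sign (um x) * pu x = |pu x| :=
      Problem.sign_mul_of_sign_eq ((hld.sign b hb x hxb).trans hs.symm)
    have h3 : (dirac x : RadonMeasure P.Ω) (P.p (toRadon u)) = pu x := rfl
    rw [e, Problem.gap, norm_toRadon_single, abs_mul, abs_sign_of_ne_zero hne, abs_of_pos hM,
      _root_.sub_apply, toRadon_single, _root_.smul_apply, smul_eq_mul, h3, mul_right_comm,
      h2] at h1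
    rw [div_le_iff₀ (by positivity)]
    linarith
  -- The dual variable attains its norm at one of the local maximizers.
  obtain ⟨bs, hbs, hbsn⟩ : ∃ b ∈ Abar, ‖P.p (toRadon u)‖ = |pu (xhat b)| := by
    have hne : Nonempty P.Ω := by
      by_contra hempty
      rw [not_nonempty_iff] at hempty
      have : ‖P.p (toRadon u)‖ ≤ 0 :=
        (ContinuousMap.norm_le _ le_rfl).2 fun x => (hempty.false x).elim
      linarith [P.α_pos]
    obtain ⟨x, -, hx⟩ := isCompact_univ.exists_isMaxOn (univ_nonempty (α := P.Ω))
      (f := fun x => |P.p (toRadon u) x|) (P.p (toRadon u)).continuous.abs.continuousOn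
    have hxn : ‖P.p (toRadon u)‖ ≤ |pu x| :=
      (ContinuousMap.norm_le _ (abs_nonneg _)).2 fun y => hx (mem_univ y)
    obtain ⟨b, hb, hxb⟩ := Problem.mem_ballUnion.1
      (hld.mem_ballUnion x (by linarith [hc.σ_pos] : P.α - c.σ / 2 < |pu x|))
    refine ⟨b, hb, le_antisymm (hxn.trans (abs_le_of_growth hP hθ hld hb hxb)) ?_⟩
    exact (P.p (toRadon u)).norm_coe_le_norm
      ⟨xhat b, interior_subset (mem_Ω_of_mem_ball hP hc hb (hld.mem b hb))⟩
  have hle_norm : ∀ b ∈ Abar, |pu (xhat b)| ≤ ‖P.p (toRadon u)‖ := fun b hb =>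
    (P.p (toRadon u)).norm_coe_le_norm
      ⟨xhat b, interior_subset (mem_Ω_of_mem_ball hP hc hb (hld.mem b hb))⟩
  -- Every cluster is charged.
  have hcharged : ∀ b ∈ Abar, ∃ x ∈ u.support, dist x.1 b < c.R := by
    intro b hb
    by_contra! hnone
    have := hmass b hb
    rw [Finset.filter_false_of_mem fun x hx => not_lt.2 (hnone x hx)] at this
    simp only [Finset.sum_empty, abs_zero] at this
    linarith
  choose! ctr hctrA hctrd hctrs using hcl_u
  have hsuppX : ∀ x ∈ u.support, x.1 ∈ Problem.ballUnion Abar c.R := fun x hx =>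
    Problem.mem_ballUnion.2 ⟨ctr x, hctrA x hx, hctrd x hx⟩
  obtain ⟨B, hloop, hB⟩ := hlsi
  obtain ⟨hB1, hB2⟩ := LSILoop.spec (dist_trans_ballUnion hP hc)
    (fun x y hy => hld.mem_ballUnion y hy.2.1) hloop hsuppX fun x hx =>
      ⟨_, hld.isLSIPoint hP hc hθ hsuppX hloc0 hx (hctrA x hx) (hctrd x hx)⟩
  choose! τ hτB hτd hτu using hB2
  -- Facts about the collected points.
  have hBfacts : ∀ y ∈ B, ∃ b ∈ Abar, dist y.1 b < c.R ∧
      |pu (xhat b)| - |pu y| ≤ 2 * c.R * localDualGap P c u ∧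
      |pu (xhat b)| - |pu y| ≤ |pu y| - localMax P c u y ∧ 0 ≤ |pu y| - localMax P c u y := by
    intro y hy
    obtain ⟨x, hx, hxy⟩ := hB1 y hy
    obtain ⟨h1, h2, h3, h4⟩ := hld.of_isLSIPoint hP hc (hctrA x hx) (hctrd x hx) hxy
    have e : localMax P c u y = localMax P c u x := by
      unfold localMax
      congr 2
      ext z
      refine and_congr_right fun hz => ?_
      rw [Subtype.dist_eq, Subtype.dist_eq,
        dist_lt_two_mul_iff hP hc (hctrA z hz) (hctrA x hx) (hctrd z hz) h1,
        dist_lt_two_mul_iff hP hc (hctrA z hz) (hctrA x hx) (hctrd z hz) (hctrd x hx)]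
    rw [e]
    exact ⟨ctr x, hctrA x hx, h1, h2, h3, h4⟩
  have hτctr : ∀ x ∈ u.support, dist (τ x).1 (ctr x) < c.R ∧
      |pu (xhat (ctr x))| - |pu (τ x)| ≤ 2 * c.R * localDualGap P c u ∧
      |pu (xhat (ctr x))| - |pu (τ x)| ≤ |pu (τ x)| - localMax P c u (τ x) ∧
      0 ≤ |pu (τ x)| - localMax P c u (τ x) := by
    intro x hx
    obtain ⟨b, hb, hbd, h⟩ := hBfacts (τ x) (hτB x hx)
    have := hτd x hx
    rw [Subtype.dist_eq, dist_lt_two_mul_iff hP hc (hctrA x hx) hb (hctrd x hx) hbd] at this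
    subst this
    exact ⟨hbd, h⟩
  obtain ⟨xs, hxs, hxsd⟩ := hcharged bs hbs
  have hctr_eq : ∀ x ∈ u.support, ∀ b ∈ Abar, dist x.1 b < c.R → ctr x = b :=
    fun x hx b hb h => hP.eq_of_mem_ball (hctrA x hx) hb ((hctrd x hx).trans hc.R_lt)
      (h.trans hc.R_lt)
  rcases hB with ⟨rfl, -⟩ | ⟨xh, hxh, hmaxgap, hut⟩
  · exact absurd (hτB xs hxs) (Finset.notMem_empty _)
  -- The selected point has improvement at least `Φ / (4 M)`.
  have hgap : Φ / (4 * c.M) ≤ |pu xh| - localMax P c u xh := by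
    have h1 := hmaxgap (τ xs) (hτB xs hxs)
    obtain ⟨-, -, h2, -⟩ := hτctr xs hxs
    rw [hctr_eq xs hxs bs hbs hxsd, ← hbsn] at h2
    have h3 : localMax P c u (τ xs) ≤ ‖P.p (toRadon u)‖ - Φ / (2 * c.M) :=
      localMax_le hxs (hτd xs hxs) fun y hy _ => by linarith [hatom y hy]
    have h4 : Φ / (2 * c.M) = 2 * (Φ / (4 * c.M)) := by field_simp; ring
    change |pu (τ xs)| - _ ≤ |pu xh| - _ at h1
    linarith
  have hm0le : m₀ ≤ |ballMass u xh (2 * c.R)| := by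
    obtain ⟨b, hb, hbd, -⟩ := hBfacts xh hxh
    have e : ballMass u xh (2 * c.R) = ∑ x ∈ u.support with dist x.1 b < c.R, u x := by
      unfold ballMass
      refine Finset.sum_congr (Finset.filter_congr fun x hx => ?_) fun _ _ => rfl
      rw [Subtype.dist_eq, dist_lt_two_mul_iff hP hc (hctrA x hx) hb (hctrd x hx) hbd]
      exact ⟨fun h => h ▸ hctrd x hx, hctr_eq x hx b hb⟩
    rw [e]
    exact hmass b hb
  set m := |ballMass u xh (2 * c.R)| with hm
  set η := lsiStepSize c m with hη
  have hlump := lump_eq_sum (c := c) rfl fun x hx => ⟨hτB x hx, hτd x hx, hτu x hx⟩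
  have hlumpR : toRadon (lump P c u B) =
      ∑ x ∈ u.support, u x • (dirac (τ x) : RadonMeasure P.Ω) := by
    rw [hlump, toRadon_sum]
    exact Finset.sum_congr rfl fun x _ => toRadon_single _ _
  have hlumpn : ‖toRadon (lump P c u B)‖ ≤ ‖toRadon u‖ := by
    rw [hlumpR, norm_toRadon]
    refine ContinuousLinearMap.opNorm_le_bound _ (Finset.sum_nonneg fun _ _ => abs_nonneg _)
      fun f => ?_
    rw [_root_.sum_apply, Finset.sum_mul]
    refine (Finset.abs_sum_le_sum_abs _ _).trans (Finset.sum_le_sum fun x _ => ?_)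
    rw [_root_.smul_apply, smul_eq_mul, abs_mul]
    exact mul_le_mul_of_nonneg_left (f.norm_coe_le_norm (τ x)) (abs_nonneg _)
  have hlumpp : toRadon (lump P c u B) (P.p (toRadon u)) = ∑ x ∈ u.support, u x * pu (τ x) := by
    rw [hlumpR, _root_.sum_apply]
    rfl
  have hlumpK : P.K (toRadon (lump P c u B)) = ∑ x ∈ u.support, u x • P.κ (τ x) :=
    ext_inner_right ℝ fun y => by
      rw [P.inner_K, hlumpR, _root_.sum_apply, sum_inner]
      refine Finset.sum_congr rfl fun x _ => ?_
      rw [real_inner_smul_left]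
      rfl
  have hsignp : ∀ x ∈ u.support, ∀ z, dist z (ctr x) < c.R → u x * pu z = |u x| * |pu z| := by
    intro x hx z hz
    have h1 := hld.sign _ (hctrA x hx) z hz
    rw [← hctrs x hx] at h1
    rw [← sign_mul_self_eq_abs (u x), ← Problem.sign_mul_of_sign_eq h1]
    have h2 : Real.sign (u x) * Real.sign (u x) = 1 := by
      rw [← abs_mul_abs_self, abs_sign_of_ne_zero (Finsupp.mem_support_iff.1 hx), one_mul]
    linear_combination -(u x * P.pFun (toRadon u) z) * h2
  have hterm : ∀ x ∈ u.support, |pu x| ≤ localMax P c u (τ x) := fun x hx =>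
    abs_le_localMax hx (hτd x hx)
  -- The linear part of the decrease.
  have hlin : m * (Φ / (4 * c.M)) ≤ P.gap (toRadon u) (toRadon (lump P c u B)) := by
    have h1 : ∑ x ∈ u.support, |u x| * (|pu (τ x)| - |pu x|) =
        (toRadon (lump P c u B) - toRadon u) (P.p (toRadon u)) := by
      rw [_root_.sub_apply, hlumpp, toRadon_apply, ← Finset.sum_sub_distrib]
      refine Finset.sum_congr rfl fun x hx => ?_
      have h2 := hsignp x hx x (hctrd x hx)
      have h3 := hsignp x hx (τ x) (hτctr x hx).1
      rw [P.p_apply, ← hpu, h2, h3]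
      ring
    have h2 : m ≤ ∑ x ∈ u.support with dist x xh < 2 * c.R, |u x| :=
      Finset.abs_sum_le_sum_abs _ _
    have h3 : 0 ≤ Φ / (4 * c.M) := by positivity
    have h4 : m * (Φ / (4 * c.M)) ≤ ∑ x ∈ u.support, |u x| * (|pu (τ x)| - |pu x|) := by
      calc _ ≤ (∑ x ∈ u.support with dist x xh < 2 * c.R, |u x|) * (Φ / (4 * c.M)) := by gcongr
        _ = ∑ x ∈ u.support with dist x xh < 2 * c.R, |u x| * (Φ / (4 * c.M)) :=
          Finset.sum_mul _ _ _
        _ ≤ ∑ x ∈ u.support with dist x xh < 2 * c.R, |u x| * (|pu (τ x)| - |pu x|) := by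
          refine Finset.sum_le_sum fun x hx => mul_le_mul_of_nonneg_left ?_ (abs_nonneg _)
          obtain ⟨hxu, hxd⟩ := Finset.mem_filter.1 hx
          rw [← hτu x hxu xh hxh hxd]
          have := abs_le_localMax hxu hxd
          linarith
        _ ≤ _ := by
          refine Finset.sum_le_sum_of_subset_of_nonneg (Finset.filter_subset _ _) fun x hx _ =>
            mul_nonneg (abs_nonneg _) ?_
          linarith [hterm x hx, (hτctr x hx).2.2.2]
    have h5 := mul_le_mul_of_nonneg_left hlumpn P.α_pos.le
    rw [Problem.gap, ← h1]
    linarith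
  -- The transport distance, and with it the quadratic error.
  have hK : ‖P.K (toRadon (lump P c u B)) - P.K (toRadon u)‖ ≤ c.CK' * (2 * stepScale c) * √Φ := by
    have hsum : ∑ x ∈ u.support, |u x| ≤ c.M := by rw [← norm_toRadon]; exact huM
    have h1 : ‖P.K (toRadon (lump P c u B)) - P.K (toRadon u)‖ ≤
        c.CK' * (∑ x ∈ u.support, |u x| * ‖(τ x).1 - xhat (ctr x)‖ +
          ∑ x ∈ u.support, |u x| * ‖x.1 - xhat (ctr x)‖) := by
      rw [hlumpK, P.K_toRadon, ← Finset.sum_sub_distrib, ← Finset.sum_add_distrib, Finset.mul_sum]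
      refine (norm_sum_le _ _).trans (Finset.sum_le_sum fun x hx => ?_)
      rw [← smul_sub, norm_smul, Real.norm_eq_abs, ← mul_add, mul_left_comm]
      refine mul_le_mul_of_nonneg_left ?_ (abs_nonneg _)
      refine (hP.norm_κ_sub_le (fun z hz => (hc.norm_κ_le' z hz).2) (hctrA x hx)
        ((hτctr x hx).1.trans hc.R_lt) ((hctrd x hx).trans hc.R_lt)).trans ?_
      refine mul_le_mul_of_nonneg_left ?_ hC.le
      rw [norm_sub_rev x.1]
      exact norm_sub_le_norm_sub_add_norm_sub _ _ _
    have h2 : ∑ x ∈ u.support, |u x| * ‖(τ x).1 - xhat (ctr x)‖ ≤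
        4 * c.M * √(c.R / c.θ) * √Φ := by
      have hpt : ∀ x ∈ u.support, ‖(τ x).1 - xhat (ctr x)‖ ≤ 4 * √(c.R / c.θ) * √Φ := by
        intro x hx
        obtain ⟨h3, h4, -⟩ := hτctr x hx
        have h5 := hld.growth _ (hctrA x hx) (τ x) h3
        have h6 : 2 * c.R * localDualGap P c u ≤ 2 * c.R * (Φ / 2) := by
          gcongr; linarith
        have h7 : ‖(τ x).1 - xhat (ctr x)‖ ^ 2 ≤ 8 * (c.R / c.θ) * Φ := by
          rw [norm_sub_rev]
          have h8 : c.θ / 8 * ‖xhat (ctr x) - (τ x).1‖ ^ 2 ≤ c.R * Φ := by linarith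
          have h9 : 8 * (c.R / c.θ) * Φ = 8 * (c.R * Φ) / c.θ := by ring
          rw [h9, le_div_iff₀ hθ0]
          linarith
        refine le_of_sq_le_sq (h7.trans ?_) (by positivity)
        rw [mul_pow, mul_pow, Real.sq_sqrt (by positivity), Real.sq_sqrt hΦ0.le]
        have : 0 ≤ c.R / c.θ * Φ := by positivity
        linarith
      calc _ ≤ ∑ x ∈ u.support, |u x| * (4 * √(c.R / c.θ) * √Φ) :=
            Finset.sum_le_sum fun x hx => mul_le_mul_of_nonneg_left (hpt x hx) (abs_nonneg _)
        _ = (∑ x ∈ u.support, |u x|) * (4 * √(c.R / c.θ) * √Φ) := (Finset.sum_mul _ _ _).symm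
        _ ≤ c.M * (4 * √(c.R / c.θ) * √Φ) := by gcongr
        _ = _ := by ring
    have h3 : ∑ x ∈ u.support, |u x| * ‖x.1 - xhat (ctr x)‖ ≤
        2 * √(c.M / c.θ) * √Φ + 2 * c.R * (r / σ₁) := by
      refine sum_mul_dist_le u.support (fun x => x.1 ∈ Metric.ball (ctr x) ρ)
        (G := fun x => |pu (xhat (ctr x))| - |pu x|) hθ0
        (fun _ _ => abs_nonneg _) hsum (fun x hx => ?_) ?_
        (fun x hx hxρ => hnear _ (hctrA x hx) x hxρ) (by positivity)
        (fun x hx _ => ?_) (fun T hT hfarT => ?_)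
      · exact sub_nonneg.2 (abs_le_of_growth hP hθ hld (hctrA x hx) (hctrd x hx))
      · calc _ ≤ ∑ x ∈ u.support, (|u x| * (‖P.p (toRadon u)‖ - P.α) +
              (P.α * |u x| - u x * pu x)) := by
              refine Finset.sum_le_sum fun x hx => ?_
              rw [hsignp x hx x (hctrd x hx)]
              have := mul_le_mul_of_nonneg_left (hle_norm _ (hctrA x hx)) (abs_nonneg (u x))
              linarith
          _ = (∑ x ∈ u.support, |u x|) * (‖P.p (toRadon u)‖ - P.α) +
              (P.α * ‖toRadon u‖ - toRadon u (P.p (toRadon u))) := by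
              rw [Finset.sum_add_distrib, Finset.sum_sub_distrib, norm_toRadon, toRadon_apply,
                Finset.sum_mul, Finset.mul_sum]
              rfl
          _ ≤ c.M * (‖P.p (toRadon u)‖ - P.α) +
              (P.α * ‖toRadon u‖ - toRadon u (P.p (toRadon u))) := by
              gcongr
          _ = Φ := by rw [hΦeq]; ring
      · have h4 := dist_triangle_right x.1 (xhat (ctr x)) (ctr x)
        have h5 := hld.mem _ (hctrA x hx)
        have h6 := hctrd x hx
        rw [Metric.mem_ball] at h5
        rw [← dist_eq_norm]
        linarith
      · rw [le_div_iff₀ hσ₁]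
        refine le_trans ?_ (hP.sum_defect_le u)
        rw [Finset.sum_mul]
        have hin : ∀ x : P.Ω, 0 ≤ P.α - |P.pFun ubar x| := fun x =>
          sub_nonneg.2 (Problem.abs_pFun_minimizer_le hP.minimizer x)
        refine le_trans (Finset.sum_le_sum fun x hx => mul_le_mul_of_nonneg_left ?_ (abs_nonneg _))
          (Finset.sum_le_sum_of_subset_of_nonneg hT fun x _ _ =>
            mul_nonneg (abs_nonneg _) (hin x))
        by_cases hxU : x.1 ∈ Problem.ballUnion Abar ρ
        · obtain ⟨b, hb, hxb⟩ := Problem.mem_ballUnion.1 hxU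
          exact absurd (hctr_eq x (hT hx) b hb (hxb.trans_le hρ) ▸ hxb) (hfarT x hx)
        · linarith [hfar x ⟨x.2, hxU⟩]
    have h4 : 2 * c.R * (r / σ₁) ≤ 4 * c.M * c.CK' * c.L / (c.θ * √c.γ) * √Φ := by
      calc 2 * c.R * (r / σ₁) = 2 * c.R / σ₁ * √r * √r := by
            rw [mul_assoc (2 * c.R / σ₁), Real.mul_self_sqrt hr0.le]; ring
        _ ≤ _ := by gcongr
    have h5 : c.CK' * (2 * stepScale c) * √Φ = c.CK' * (4 * c.M * √(c.R / c.θ) * √Φ +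
        (2 * √(c.M / c.θ) * √Φ + 4 * c.M * c.CK' * c.L / (c.θ * √c.γ) * √Φ)) := by
      unfold stepScale; ring
    rw [h5]
    refine h1.trans (mul_le_mul_of_nonneg_left ?_ hC.le)
    linarith
  have hD := stepScale_pos hM hR hθ0 hL hC hγ0
  have hm_pos : 0 < m := hm₀.trans_le hm0le
  have hden : 0 < 16 * c.M * c.L * c.CK' ^ 2 * stepScale c ^ 2 := by positivity
  have hη0 : 0 ≤ η := le_min zero_le_one (div_nonneg hm_pos.le hden.le)
  have hηle : η ≤ m / (16 * c.M * c.L * c.CK' ^ 2 * stepScale c ^ 2) := min_le_right _ _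
  have h1 := P.J_convexComb_le hc.lipschitz (toRadon u) (toRadon (lump P c u B)) hη0
    (min_le_left _ _)
  rw [← toRadon_smul, ← toRadon_smul, ← toRadon_add, ← hut] at h1
  have h2 := step_le hM hL hC hD hη0 hηle hΦ0.le hlin (norm_nonneg _) hK
  have h3 : lsiStepSize c m₀ ≤ η := by
    refine min_le_min le_rfl ?_
    change m₀ / (16 * c.M * c.L * c.CK' ^ 2 * stepScale c ^ 2) ≤
      m / (16 * c.M * c.L * c.CK' ^ 2 * stepScale c ^ 2)
    gcongr
  have h4 : lsiStepSize c m₀ * m₀ / (8 * c.M) * Φ ≤ η * m * Φ / (8 * c.M) := by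
    rw [div_mul_eq_mul_div]
    gcongr
  linarith

/-! ### From one-step estimates to a linear rate -/

/-- One-step estimates imply geometric decay in both counters. Here `a` and `b` are the residuals
before and after the coefficient step, `G` marks the passes in which the local contraction is
available once `b ≤ Δ`, and every step either recomputes or advances. An advancing step with
`b > Δ` contracts since its decrease is bounded below; one with `b ≤ Δ` contracts unless `G` fails
or `a > Δ`, which happens at most once and costs a factor `q⁻¹`. -/
lemma exists_geometric_of_steps {len : ℕ∞} {a b Ψ : ℕ → ℝ} {k s : ℕ → ℕ} {G : ℕ → Prop}
    {r₀ Δ q₀ D : ℝ} (hr₀ : 0 < r₀) (hΔ : 0 < Δ) (hq₀ : q₀ < 1) (hD : 0 < D)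
    (ha0 : a 0 ≤ r₀) (hk0 : k 0 = 1) (hs0 : s 0 = 0)
    (hb0 : ∀ n : ℕ, n < len → 0 ≤ b n) (hba : ∀ n : ℕ, n < len → b n ≤ a n)
    (hstep : ∀ n : ℕ, (n + 1 : ℕ) < len →
      (k (n + 1) = k n ∧ s (n + 1) = s n + 1 ∧ Ψ (n + 1) = Ψ n / 2 ∧ a (n + 1) = a n ∧
        (G (n + 1) ↔ G n) ∧ b n ≤ 4 * Ψ n ∧ b (n + 1) ≤ Ψ (n + 1) + b n) ∨
      (k (n + 1) = k n + 1 ∧ s (n + 1) = s n ∧ Ψ (n + 1) = Ψ n ∧ a (n + 1) ≤ b n ∧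
        a (n + 1) ≤ b n - min (b n / 4) (b n ^ 2 / D) ∧ (b n ≤ Δ → G (n + 1)) ∧
        (G n → b n ≤ Δ → a (n + 1) ≤ q₀ * b n))) :
    ∃ C q : ℝ, 0 < C ∧ 1 / 2 ≤ q ∧ q < 1 ∧
      ∀ n : ℕ, n < len → b n ≤ C * q ^ k n ∧ b n ≤ C * (1 / 2) ^ s n := by
  set f₀ := min (Δ / 4) (Δ ^ 2 / D) with hf₀
  have hf₀pos : 0 < f₀ := lt_min (by positivity) (by positivity)
  set q := max (1 / 2) (max q₀ (1 - f₀ / r₀)) with hq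
  have hq1 : q < 1 := max_lt (by norm_num) (max_lt hq₀ (sub_lt_self _ (by positivity)))
  have hqhalf : 1 / 2 ≤ q := le_max_left _ _
  have hq0 : 0 < q := lt_of_lt_of_le (by norm_num) hqhalf
  have hqq₀ : q₀ ≤ q := (le_max_left _ _).trans (le_max_right _ _)
  have hqf : 1 - f₀ / r₀ ≤ q := (le_max_right _ _).trans (le_max_right _ _)
  have hlt : ∀ n : ℕ, (n + 1 : ℕ) < len → n < len := fun n hn =>
    lt_of_le_of_lt (by exact_mod_cast Nat.le_succ n) hn
  have hcontract : ∀ n : ℕ, (n + 1 : ℕ) < len → b n ≤ r₀ → Δ < b n →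
      a (n + 1) ≤ b n - min (b n / 4) (b n ^ 2 / D) → a (n + 1) ≤ q * b n := by
    intro n _ hbr hbΔ hle
    have h1 : f₀ ≤ min (b n / 4) (b n ^ 2 / D) := by
      refine min_le_min ?_ ?_ <;> gcongr
    have h2 : f₀ / r₀ * b n ≤ f₀ := by
      rw [div_mul_eq_mul_div, div_le_iff₀ hr₀]; gcongr
    have h3 := mul_le_mul_of_nonneg_right hqf (hΔ.trans hbΔ).le
    linarith
  have hA : ∀ n : ℕ, n < len → a n ≤ r₀ ∧ (¬ (G n ∧ a n ≤ Δ) → a n ≤ r₀ / q * q ^ k n) ∧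
      a n ≤ r₀ / q ^ 2 * q ^ k n := by
    intro n
    induction n with
    | zero =>
      intro _
      have e1 : r₀ / q * q ^ k 0 = r₀ := by rw [hk0]; field_simp
      have e2 : r₀ ≤ r₀ / q ^ 2 * q ^ k 0 := by
        rw [hk0, pow_one, div_mul_eq_mul_div, le_div_iff₀ (by positivity)]
        nlinarith [mul_pos hr₀ hq0]
      exact ⟨ha0, fun _ => by rw [e1]; exact ha0, ha0.trans e2⟩
    | succ n ih =>
      intro hn
      obtain ⟨h1, h2, h3⟩ := ih (hlt n hn)
      have hbn := hb0 n (hlt n hn)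
      have hban := hba n (hlt n hn)
      rcases hstep n hn with ⟨hk, -, -, ha, hG, -⟩ | ⟨hk, -, -, ha, hdec, hGΔ, hloc⟩
      · rw [hk, ha, hG]; exact ⟨h1, h2, h3⟩
      · refine ⟨ha.trans (hban.trans h1), ?_⟩
        rw [hk, pow_succ]
        have hpow : 0 < q ^ k n := pow_pos hq0 _
        rcases le_or_gt (b n) Δ with hbΔ | hbΔ
        · refine ⟨fun hnG => absurd ⟨hGΔ hbΔ, ha.trans hbΔ⟩ hnG, ?_⟩
          by_cases hGn : G n ∧ a n ≤ Δ
          · calc a (n + 1) ≤ q₀ * b n := hloc hGn.1 hbΔ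
              _ ≤ q * b n := by gcongr
              _ ≤ q * (r₀ / q ^ 2 * q ^ k n) := by gcongr; exact hban.trans h3
              _ = _ := by ring
          · calc a (n + 1) ≤ r₀ / q * q ^ k n := ha.trans (hban.trans (h2 hGn))
              _ = _ := by field_simp
        · have h4 := hcontract n hn (hban.trans h1) hbΔ hdec
          have hGn : ¬ (G n ∧ a n ≤ Δ) := fun h => absurd (hban.trans h.2) hbΔ.not_ge
          refine ⟨fun _ => ?_, ?_⟩
          · calc a (n + 1) ≤ q * b n := h4
              _ ≤ q * (r₀ / q * q ^ k n) := by gcongr; exact hban.trans (h2 hGn)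
              _ = _ := by ring
          · calc a (n + 1) ≤ q * b n := h4
              _ ≤ q * (r₀ / q ^ 2 * q ^ k n) := by gcongr; exact hban.trans h3
              _ = _ := by ring
  have hB : ∀ n : ℕ, n < len → Ψ n = Ψ 0 * (1 / 2) ^ s n ∧
      b n ≤ max r₀ (9 * Ψ 0) * (1 / 2) ^ s n := by
    intro n
    induction n with
    | zero =>
      intro hn
      rw [hs0]
      refine ⟨by simp, ?_⟩
      rw [pow_zero, mul_one]
      exact ((hba 0 hn).trans ha0).trans (le_max_left _ _)
    | succ n ih =>
      intro hn
      obtain ⟨h1, h2⟩ := ih (hlt n hn)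
      rcases hstep n hn with ⟨-, hs, hΨn, -, -, h3, h4⟩ | ⟨-, hs, hΨn, ha, -⟩
      · have e : Ψ (n + 1) = Ψ 0 * (1 / 2) ^ s (n + 1) := by rw [hΨn, h1, hs, pow_succ]; ring
        refine ⟨e, ?_⟩
        calc b (n + 1) ≤ 9 * Ψ (n + 1) := by linarith
          _ = 9 * Ψ 0 * (1 / 2) ^ s (n + 1) := by rw [e]; ring
          _ ≤ _ := by gcongr; exact le_max_right _ _
      · rw [hs, hΨn]
        exact ⟨h1, (hba _ hn).trans (ha.trans h2)⟩
  refine ⟨max (r₀ / q ^ 2) (max r₀ (9 * Ψ 0)), q, lt_max_of_lt_left (by positivity), hqhalf, hq1,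
    fun n hn => ⟨?_, ?_⟩⟩
  · refine ((hba n hn).trans (hA n hn).2.2).trans ?_
    gcongr
    exact le_max_left _ _
  · exact (hB n hn).2.trans (mul_le_mul_of_nonneg_right (le_max_right _ _) (by positivity))

/-- Multiplying the two geometric bounds gives `b ^ 2 ≤ C ^ 2 * q ^ (k + s)`, and the constant
`C ^ 2` is absorbed into the iteration count because `tol < ζ`. -/
lemma exists_logb_rate {C q ζ : ℝ} (hC : 0 < C) (hq : 1 / 2 ≤ q) (hq1 : q < 1) (hζ : 0 < ζ)
    (hζ1 : ζ < 1) :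
    ∃ Cc : ℝ, 0 < Cc ∧ ∀ tol : ℝ, 0 < tol → tol < ζ → ∀ (k s : ℕ) (b : ℝ), 0 ≤ b →
      b ≤ C * q ^ k → b ≤ C * (1 / 2) ^ s → Cc * Real.logb ζ tol ≤ (k + s : ℝ) → b ≤ tol := by
  have hq0 : 0 < q := by linarith
  set A := max 1 (C ^ 2) with hA
  have hA1 : 1 ≤ A := le_max_left _ _
  have hA0 : 0 < A := by linarith
  have hlogq : Real.log q < 0 := Real.log_neg hq0 hq1
  have hlogζ : Real.log ζ < 0 := Real.log_neg hζ hζ1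
  have hlogA : 0 ≤ Real.log A := Real.log_nonneg hA1
  refine ⟨(2 * Real.log ζ - Real.log A) / Real.log q, div_pos_of_neg_of_neg (by linarith) hlogq,
    fun tol htol htolζ k s b hb hbk hbs hks => ?_⟩
  rcases hb.eq_or_lt with rfl | hb
  · exact htol.le
  have hlogtol : Real.log tol < Real.log ζ := Real.log_lt_log htol htolζ
  set t := Real.logb ζ tol with ht
  have ht1 : 1 ≤ t := by
    rw [ht, Real.logb, le_div_iff_of_neg hlogζ]; linarith
  have htζ : t * Real.log ζ = Real.log tol := div_mul_cancel₀ _ hlogζ.ne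
  have hsq : b ^ 2 ≤ A * q ^ (k + s) := by
    calc b ^ 2 = b * b := sq b
      _ ≤ (C * q ^ k) * (C * q ^ s) := by
        gcongr
        exact hbs.trans (by gcongr)
      _ = C ^ 2 * q ^ (k + s) := by ring
      _ ≤ A * q ^ (k + s) := by gcongr; exact le_max_right _ _
  have hlog := Real.log_le_log (by positivity) hsq
  rw [Real.log_mul hA0.ne' (by positivity), Real.log_pow, Real.log_pow] at hlog
  have h1 : ((k + s : ℕ) : ℝ) * Real.log q ≤ t * (2 * Real.log ζ - Real.log A) := by
    have := mul_le_mul_of_nonpos_right hks hlogq.le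
    push_cast
    calc ((k : ℝ) + s) * Real.log q ≤ _ := this
      _ = _ := by field_simp [hlogq.ne]
  have h2 : Real.log A ≤ t * Real.log A := le_mul_of_one_le_left hlogA ht1
  push_cast at hlog h1
  exact (Real.log_le_log_iff hb htol).1 (by linarith)

/-! ### Local contraction and convergence of the runs -/

/-- Near the minimizer, a local step taken after a sufficiently accurate coefficient step contracts
the residual. -/
lemma exists_lsi_contraction (hP : P.IsNondegenerate ubar Abar R' σ' γ θ)
    (hc : c.IsAdmissible P ubar Abar R' σ') (hγ : c.γ = γ) (hθ : c.θ = θ) (hM : 0 < c.M)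
    (hubar : ‖ubar‖ ≤ c.M) :
    ∃ Δ > 0, ∃ q < 1, ∀ (um u w ut : SparseMeasure P.Ω) (Ψ : ℝ),
      Clustered P c ubar Abar um → CoefficientStep P c um Ψ u w → P.residual (toRadon u) ≤ Δ →
      ‖toRadon u‖ ≤ c.M → signedDualGap P c um w ≤ maxGap P c (toRadon u) / 2 →
      0 < P.residual (toRadon u) → LSIStep P c u ut →
      P.residual (toRadon ut) ≤ q * P.residual (toRadon u) := by
  have hθ0 : 0 < c.θ := hθ ▸ hP.θ_pos
  have hγ0 : 0 < c.γ := hγ ▸ hP.γ_pos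
  have hR := hc.R_pos
  have hL := hc.L_pos
  have hCK' := hc.CK'_pos
  -- On a smaller radius `ρ` the localization holds with the better constant `2 * θ`.
  obtain ⟨Rt, hRt0, -, hRt⟩ := hP.exists_isLocalization
  set ρ := min c.R Rt / 2 with hρ
  have hρ0 : 0 < ρ := by positivity
  have hρR : ρ ≤ c.R := by linarith [min_le_left c.R Rt, lt_min hR hRt0]
  have hρRt : ρ < Rt := by linarith [min_le_right c.R Rt, lt_min hR hRt0]
  obtain ⟨σρ, -, -, Δ₁, hΔ₁, hlocρ⟩ := hRt ρ hρ0 hρRt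
  obtain ⟨σ₁, hσ₁, -, hfar⟩ := hP.exists_abs_pFun_le hρ0
  obtain ⟨Δ₂, hΔ₂, m₀, hm₀, hmass⟩ := hP.exists_mass_le hR hc.R_lt (hθ ▸ hc.localization)
    hCK' (fun x hx => (hc.norm_κ_le' x hx).2) hM
  obtain ⟨Δ₃, hΔ₃, hld⟩ := exists_localDual hP hc hθ
  -- Below `Δ₄` the mass outside of the `ρ`-balls is negligible.
  set E := 4 * c.M * c.CK' * c.L / (c.θ * √c.γ) with hE
  have hE0 : 0 < E := by positivity
  set Δ₄ := (E * σ₁ / (2 * c.R)) ^ 2 with hΔ₄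
  have hΔ₄0 : 0 < Δ₄ := by positivity
  have hstep0 : 0 < lsiStepSize c m₀ := lt_min one_pos (by positivity)
  refine ⟨min (min Δ₁ Δ₂) (min Δ₃ Δ₄), lt_min (lt_min hΔ₁ hΔ₂) (lt_min hΔ₃ hΔ₄0),
    1 - lsiStepSize c m₀ * m₀ / (8 * c.M), sub_lt_self _ (by positivity),
    fun um u w ut Ψ hcl hcs hr huM hS hr0 hlsi => ?_⟩
  have hr1 := hr.trans ((min_le_left _ _).trans (min_le_left _ _))
  have hr2 := hr.trans ((min_le_left _ _).trans (min_le_right _ _))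
  have hr3 := hr.trans ((min_le_right _ _).trans (min_le_left _ _))
  have hr4 := hr.trans ((min_le_right _ _).trans (min_le_right _ _))
  obtain ⟨xhat, hx⟩ := hld _ hr3
  have hrΦ := residual_le_maxGap (c := c) hP.minimizer hubar (toRadon u)
  have hclu : Clustered P c ubar Abar u := by
    rw [hcs.2.2.2]; exact hcl.signedMeasure hcs.1
  have key := LSIStep.J_le hP hc hγ hθ hM hcl hcs hx huM hS hr0 hrΦ hm₀
    (hmass u hr2 huM fun x hxu => by
      obtain ⟨b, hb, hd, -⟩ := hclu x hxu
      exact Problem.ball_subset_ballUnion hb c.R hd) hσ₁ hρR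
    (fun b hb x hxb => by
      obtain ⟨-, ⟨y, hy, hmax, -, hgrow⟩, -⟩ := (hlocρ _ hr1).1 b hb
      -- Both localizations single out the same local maximizer.
      have e : y = xhat b := (hx.isLocalMax b hb y (Metric.ball_subset_ball hρR hy)).1
        ((hmax y hy).2 rfl)
      have := hgrow x hxb
      rw [e, norm_sub_rev] at this
      rw [hθ]
      linarith) hfar (by
    have h1 : √(P.residual (toRadon u)) ≤ E * σ₁ / (2 * c.R) := by
      rw [Real.sqrt_le_left (by positivity)]; exact hr4
    calc _ ≤ 2 * c.R / σ₁ * (E * σ₁ / (2 * c.R)) := by gcongr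
      _ = E := by field_simp) hlsi
  rw [Problem.residual_eq hP.minimizer] at hrΦ ⊢
  rw [Problem.residual_eq hP.minimizer]
  have h1 : 0 ≤ lsiStepSize c m₀ * m₀ / (8 * c.M) := by positivity
  have h2 := mul_le_mul_of_nonneg_left hrΦ h1
  linarith

/-- Along a run, the residuals decay geometrically both in the number of outer iterations and in the
number of recompute steps. -/
lemma IsLPDAPRun.exists_geometric (hP : P.IsNondegenerate ubar Abar R' σ' γ θ)
    (hc : c.IsAdmissible P ubar Abar R' σ') (hγ : c.γ = γ) (hθ : c.θ = θ) (hM : 0 < c.M)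
    {u₀ : SparseMeasure P.Ω} {ε₁ Ψ₁ : ℝ}
    (hMJ : ∀ v : RadonMeasure P.Ω, P.J v ≤ P.J (toRadon u₀) → ‖v‖ ≤ c.M) (hε₁ : 0 < ε₁)
    (hr₀ : P.residual (toRadon u₀) ≤ 2 * c.M * ε₁) {len : ℕ∞} {k s : ℕ → ℕ}
    {uminus u w utilde uhat v : ℕ → SparseMeasure P.Ω} {ε εnext Ψ : ℕ → ℝ}
    (h : IsLPDAPRun P c u₀ ε₁ Ψ₁ len k s uminus u w utilde uhat v ε εnext Ψ) :
    ∃ C q : ℝ, 0 < C ∧ 1 / 2 ≤ q ∧ q < 1 ∧ ∀ n : ℕ, n < len →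
      P.residual (toRadon (u n)) ≤ C * q ^ k n ∧
      P.residual (toRadon (u n)) ≤ C * (1 / 2) ^ s n := by
  have hmin := hP.minimizer
  have hL := hc.L_pos
  have hCK := hc.CK_pos
  have hubar : ‖ubar‖ ≤ c.M := hMJ ubar (hmin _)
  have hres : ∀ {x y : RadonMeasure P.Ω}, P.J x ≤ P.J y → P.residual x ≤ P.residual y := by
    intro x y hxy
    rw [Problem.residual_eq hmin, Problem.residual_eq hmin]; linarith
  have hlt : ∀ n : ℕ, (n + 1 : ℕ) < len → n < len := fun n hn =>
    lt_of_le_of_lt (by exact_mod_cast Nat.le_succ n) hn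
  have hJu : ∀ n : ℕ, n < len → P.J (toRadon (u n)) ≤ P.J (toRadon (uminus n)) := fun n hn =>
    J_le_of_coefficientStep (h.coefficient n hn)
  have hspec : ∀ n : ℕ, n < len → P.J (toRadon (uminus n)) ≤ P.J (toRadon u₀) → 0 ≤ ε n →
      P.residual (toRadon (uminus n)) ≤ 2 * c.M * ε n → _ := fun n hn hJ hε hr =>
    LGCGStep.spec hmin hubar hM hL hc.lipschitz hCK hc.norm_κ_le
      (hMJ _ ((hJu n hn).trans hJ)) hε ((hres (hJu n hn)).trans hr) (h.lgcg n hn)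
  have hinv : ∀ n : ℕ, n < len → P.J (toRadon (uminus n)) ≤ P.J (toRadon u₀) ∧ 0 ≤ ε n ∧
      P.residual (toRadon (uminus n)) ≤ 2 * c.M * ε n := by
    intro n
    induction n with
    | zero =>
      intro _
      have hJ := J_dropStep_le (c := c) u₀
      rw [h.init_uminus, h.init_ε]
      exact ⟨hJ, hε₁.le, (hres hJ).trans hr₀⟩
    | succ n ih =>
      intro hn
      obtain ⟨h1, h2, h3⟩ := ih (hlt n hn)
      obtain ⟨-, -, h6, h7, h8, -⟩ := hspec n (hlt n hn) h1 h2 h3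
      rcases lt_or_ge (P.gap (toRadon (u n)) (toRadon (v n)) / 2)
        (signedDualGap P c (uminus n) (w n)) with hg | hg
      · obtain ⟨-, -, hu, hε, -⟩ := h.recompute n hn hg
        rw [hu, hε]; exact ⟨h1, h2, h3⟩
      · obtain ⟨-, -, hε, -, uplus, -, -, hJ, hu⟩ := h.advance n hn hg
        have hJ' : P.J (toRadon (uminus (n + 1))) ≤ P.J (toRadon (u n)) := by
          rw [hu]; exact ((J_dropStep_le uplus).trans hJ).trans h8
        rw [hε]
        exact ⟨(hJ'.trans (hJu n (hlt n hn))).trans h1, h6, (hres hJ').trans h7⟩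
  have huM : ∀ n : ℕ, n < len → ‖toRadon (u n)‖ ≤ c.M := fun n hn =>
    hMJ _ ((hJu n hn).trans (hinv n hn).1)
  obtain ⟨Δ₁, hΔ₁, hcl⟩ := exists_clustered_dropStep hP hc
  obtain ⟨Δ₂, hΔ₂, q₀, hq₀, hlsi⟩ := exists_lsi_contraction hP hc hγ hθ hM hubar
  refine exists_geometric_of_steps (a := fun n => P.residual (toRadon (uminus n)))
    (b := fun n => P.residual (toRadon (u n))) (Ψ := Ψ) (k := k) (s := s)
    (G := fun n => Clustered P c ubar Abar (uminus n)) (r₀ := 2 * c.M * ε₁) (Δ := min Δ₁ Δ₂)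
    (q₀ := q₀) (D := 32 * c.L * c.M ^ 2 * c.CK ^ 2) (by positivity) (lt_min hΔ₁ hΔ₂) hq₀
    (by positivity) ?_ h.init_k h.init_s
    (fun n _ => Problem.residual_nonneg hmin _) (fun n hn => hres (hJu n hn)) fun n hn => ?_
  · rw [h.init_uminus]
    exact (hres (J_dropStep_le u₀)).trans hr₀
  have hn' := hlt n hn
  obtain ⟨h1, h2, h3⟩ := hinv n hn'
  obtain ⟨h4, h5, -, -, h8, h9⟩ := hspec n hn' h1 h2 h3
  have hcs := h.coefficient n hn'
  rcases lt_or_ge (P.gap (toRadon (u n)) (toRadon (v n)) / 2)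
    (signedDualGap P c (uminus n) (w n)) with hg | hg
  · left
    obtain ⟨hk, hs, hu, -, hΨ⟩ := h.recompute n hn hg
    have hcs' := h.coefficient (n + 1) hn
    rw [hu] at hcs'
    -- Both iterates come from the same input, so the next dual gap bounds their difference.
    have hgap : P.gap (toRadon (u (n + 1))) (toRadon (u n)) ≤ Ψ (n + 1) := by
      have := gap_le_signedDualGap (c := c) hcs'.1 hcs.1 (by
        rw [← norm_signedMeasure hcs.1, ← hcs.2.2.2]; exact huM n hn')
      rw [← hcs.2.2.2, ← hcs'.2.2.2] at this
      exact this.trans hcs'.2.2.1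
    have hJ := (P.J_sub_le_gap (toRadon (u (n + 1))) (toRadon (u n))).trans hgap
    refine ⟨hk, hs, hΨ, by rw [hu], by rw [hu], ?_, ?_⟩
    -- The residual is at most twice the gap, which is less than twice the dual gap.
    · linarith [hcs.2.2.1]
    · rw [Problem.residual_eq hmin, Problem.residual_eq hmin]; linarith
  · right
    obtain ⟨hk, hs, -, hΨ, uplus, -, hJt, hJh, hu⟩ := h.advance n hn hg
    have hJd := J_dropStep_le (c := c) uplus
    rw [← hu] at hJd
    refine ⟨hk, hs, hΨ, hres ((hJd.trans hJh).trans h8), ?_, fun hb => ?_, fun hG hb => ?_⟩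
    · have := (hJd.trans hJh).trans h9
      rw [Problem.residual_eq hmin (toRadon (uminus (n + 1)))]
      have e := Problem.residual_eq hmin (toRadon (u n))
      linarith
    · rw [hu]
      exact hcl _ ((hres (hJh.trans h8)).trans (hb.trans (min_le_left _ _)))
    · rcases (Problem.residual_nonneg hmin (toRadon (u n))).eq_or_lt with h0 | h0
      · rw [← h0, mul_zero, h0]
        exact hres ((hJd.trans hJh).trans h8)
      · refine (hres (hJd.trans hJt)).trans ?_
        refine hlsi _ _ _ _ _ hG hcs (hb.trans (min_le_right _ _)) (huM n hn') ?_ h0 (h.lsi n hn')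
        linarith [gap_le_maxGap (P := P) (c := c) (toRadon (u n)) h4]

end SparseMin

theorem mainTheorem3 {d : ℕ} (hd : 1 ≤ d) {Y : Type*} [NormedAddCommGroup Y]
    [InnerProductSpace ℝ Y] [CompleteSpace Y] (P : SparseMin.Problem d Y)
    (ubar : SparseMin.RadonMeasure P.Ω) (Abar : Finset (EuclideanSpace ℝ (Fin d)))
    (R' σ' γ θ : ℝ) (hP : P.IsNondegenerate ubar Abar R' σ' γ θ) :
    (∃ Rtilde, 0 < Rtilde ∧ Rtilde ≤ R' ∧ ∀ R, 0 < R → R < Rtilde →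
      ∃ σ, 0 < σ ∧ σ ≤ σ' ∧ P.IsLocalization ubar Abar θ R σ) ∧
    ∀ c : SparseMin.Params, c.γ = γ → c.θ = θ → c.IsAdmissible P ubar Abar R' σ' →
      ∀ (u₀ : SparseMin.SparseMeasure P.Ω) (ε₁ Ψ₁ : ℝ), 0 < c.M →
        (∀ v : SparseMin.RadonMeasure P.Ω, P.J v ≤ P.J (SparseMin.toRadon u₀) → ‖v‖ ≤ c.M) →
        0 < ε₁ → P.residual (SparseMin.toRadon u₀) ≤ 2 * c.M * ε₁ → 0 < Ψ₁ →
        ∀ (len : ℕ∞) (k s : ℕ → ℕ)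
          (uminus u w utilde uhat v : ℕ → SparseMin.SparseMeasure P.Ω) (ε εnext Ψ : ℕ → ℝ),
          SparseMin.IsLPDAPRun P c u₀ ε₁ Ψ₁ len k s uminus u w utilde uhat v ε εnext Ψ →
          ∀ ζ : ℝ, 0 < ζ → ζ < 1 →
            ∃ Ccheck : ℝ, 0 < Ccheck ∧ ∀ tol : ℝ, 0 < tol → tol < ζ →
              ∀ n : ℕ, n < len → Ccheck * Real.logb ζ tol ≤ (k n + s n : ℝ) →
                P.residual (SparseMin.toRadon (u n)) ≤ tol := by
  refine ⟨?_, ?_⟩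
  · obtain ⟨Rt, hRt0, hRt, h⟩ := hP.exists_isLocalization
    refine ⟨Rt, hRt0, hRt, fun R hR0 hR => ?_⟩
    obtain ⟨σ, hσ0, hσ, hloc⟩ := h R hR0 hR
    exact ⟨σ, hσ0, hσ, hloc.mono (by linarith [hP.θ_pos])⟩
  · intro c hγ hθ hc u₀ ε₁ Ψ₁ hM hMJ hε₁ hr₀ _ len k s uminus u w utilde uhat v ε εnext Ψ hrun
      ζ hζ hζ1
    obtain ⟨C, q, hC, hq, hq1, h⟩ :=
      hrun.exists_geometric hP hc hγ hθ hM hMJ hε₁ hr₀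
    obtain ⟨Cc, hCc, h'⟩ := SparseMin.exists_logb_rate hC hq hq1 hζ hζ1
    exact ⟨Cc, hCc, fun tol h0 htol n hn hks => h' tol h0 htol _ _ _
      (SparseMin.Problem.residual_nonneg hP.minimizer _) (h n hn).1 (h n hn).2 hks⟩
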